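/- **Setting.** Let $G$ be a finite simple triangulation of the sphere, given with its clockwise cyclic order of edges around each vertex, and let $\xi$ be a corner of $G$ (the root corner). The face incident to $\xi$ is the root face, and $G$ is drawn in the plane with the root face unbounded; its vertices in clockwise order are $v,A,B$ with $v$ incident to $\xi$. A 3-orientation of $(G,\xi)$ is an orientation of the edges in which $A,B,v$ have outdegrees $0,1,2$ and every other vertex has outdegree $3$; it is minimal if every directed cycle has $\xi$ on its left. Let $\overrightarrow{E}$ be the minimal 3-orientation of $(G,\xi)$. For $e=uw\in\overrightarrow{E}$, the leftmost path $P(e)=(u_0,u_1,\dots,u_\ell)$ from $e$ to $A$ is the directed path with $u_0=u$, $u_1=w$, $u_\ell=A$ such that, for $1\le i\le \ell-1$, $u_iu_{i+1}$ is the first outgoing edge at $u_i$ in clockwise order starting from $\{u_{i-1},u_i\}$. **Labels.** Let $T'$ be the spanning tree of $V(G)\setminus\{A,B\}$, with all edges oriented in $\overrightarrow{E}$ towards $v$, such that every $xy\in\overrightarrow{E}$ with $\{x,y\}\notin E(T')$ and $y\notin\{A,B\}$ is met at $x$ before it is met at $y$ in the clockwise contour exploration of $T'$ inside $G$ starting from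 $\xi$. Attach a stem ending at a bud to $x$ in place of each $xy\in\overrightarrow{E}$ with $\{x,y\}\notin E(T')$ and $x\neq B$; the result is the balanced blossoming tree $\mathrm T$ whose closure is $(G,\xi)$. Label the corners of $\mathrm T$ along its clockwise contour exploration from $\xi$: the label of $\xi$ is $2$; it decreases by $1$ on passing from a non-bud to a non-bud, is unchanged on passing from a non-bud to a bud, and increases by $1$ on passing from a bud to a non-bud. For $y\in V(G)\setminus\{A,B\}$ let $Y_{\mathrm T}(y)$ be the smallest label of a corner of $\mathrm T$ at $y$, and put $Y_{\mathrm T}(A)=1$, $Y_{\mathrm T}(B)=2$. **Winding number.** For $e=uw\in\overrightarrow{E}$ and a simple path $Q$ from $u$ to $A$, let $w(Q,e)$ be the winding number (counterclockwise turns counted positively) of the closed curve that follows $Q$ from $u$ to $A$ and then $P(e)$ backwards from $A$ to $u$, around a point in the face of $G$ on the right of $uw$, where the reference point (the point at infinity) is in the root face. **Sides of a cycle.** For a simple cycle $C$ of $G$ with a direction of traversal (which need not agree with $\overrightarrow{E}$), let $V^l(C)$, resp. $V^r(C)$, be the set of vertices lying on or to the left, resp. on or to the right, of $C$. Write $|Q|$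 for the number of vertices of a path $Q$, and $G[W]$ for the subgraph of $G$ induced by $W$. **Proposition.** Let $e=uw\in\overrightarrow{E}$ and let $Q$ be a shortest path in $G$ from $u$ to $A$. If $w(Q,e)<-2$, then there is an oriented simple cycle $C$ in $G$, of length (number of edges) at most $$\frac{6(|Q|-1)}{-w(Q,e)-2},$$ such that $G[V^l(C)]$ and $G[V^r(C)]$ each have diameter at least $\lfloor -w(Q,e)/3\rfloor-2$, and such that for $h\in\{l,r\}$ $$\max_{y\in V^h(C)}Y_{\mathrm T}(y)-\min_{y\in V^h(C)}Y_{\mathrm T}(y)\ \ge\ \lfloor -w(Q,e)/3\rfloor .$$ -/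

import Mathlib

/-- A connected simple graph together with, around every vertex, a cyclic order of the incident
edges. A dart is an oriented edge; `rot d` is the dart that follows `d` in clockwise order around
the tail `d.fst` of `d`. -/
structure RotationSystem (V : Type*) where
  graph : SimpleGraph V
  connected : graph.Connected
  rot : Equiv.Perm graph.Dart
  rot_fst : ∀ d, (rot d).fst = d.fst
  rot_sameCycle : ∀ d d' : graph.Dart, d.fst = d'.fst → rot.SameCycle d d'

namespace RotationSystem

variable {V : Type*} (M : RotationSystem V)

/-- The next dart along the boundary of the face on the left of `d`: arriving at the head of `d`,
take the edge that follows `d` clockwise around that vertex. -/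
def faceNext : Equiv.Perm M.graph.Dart :=
  (SimpleGraph.Dart.symm_involutive (G := M.graph)).toPerm.trans M.rot

/-- The faces are the orbits of `faceNext`. -/
def Face : Type _ := Quotient (Equiv.Perm.SameCycle.setoid M.faceNext)

/-- The face on the left of a dart. Corners of the map correspond to darts: the dart `d` stands for
the corner at `d.fst` lying just before `d` in clockwise order (that is, on the left of `d`), and
this corner is incident to `M.leftFace d`. -/
def leftFace (d : M.graph.Dart) : M.Face := Quotient.mk _ d

/-- The face on the right of a dart. -/
def rightFace (d : M.graph.Dart) : M.Face := M.leftFace d.symm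

/-- Two faces are adjacent off `C` if they are the two sides of an edge not traversed by `C`. -/
def AdjOff {a : V} (C : M.graph.Walk a a) (f g : M.Face) : Prop :=
  ∃ d : M.graph.Dart, d.edge ∉ C.edges ∧ M.leftFace d = f ∧ M.rightFace d = g

/-- The faces on the left of an oriented cycle `C`: those that can be reached, without crossing
`C`, from a face lying immediately on the left of an edge of `C`. -/
def leftFaces {a : V} (C : M.graph.Walk a a) : Set M.Face :=
  {f | ∃ d ∈ C.darts, Relation.ReflTransGen (M.AdjOff C) (M.leftFace d) f}

/-- The faces on the right of an oriented cycle. -/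
def rightFaces {a : V} (C : M.graph.Walk a a) : Set M.Face :=
  {f | ∃ d ∈ C.darts, Relation.ReflTransGen (M.AdjOff C) (M.rightFace d) f}

/-- The vertices lying on, or to the left of, an oriented cycle. -/
def leftVertices {a : V} (C : M.graph.Walk a a) : Set V :=
  {v | v ∈ C.support ∨ ∃ d : M.graph.Dart, d.fst = v ∧ M.leftFace d ∈ M.leftFaces C}

/-- The vertices lying on, or to the right of, an oriented cycle. -/
def rightVertices {a : V} (C : M.graph.Walk a a) : Set V :=
  {v | v ∈ C.support ∨ ∃ d : M.graph.Dart, d.fst = v ∧ M.leftFace d ∈ M.rightFaces C}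

open Classical in
/-- `h f` is the winding number of the closed walk `C` around the points of the face `f`, where
the reference point (the point at infinity) is in the face `r`. It vanishes in `r`, and crossing a
dart from its right to its left increases it by the net number of times that `C` follows the
dart; so a counterclockwise turn counts `+1`. On the sphere there is exactly one such function. -/
def IsWindingFunction {a : V} (C : M.graph.Walk a a) (r : M.Face) (h : M.Face → ℤ) : Prop :=
  h r = 0 ∧ ∀ d : M.graph.Dart,
    h (M.leftFace d) - h (M.rightFace d) = (C.darts.count d : ℤ) - (C.darts.count d.symm : ℤ)

open Classical in
/-- The winding number of the closed walk `C` around a point of the face `x`, relative to a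
reference point in the face `r`. -/
noncomputable def wind {a : V} (r x : M.Face) (C : M.graph.Walk a a) : ℤ :=
  if h : ∃ f, M.IsWindingFunction C r f then h.choose x else 0

end RotationSystem

/-- A planar map (with at least one edge), up to orientation-preserving homeomorphism: a rotation
system whose faces satisfy Euler's formula for the sphere. -/
structure PlanarMap (V : Type*) extends RotationSystem V where
  euler : Nat.card V + Nat.card toRotationSystem.Face = Nat.card graph.edgeSet + 2

/-- A planted simple triangulation of the sphere. As there are no loops, `triangle` says that all
faces have degree three. The root corner is the one on the left of the dart `root`. -/
structure PlantedTriangulation (V : Type*) extends PlanarMap V where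
  triangle : ∀ d, toRotationSystem.faceNext
    (toRotationSystem.faceNext (toRotationSystem.faceNext d)) = d
  root : graph.Dart

namespace PlantedTriangulation

variable {V : Type*} (G : PlantedTriangulation V)

/-- The face incident to the root corner. -/
def rootFace : G.Face := G.leftFace G.root

/-- When `G` is drawn in the plane with the root face unbounded, the vertices of the root face are,
in clockwise order, `rootVertex`, `A`, `B`. -/
def rootVertex : V := G.root.fst

/-- The vertex `A` of the root face. -/
def A : V := G.root.snd

/-- The vertex `B` of the root face. -/
def B : V := (G.faceNext G.root).snd

/-- `E` contains exactly one orientation of each edge; `A`, `B` and the root vertex have outdegrees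
`0`, `1` and `2`, and all other vertices have outdegree `3`. -/
structure IsThreeOrientation (E : Set G.graph.Dart) : Prop where
  orientation : ∀ d, d.symm ∈ E ↔ d ∉ E
  outdeg_A : {d | d ∈ E ∧ d.fst = G.A}.ncard = 0
  outdeg_B : {d | d ∈ E ∧ d.fst = G.B}.ncard = 1
  outdeg_root : {d | d ∈ E ∧ d.fst = G.rootVertex}.ncard = 2
  outdeg : ∀ v, v ≠ G.A → v ≠ G.B → v ≠ G.rootVertex → {d | d ∈ E ∧ d.fst = v}.ncard = 3

/-- A 3-orientation is minimal if it has no counterclockwise directed cycle, i.e. if every directed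
cycle has the root corner on its left. -/
structure IsMinimalThreeOrientation (E : Set G.graph.Dart) : Prop extends
    G.IsThreeOrientation E where
  minimal : ∀ (a : V) (C : G.graph.Walk a a), C.IsCycle → (∀ d ∈ C.darts, d ∈ E) →
    G.rootFace ∈ G.leftFaces C

/-- `d'` is the first outgoing dart after `d`, when the edges at the head of `d` are considered in
clockwise order starting from `d`. -/
def IsFirstOutgoing (E : Set G.graph.Dart) (d d' : G.graph.Dart) : Prop :=
  d' ∈ E ∧ ∃ k : ℕ, 1 ≤ k ∧ (G.rot ^ k) d.symm = d' ∧
    ∀ j : ℕ, 1 ≤ j → j < k → (G.rot ^ j) d.symm ∉ E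

/-- `P` is the leftmost path from the oriented edge `e` to `A`. -/
def IsLeftmostPath (E : Set G.graph.Dart) (e : G.graph.Dart) (P : G.graph.Walk e.fst G.A) : Prop :=
  P.darts.head? = some e ∧ P.darts.IsChain (G.IsFirstOutgoing E)

/-- The winding number of `Q` around `e`: the winding number of the closed curve that follows `Q`
and then the leftmost path `P` backwards, around a point in the face on the right of `e`, the
reference point being in the root face. -/
noncomputable def windingNumber {e : G.graph.Dart} (P Q : G.graph.Walk e.fst G.A) : ℤ :=
  G.wind G.rootFace (G.rightFace e) (Q.append P.reverse)

section Tree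

variable (T : Set G.graph.Dart)

open Classical in
/-- One step of the clockwise contour exploration of the tree with edge set `T` inside `G`. The
dart `d` stands for the current corner, so the edge of `d` is considered next: if it is a tree edge
it is followed, and otherwise it is passed over, the exploration staying at the same vertex. -/
noncomputable def contourNext (d : G.graph.Dart) : G.graph.Dart :=
  if d ∈ T ∨ d.symm ∈ T then G.rot d.symm else G.rot d

/-- The clockwise contour exploration, from the root corner. -/
noncomputable def contour (t : ℕ) : G.graph.Dart := (G.contourNext T)^[t] G.root

/-- The number of steps after which the contour exploration is back at the root corner. -/
noncomputable def contourLength : ℕ := Function.minimalPeriod (G.contourNext T) G.root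

/-- `T` (whose darts point from child to parent) is the set of inner edges of the balanced
blossoming tree whose closure is `G`: it is a spanning tree of `V ∖ {A, B}` in which all edges are
oriented towards the root vertex in `E`, and each edge of `E` outside `T` is met by the
contour exploration at its tail before it is met at its head (if its head is in the tree at all).
The stems of the blossoming tree are the darts of `E` outside `T`, attached to their tails, except
the dart from `B` to `A`. -/
structure IsBlossomingTree (E : Set G.graph.Dart) : Prop where
  oriented : T ⊆ E
  avoids : ∀ d ∈ T, d.fst ≠ G.A ∧ d.fst ≠ G.B ∧ d.snd ≠ G.A ∧ d.snd ≠ G.B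
  root_no_parent : ∀ d ∈ T, d.fst ≠ G.rootVertex
  parent_unique : ∀ d ∈ T, ∀ d' ∈ T, d.fst = d'.fst → d = d'
  reaches_root : ∀ v, v ≠ G.A → v ≠ G.B →
    Relation.ReflTransGen (fun x y => ∃ d ∈ T, d.fst = x ∧ d.snd = y) v G.rootVertex
  tail_first : ∀ d ∈ E, d ∉ T → d.snd ≠ G.A → d.snd ≠ G.B →
    ∃ s t : ℕ, s < t ∧ t < G.contourLength T ∧ G.contour T s = d ∧ G.contour T t = d.symm

variable (E : Set G.graph.Dart)

open Classical in
/-- The labels of the corners of the blossoming tree, in the order of its contour exploration. The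
label starts at `2`, decreases by one along an inner edge, and increases by one after the visit of
a bud (it is unchanged on the way to the bud and increases on the way back). An edge
that is neither in the tree nor a stem at the current vertex is not there in the blossoming tree,
and the label does not change when it is passed over. -/
noncomputable def cornerLabel : ℕ → ℤ
  | 0 => 2
  | t + 1 =>
      if G.contour T t ∈ T ∨ (G.contour T t).symm ∈ T then cornerLabel t - 1
      else if G.contour T t ∈ E then cornerLabel t + 1
      else cornerLabel t

open Classical in
/-- The vertex labels `Y`: `1` at `A`, `2` at `B`, and elsewhere the smallest label of a corner of
the blossoming tree at the vertex. -/
noncomputable def label (v : V) : ℤ :=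
  if v = G.A then 1
  else if v = G.B then 2
  else sInf {l | ∃ t < G.contourLength T, (G.contour T t).fst = v ∧ G.cornerLabel T E t = l}

/-- The difference between the largest and the smallest label in a (finite nonempty) set of
vertices. -/
noncomputable def labelSpan (S : Set V) : ℤ :=
  sSup (G.label T E '' S) - sInf (G.label T E '' S)

end Tree

end PlantedTriangulation

/-!
For a position at which `Q` meets `P := P(e)`, follow `Q` up to it and come back along `P`. The
winding number of this lasso around the face on the right of `e` is `0` at the start of `Q` and
`w(Q, e)` at its end, and from one meeting with `P` to the next it changes by the winding number
of a simple cycle, made of an excursion of `Q` and of the part of `P` that the excursion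
bypasses. So it drops by at most one at a time, and when `3 m ≤ -w(Q, e)` one finds `m`
excursions, each at distance at least `m` from both ends of `Q`, at which it drops; the shortest
of them has at most `(|Q| - 1) / m - 2` edges.

At a drop the cycle separates the root face from the right of `e`. On the side without the root
face, Euler's formula and the outdegrees `3` show that the number of oriented edges that leave
the cycle into that side is the length of the cycle minus `3`. As `P` is leftmost, this count
first forces the excursion to go ahead along `P`, and then bounds the bypassed part of `P` by
two more than the excursion, whence the bound on the length of the cycle.

The ends of the excursion lie on the cycle and are far from both ends of the geodesic `Q`, of
which one is on each side of the cycle: this gives the diameters. The labels drop by at least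
one with each step of `P`, up to a total defect of two. This defect is made up for by the
bypassed part of `P`, which has at least two edges: from each end of `P` to the farther of the
two ends of the excursion there are at least `m + 2` steps of `P`.
-/

namespace RotationSystem

variable {V : Type*} (M : RotationSystem V)

instance finite_dart [Finite V] : Finite M.graph.Dart :=
  Finite.of_injective SimpleGraph.Dart.toProd SimpleGraph.Dart.toProd_injective

noncomputable instance fintypeDart [Finite V] : Fintype M.graph.Dart := Fintype.ofFinite _

instance finite_face [Finite V] : Finite M.Face := Quotient.finite _

theorem faceNext_apply (d : M.graph.Dart) : M.faceNext d = M.rot d.symm := rfl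

theorem faceNext_fst (d : M.graph.Dart) : (M.faceNext d).fst = d.snd := M.rot_fst d.symm

theorem leftFace_faceNext (d : M.graph.Dart) : M.leftFace (M.faceNext d) = M.leftFace d :=
  Quotient.sound (s := Equiv.Perm.SameCycle.setoid M.faceNext)
    (Equiv.Perm.sameCycle_apply_left.2 (Equiv.Perm.SameCycle.refl _ _))

theorem leftFace_eq_iff {d d' : M.graph.Dart} :
    M.leftFace d = M.leftFace d' ↔ M.faceNext.SameCycle d d' :=
  Quotient.eq (r := Equiv.Perm.SameCycle.setoid M.faceNext)

theorem leftFace_symm (d : M.graph.Dart) : M.leftFace d.symm = M.rightFace d := rfl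

theorem rightFace_symm (d : M.graph.Dart) : M.rightFace d.symm = M.leftFace d := by
  rw [rightFace, SimpleGraph.Dart.symm_symm]

theorem leftFace_rot (d : M.graph.Dart) : M.leftFace (M.rot d) = M.rightFace d := by
  rw [← leftFace_symm, ← M.leftFace_faceNext d.symm, faceNext_apply, SimpleGraph.Dart.symm_symm]

theorem rot_pow_succ_apply (d : M.graph.Dart) (n : ℕ) :
    (M.rot ^ (n + 1)) d = M.rot ((M.rot ^ n) d) := by
  rw [pow_succ', Equiv.Perm.mul_apply]

theorem rot_pow_fst (d : M.graph.Dart) (n : ℕ) : ((M.rot ^ n) d).fst = d.fst := by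
  induction n with
  | zero => rfl
  | succ n ih => rw [rot_pow_succ_apply, M.rot_fst, ih]

theorem rot_induction [Finite V] {p : M.graph.Dart → Prop} {d d' : M.graph.Dart} (hd : p d)
    (h : d.fst = d'.fst) (step : ∀ g, g.fst = d.fst → p g → p (M.rot g)) : p d' := by
  obtain ⟨n, rfl⟩ := (M.rot_sameCycle d d' h).exists_nat_pow_eq
  clear h
  induction n with
  | zero => exact hd
  | succ n ih => rw [rot_pow_succ_apply]; exact step _ (M.rot_pow_fst _ _) ih

theorem rot_induction_symm [Finite V] {p : M.graph.Dart → Prop} {d d' : M.graph.Dart} (hd : p d)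
    (h : d.fst = d'.fst) (step : ∀ g, g.fst = d.fst → p (M.rot g) → p g) : p d' :=
  by_contra fun hd' => M.rot_induction (p := fun g => ¬p g) hd' h.symm
    (fun g hg hn hp => hn (step g (hg.trans h.symm) hp)) hd

theorem face_induction [Finite V] {p : M.Face → Prop}
    (step : ∀ d, p (M.leftFace d) → p (M.rightFace d)) {f : M.Face} (hf : p f) (f' : M.Face) :
    p f' := by
  have around : ∀ d d' : M.graph.Dart, d.fst = d'.fst → p (M.leftFace d) → p (M.leftFace d') :=
    fun d d' h hd => M.rot_induction (p := fun g => p (M.leftFace g)) hd h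
      fun g _ hg => by rw [M.leftFace_rot]; exact step g hg
  have along : ∀ {x y : V}, M.graph.Walk x y → ∀ d d' : M.graph.Dart, d.fst = x → d'.fst = y →
      p (M.leftFace d) → p (M.leftFace d') := by
    intro x y W
    induction W with
    | nil => exact fun d d' hd hd' => around d d' (hd.trans hd'.symm)
    | cons hadj _ ih =>
      intro d d' hx hy hd
      let g : M.graph.Dart := ⟨(_, _), hadj⟩
      exact ih g.symm d' rfl hy (step g (around d g hx hd))
  induction f using Quotient.ind with | _ d
  induction f' using Quotient.ind with | _ d'
  obtain ⟨W⟩ := M.connected.preconnected d.fst d'.fst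
  exact along W d d' rfl rfl hf

theorem eq_of_forall_dart {α : Type*} {g : V → α} (hg : ∀ d : M.graph.Dart, g d.fst = g d.snd)
    (x y : V) : g x = g y := by
  obtain ⟨W⟩ := M.connected.preconnected x y
  induction W with
  | nil => rfl
  | cons hadj _ ih => exact (hg ⟨(_, _), hadj⟩).trans ih

section Orientation

/-- An orientation of the graph, given by the set of the darts that follow it: `E` contains exactly
one of the two darts of every edge. -/
def IsOrientation (E : Set M.graph.Dart) : Prop := ∀ d : M.graph.Dart, d.symm ∈ E ↔ d ∉ E

theorem exists_isOrientation : ∃ E, M.IsOrientation E := by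
  let : LinearOrder V := IsWellOrder.linearOrder WellOrderingRel
  refine ⟨{d | d.fst < d.snd}, fun d => ?_⟩
  change d.snd < d.fst ↔ ¬d.fst < d.snd
  exact ⟨lt_asymm, fun h => lt_of_le_of_ne (not_lt.1 h) d.adj.ne'⟩

variable {M} {E : Set M.graph.Dart}

theorem IsOrientation.bijective_edge (hE : M.IsOrientation E) :
    Function.Bijective fun d : E => (⟨d.1.edge, d.1.edge_mem⟩ : M.graph.edgeSet) := by
  refine ⟨?_, ?_⟩
  · rintro ⟨d, hd⟩ ⟨d', hd'⟩ h
    simp only [Subtype.mk.injEq, SimpleGraph.dart_edge_eq_iff] at h ⊢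
    rcases h with rfl | rfl
    · rfl
    · exact absurd hd' ((hE d').1 hd)
  · rintro ⟨e, he⟩
    induction e with
    | _ x y =>
      let d : M.graph.Dart := ⟨(x, y), he⟩
      by_cases hd : d ∈ E
      · exact ⟨⟨d, hd⟩, rfl⟩
      · exact ⟨⟨d.symm, (hE d).2 hd⟩, Subtype.ext (SimpleGraph.Dart.edge_symm d)⟩

theorem IsOrientation.ncard_eq (hE : M.IsOrientation E) :
    E.ncard = Nat.card M.graph.edgeSet := by
  rw [← Nat.card_coe_set_eq]
  exact Nat.card_congr (Equiv.ofBijective _ hE.bijective_edge)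

end Orientation

section Coboundary

variable [Finite V]

/-- Every vertex function telescopes around the faces, and every face function changes sign with
the dart, so the two kinds of coboundaries are orthogonal. -/
theorem sum_sub_mul_sub_eq_zero {α : Type*} [CommRing α] (h : M.Face → α) (g : V → α) :
    ∑ d, (h (M.leftFace d) - h (M.rightFace d)) * (g d.snd - g d.fst) = 0 := by
  have hleft : ∑ d, h (M.leftFace d) * (g d.snd - g d.fst) = 0 := by
    simp only [mul_sub, Finset.sum_sub_distrib, sub_eq_zero]
    refine Fintype.sum_equiv M.faceNext _ _ fun d => ?_
    rw [M.leftFace_faceNext, M.faceNext_fst]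
  have hright : ∑ d, h (M.rightFace d) * (g d.snd - g d.fst) =
      -∑ d, h (M.leftFace d) * (g d.snd - g d.fst) := by
    rw [← Finset.sum_neg_distrib]
    refine Fintype.sum_equiv SimpleGraph.Dart.symm_involutive.toPerm _ _ fun d => ?_
    change _ = -(h (M.leftFace d.symm) * (g d.fst - g d.snd))
    rw [M.leftFace_symm]; ring
  simp only [sub_mul, Finset.sum_sub_distrib, hright, hleft, neg_zero, sub_zero]

/-- The joint coboundary map of rational functions on the faces and on the vertices, with values in
the functions on the darts. -/
def coboundary : (M.Face → ℚ) × (V → ℚ) →ₗ[ℚ] (M.graph.Dart → ℚ) where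
  toFun p d := p.1 (M.leftFace d) - p.1 (M.rightFace d) + (p.2 d.snd - p.2 d.fst)
  map_add' p q := by ext d; simp only [Prod.fst_add, Prod.snd_add, Pi.add_apply]; ring
  map_smul' c p := by
    ext d
    simp only [Prod.smul_fst, Prod.smul_snd, Pi.smul_apply, smul_eq_mul, RingHom.id_apply]
    ring

omit [Finite V] in
theorem coboundary_apply (p : (M.Face → ℚ) × (V → ℚ)) (d : M.graph.Dart) : M.coboundary p d =
    p.1 (M.leftFace d) - p.1 (M.rightFace d) + (p.2 d.snd - p.2 d.fst) := rfl

omit [Finite V] in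
theorem coboundary_symm (p : (M.Face → ℚ) × (V → ℚ)) (d : M.graph.Dart) :
    M.coboundary p d.symm = -M.coboundary p d := by
  rw [coboundary_apply, coboundary_apply, leftFace_symm, rightFace_symm]
  change _ + (p.2 d.fst - p.2 d.snd) = _
  ring

theorem snd_eq_of_sum_coboundary_mul_eq_zero {p : (M.Face → ℚ) × (V → ℚ)}
    (hp : ∑ d, M.coboundary p d * (p.2 d.snd - p.2 d.fst) = 0) (x y : V) : p.2 x = p.2 y := by
  have hsq : ∑ d : M.graph.Dart, (p.2 d.snd - p.2 d.fst) ^ 2 = 0 := by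
    rw [← hp, ← sub_eq_zero, ← Finset.sum_sub_distrib, ← neg_eq_zero, ← Finset.sum_neg_distrib,
      ← M.sum_sub_mul_sub_eq_zero p.1 p.2]
    refine Finset.sum_congr rfl fun d _ => ?_
    rw [coboundary_apply]; ring
  refine M.eq_of_forall_dart (fun d => ?_) x y
  have := (Finset.sum_eq_zero_iff_of_nonneg fun d _ => sq_nonneg _).1 hsq d (Finset.mem_univ d)
  exact (sub_eq_zero.1 (sq_eq_zero_iff.1 this)).symm

/-- The vertices in the interior of the union of the faces in `R`: all their corners are in `R`. -/
def innerVertices (R : Set M.Face) : Set V := {x | ∀ d : M.graph.Dart, d.fst = x → M.leftFace d ∈ R}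

/-- The darts of `E` in the interior of the union of the faces in `R`. -/
def innerDarts (E : Set M.graph.Dart) (R : Set M.Face) : Set M.graph.Dart :=
  {d | d ∈ E ∧ M.leftFace d ∈ R ∧ M.rightFace d ∈ R}

/-- The faces of `R` are connected to each other by crossing edges without leaving `R`. -/
def IsFaceConnected (R : Set M.Face) : Prop := ∀ f ∈ R, ∀ g ∈ R,
  Relation.ReflTransGen (fun f g => f ∈ R ∧ g ∈ R ∧ ∃ d, M.leftFace d = f ∧ M.rightFace d = g) f g

variable {M}

theorem isFaceConnected_univ : M.IsFaceConnected Set.univ := fun f _ g _ =>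
  M.face_induction (p := Relation.ReflTransGen _ f)
    (fun d h => h.tail ⟨trivial, trivial, d, rfl, rfl⟩) .refl g

omit [Finite V] in
theorem IsFaceConnected.eq {R : Set M.Face} (hR : M.IsFaceConnected R) {α : Type*}
    {h : M.Face → α}
    (hh : ∀ d, M.leftFace d ∈ R → M.rightFace d ∈ R → h (M.leftFace d) = h (M.rightFace d))
    {f g : M.Face} (hf : f ∈ R) (hg : g ∈ R) : h f = h g := by
  have hfg := hR f hf g hg
  clear hg
  induction hfg with
  | refl => rfl
  | tail _ hadj ih =>
    obtain ⟨h1, h2, d, rfl, rfl⟩ := hadj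
    exact ih.trans (hh d h1 h2)

variable {E : Set M.graph.Dart} {R : Set M.Face}

omit [Finite V] in
theorem leftFace_mem_of_mem_innerVertices {d : M.graph.Dart} (hd : d.fst ∈ M.innerVertices R) :
    M.leftFace d ∈ R ∧ M.rightFace d ∈ R :=
  ⟨hd d rfl, M.leftFace_rot d ▸ hd (M.rot d) (M.rot_fst d)⟩

theorem IsFaceConnected.eq_zero_of_coboundary_eq_zero (hR : M.IsFaceConnected R) {x₀ : V}
    {f₀ : M.Face} (hf₀ : f₀ ∈ R) {p : (M.Face → ℚ) × (V → ℚ)} (hface : ∀ f ∉ R, p.1 f = 0)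
    (hvert : ∀ x ∉ M.innerVertices R \ {x₀}, p.2 x = 0) (h0 : p.1 f₀ = 0)
    (hp : ∀ d, M.leftFace d ∈ R → M.rightFace d ∈ R → M.coboundary p d = 0) : p = 0 := by
  have hvert0 : ∀ x, p.2 x = 0 := by
    intro x
    rw [M.snd_eq_of_sum_coboundary_mul_eq_zero (Finset.sum_eq_zero fun d _ => ?_) x x₀]
    · exact hvert x₀ fun h => h.2 rfl
    · by_cases hd : M.leftFace d ∈ R ∧ M.rightFace d ∈ R
      · rw [hp d hd.1 hd.2, zero_mul]
      · rw [hvert d.fst fun h => hd (leftFace_mem_of_mem_innerVertices h.1), hvert d.snd, sub_zero,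
          mul_zero]
        intro h
        have := leftFace_mem_of_mem_innerVertices (d := d.symm) h.1
        rw [rightFace_symm, leftFace_symm] at this
        exact hd this.symm
  refine Prod.ext (funext fun f => ?_) (funext hvert0)
  by_cases hf : f ∈ R
  · refine (hR.eq (fun d hl hr => ?_) hf hf₀).trans h0
    have := hp d hl hr
    rwa [coboundary_apply, hvert0, hvert0, sub_zero, add_zero, sub_eq_zero] at this
  · exact hface f hf

/-- The coboundary map restricted to the functions that vanish off the faces in `R` and the
vertices in `U`, read on the darts in the interior of `R`, together with the value at the base face
`f₀`, which removes the constants from its kernel. -/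
noncomputable def regionCoboundary (E : Set M.graph.Dart) (R : Set M.Face) (U : Set V)
    (f₀ : M.Face) : (R → ℚ) × (U → ℚ) →ₗ[ℚ] (M.innerDarts E R → ℚ) × ℚ :=
  ((LinearMap.funLeft ℚ ℚ Subtype.val).comp M.coboundary |>.prod
    ((LinearMap.proj f₀).comp (LinearMap.fst ℚ _ _))).comp
      ((Function.ExtendByZero.linearMap ℚ Subtype.val).prodMap
        (Function.ExtendByZero.linearMap ℚ Subtype.val))

theorem IsFaceConnected.regionCoboundary_injective (hR : M.IsFaceConnected R)
    (hE : M.IsOrientation E) {f₀ : M.Face} (hf₀ : f₀ ∈ R) (x₀ : V) :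
    Function.Injective (regionCoboundary E R (M.innerVertices R \ {x₀}) f₀) := by
  rw [← LinearMap.ker_eq_bot, LinearMap.ker_eq_bot']
  rintro ⟨h, g⟩ hp
  have hdart := congrFun (congrArg Prod.fst hp)
  have hbase := congrArg Prod.snd hp
  have hzero := hR.eq_zero_of_coboundary_eq_zero (x₀ := x₀) hf₀
    (p := (Function.extend Subtype.val h 0, Function.extend Subtype.val g 0))
    (fun f hf => Function.extend_apply' _ _ _ (by simpa using hf))
    (fun f hf => Function.extend_apply' _ _ _ (by simpa using hf)) hbase fun d hl hr => by
      by_cases hd : d ∈ E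
      · exact hdart ⟨d, hd, hl, hr⟩
      · rw [← neg_eq_zero, ← coboundary_symm]
        exact hdart ⟨d.symm, (hE d).2 hd, hr, by rwa [rightFace_symm]⟩
  rw [Prod.mk_eq_zero] at hzero
  refine Prod.ext (funext fun f => ?_) (funext fun x => ?_)
  · simpa [Subtype.val_injective.extend_apply] using congrFun hzero.1 f.1
  · simpa [Subtype.val_injective.extend_apply] using congrFun hzero.2 x.1

theorem IsFaceConnected.ncard_add_ncard_le (hR : M.IsFaceConnected R) (hE : M.IsOrientation E)
    (hne : R.Nonempty) (x₀ : V) :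
    R.ncard + (M.innerVertices R \ {x₀}).ncard ≤ (M.innerDarts E R).ncard + 1 := by
  classical
  have := Fintype.ofFinite M.Face
  have := Fintype.ofFinite V
  have := LinearMap.finrank_le_finrank_of_injective
    (hR.regionCoboundary_injective hE hne.some_mem x₀)
  simp only [Module.finrank_prod, Module.finrank_fintype_fun_eq_card, Module.finrank_self] at this
  simpa only [← Nat.card_coe_set_eq, Nat.card_eq_fintype_card] using this

end Coboundary

section Potential

variable {α : Type*} [AddCommGroup α]

/-- `φ` is the coboundary of the function `h` on the faces: crossing a dart from its right to its
left increases `h` by `φ`. -/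
def IsPotential (φ : M.graph.Dart → α) (h : M.Face → α) : Prop :=
  ∀ d, h (M.leftFace d) - h (M.rightFace d) = φ d

variable {M} [Finite V]

theorem IsPotential.sub_eq {φ : M.graph.Dart → α} {h h' : M.Face → α} (hh : M.IsPotential φ h)
    (hh' : M.IsPotential φ h') (f f' : M.Face) : h f - h f' = h' f - h' f' := by
  have hconst : h f - h' f = h f' - h' f' :=
    isFaceConnected_univ.eq (h := fun f => h f - h' f)
      (fun d _ _ => sub_eq_sub_iff_sub_eq_sub.2 ((hh d).trans (hh' d).symm)) trivial trivial
  exact sub_eq_sub_iff_sub_eq_sub.1 hconst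

theorem IsPotential.exists_int {φ : M.graph.Dart → ℤ} {h : M.Face → ℚ}
    (hh : M.IsPotential (fun d => (φ d : ℚ)) h) : ∃ h' : M.Face → ℤ, M.IsPotential φ h' := by
  rcases isEmpty_or_nonempty M.Face with hempty | ⟨⟨f₀⟩⟩
  · exact ⟨fun _ => 0, fun d => (hempty.false (M.leftFace d)).elim⟩
  have hint : ∀ f, ∃ n : ℤ, h f = h f₀ + n :=
    M.face_induction (p := fun f => ∃ n : ℤ, h f = h f₀ + n) (f := f₀)
      (fun d ⟨n, hn⟩ => ⟨n - φ d, by have := hh d; push_cast; linarith⟩) ⟨0, by simp⟩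
  choose h' hh' using hint
  refine ⟨h', fun d => ?_⟩
  have := hh d
  simp only [hh' (M.leftFace d), hh' (M.rightFace d), add_sub_add_left_eq_sub] at this
  exact_mod_cast this

end Potential

end RotationSystem

namespace PlanarMap

open RotationSystem

variable {V : Type*} [Finite V] (M : PlanarMap V)

/-- The dimensions agree by Euler's formula: this is where the genus enters. -/
theorem exists_coboundary_eq {φ : M.graph.Dart → ℚ} (hφ : ∀ d, φ d.symm = -φ d) :
    ∃ p, M.coboundary p = φ := by
  classical
  have := Fintype.ofFinite M.Face
  have := Fintype.ofFinite V
  rcases isEmpty_or_nonempty M.graph.Dart with hempty | ⟨⟨d₀⟩⟩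
  · exact ⟨0, funext fun d => hempty.elim d⟩
  obtain ⟨E, hE⟩ := M.exists_isOrientation
  set x₀ := d₀.fst
  set U := M.innerVertices Set.univ \ {x₀} with hU
  have hinj := isFaceConnected_univ.regionCoboundary_injective hE (Set.mem_univ (M.leftFace d₀)) x₀
  have hcard : Module.finrank ℚ ((↥(Set.univ : Set M.Face) → ℚ) × (↥U → ℚ)) =
      Module.finrank ℚ ((↥(M.innerDarts E Set.univ) → ℚ) × ℚ) := by
    have hvert : U.ncard + 1 = Nat.card V := by
      rw [show U = {x₀}ᶜ by ext; simp [hU, innerVertices], ← Set.ncard_singleton x₀, add_comm,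
        Set.ncard_add_ncard_compl]
    have hdart : (M.innerDarts E Set.univ).ncard = E.ncard := by simp [innerDarts]
    simp only [Module.finrank_prod, Module.finrank_fintype_fun_eq_card, Module.finrank_self,
      ← Nat.card_eq_fintype_card, Nat.card_coe_set_eq, Set.ncard_univ]
    have := M.euler
    have := hE.ncard_eq
    omega
  obtain ⟨⟨h, g⟩, hhg⟩ := (LinearMap.injective_iff_surjective_of_finrank_eq_finrank hcard).1 hinj
    (fun d => φ d.1, 0)
  set p := (Function.extend Subtype.val h (0 : M.Face → ℚ),
    Function.extend Subtype.val g (0 : V → ℚ))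
  have hp : ∀ d ∈ E, M.coboundary p d = φ d :=
    fun d hd => congrFun (congrArg Prod.fst hhg) ⟨d, hd, trivial, trivial⟩
  refine ⟨p, funext fun d => ?_⟩
  by_cases hd : d ∈ E
  · exact hp d hd
  · rw [← neg_inj, ← coboundary_symm, ← hφ, hp _ ((hE d).2 hd)]

theorem exists_isPotential {φ : M.graph.Dart → ℤ} (hanti : ∀ d, φ d.symm = -φ d)
    (hcirc : ∀ g : V → ℚ, ∑ d, (φ d : ℚ) * (g d.snd - g d.fst) = 0) :
    ∃ h, M.IsPotential φ h := by
  obtain ⟨p, hp⟩ := M.exists_coboundary_eq (φ := fun d => (φ d : ℚ))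
    fun d => by rw [hanti, Int.cast_neg]
  refine IsPotential.exists_int (h := p.1) fun d => ?_
  have hconst := M.snd_eq_of_sum_coboundary_mul_eq_zero (by rw [hp]; exact hcirc p.2) d.snd d.fst
  change _ = (φ d : ℚ)
  rw [← congrFun hp d, coboundary_apply, hconst, sub_self, add_zero]

end PlanarMap

section Walk

variable {V : Type*} {G : SimpleGraph V} {a b c : V}

theorem dart_edge_mem_edges_iff {W : G.Walk a b} {d : G.Dart} :
    d.edge ∈ W.edges ↔ d ∈ W.darts ∨ d.symm ∈ W.darts := by
  simp only [SimpleGraph.Walk.edges, List.mem_map, SimpleGraph.dart_edge_eq_iff]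
  constructor
  · rintro ⟨g, hg, rfl | rfl⟩
    · exact .inl hg
    · exact .inr hg
  · rintro (h | h)
    · exact ⟨d, h, .inl rfl⟩
    · exact ⟨d.symm, h, .inr rfl⟩

open Classical in
/-- The net number of times that the walk `W` follows the dart `d`. -/
noncomputable def walkFlow (W : G.Walk a b) (d : G.Dart) : ℤ :=
  (W.darts.count d : ℤ) - (W.darts.count d.symm : ℤ)

theorem walkFlow_symm (W : G.Walk a b) (d : G.Dart) : walkFlow W d.symm = -walkFlow W d := by
  rw [walkFlow, SimpleGraph.Dart.symm_symm, walkFlow, neg_sub]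

@[simp]
theorem walkFlow_nil (d : G.Dart) : walkFlow (.nil : G.Walk a a) d = 0 := by
  simp [walkFlow]

theorem walkFlow_append (W : G.Walk a b) (W' : G.Walk b c) (d : G.Dart) :
    walkFlow (W.append W') d = walkFlow W d + walkFlow W' d := by
  simp only [walkFlow, SimpleGraph.Walk.darts_append, List.count_append]
  push_cast; ring

theorem walkFlow_reverse (W : G.Walk a b) (d : G.Dart) :
    walkFlow W.reverse d = -walkFlow W d := by
  classical
  have hcount (g : G.Dart) : (W.darts.map SimpleGraph.Dart.symm).count g =
      W.darts.count g.symm := by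
    conv_lhs => rw [← SimpleGraph.Dart.symm_symm g]
    exact List.count_map_of_injective _ _ SimpleGraph.Dart.symm_involutive.injective _
  simp only [walkFlow, SimpleGraph.Walk.darts_reverse, List.count_reverse, hcount,
    SimpleGraph.Dart.symm_symm]
  ring

@[simp]
theorem walkFlow_copy {a' b' : V} (W : G.Walk a b) (h : a = a') (h' : b = b') :
    walkFlow (W.copy h h') = walkFlow W := by
  subst h h'; rfl

theorem walkFlow_eq_zero {W : G.Walk a b} {d : G.Dart} (hd : d.edge ∉ W.edges) :
    walkFlow W d = 0 := by
  classical
  rw [dart_edge_mem_edges_iff, not_or] at hd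
  rw [walkFlow, List.count_eq_zero_of_not_mem hd.1, List.count_eq_zero_of_not_mem hd.2, sub_self]

theorem sum_walkFlow_mul_sub [Fintype G.Dart] {R : Type*} [CommRing R] (W : G.Walk a b)
    (g : V → R) : ∑ d, (walkFlow W d : R) * (g d.snd - g d.fst) = 2 * (g b - g a) := by
  classical
  induction W with
  | nil => simp
  | @cons x y z h W ih =>
    let d₀ : G.Dart := ⟨(x, y), h⟩
    have hcons (d : G.Dart) : walkFlow (.cons h W) d =
        walkFlow W d + ((if d₀ = d then 1 else 0) - (if d₀.symm = d then 1 else 0)) := by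
      have hsymm : d₀ = d.symm ↔ d₀.symm = d :=
        (SimpleGraph.Dart.symm_involutive.eq_iff (x := d₀) (y := d)).symm
      simp only [walkFlow, SimpleGraph.Walk.darts_cons, List.count_cons, beq_iff_eq, ← hsymm]
      push_cast
      ring
    have hstep : ∑ d : G.Dart, ((if d₀ = d then 1 else 0) - (if d₀.symm = d then 1 else 0) : R) *
        (g d.snd - g d.fst) = (g y - g x) - (g x - g y) := by
      simp only [sub_mul, ite_mul, one_mul, zero_mul, Finset.sum_sub_distrib,
        Finset.sum_ite_eq, Finset.mem_univ, if_true]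
      rfl
    simp only [hcons, Int.cast_add, add_mul, Finset.sum_add_distrib, ih, Int.cast_sub,
      Int.cast_ite, Int.cast_one, Int.cast_zero]
    rw [hstep]
    ring

variable {C : G.Walk a a}

theorem eq_of_snd_eq_of_isCycle (hC : C.IsCycle) {d d' : G.Dart} (hd : d ∈ C.darts)
    (hd' : d' ∈ C.darts) (h : d.snd = d'.snd) : d = d' :=
  List.inj_on_of_nodup_map (C.map_snd_darts.symm ▸ hC.support_nodup) hd hd' h

theorem eq_of_fst_eq_of_isCycle (hC : C.IsCycle) {d d' : G.Dart} (hd : d ∈ C.darts)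
    (hd' : d' ∈ C.darts) (h : d.fst = d'.fst) : d = d' :=
  List.inj_on_of_nodup_map (C.map_fst_darts.symm ▸ hC.nodup_dropLast_support) hd hd' h

theorem dart_symm_notMem_of_isTrail {W : G.Walk a b} (hW : W.IsTrail) {d : G.Dart}
    (hd : d ∈ W.darts) : d.symm ∉ W.darts := fun hd' =>
  d.symm_ne (List.inj_on_of_nodup_map hW.edges_nodup hd' hd d.edge_symm)

theorem walkFlow_eq_one_of_isTrail {W : G.Walk a b} (hW : W.IsTrail) {d : G.Dart}
    (hd : d ∈ W.darts) : walkFlow W d = 1 := by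
  classical
  rw [walkFlow, List.count_eq_zero_of_not_mem (dart_symm_notMem_of_isTrail hW hd),
    List.count_eq_one_of_mem (hW.edges_nodup.of_map _) hd, Nat.cast_one, Nat.cast_zero, sub_zero]

theorem mem_support_tail_of_isCycle (hC : C.IsCycle) {x : V} (hx : x ∈ C.support) :
    x ∈ C.support.tail := by
  rw [← SimpleGraph.Walk.cons_tail_support] at hx
  rcases List.mem_cons.1 hx with rfl | h
  · exact SimpleGraph.Walk.end_mem_tail_support hC.not_nil
  · exact h

theorem exists_dart_snd_eq_of_isCycle (hC : C.IsCycle) {x : V} (hx : x ∈ C.support) :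
    ∃ d ∈ C.darts, d.snd = x := by
  simpa only [← SimpleGraph.Walk.map_snd_darts, List.mem_map] using
    mem_support_tail_of_isCycle hC hx

theorem exists_dart_fst_eq_of_isCycle (hC : C.IsCycle) {x : V} (hx : x ∈ C.support) :
    ∃ d ∈ C.darts, d.fst = x := by
  obtain ⟨d, hd, rfl⟩ := exists_dart_snd_eq_of_isCycle hC.reverse (x := x) (by simpa using hx)
  exact ⟨d.symm, by simpa using hd, rfl⟩

theorem exists_mem_darts_of_isCycle (hC : C.IsCycle) : ∃ d, d ∈ C.darts :=
  (exists_dart_snd_eq_of_isCycle hC C.start_mem_support).imp fun _ h => h.1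

theorem ncard_support_of_isCycle (hC : C.IsCycle) : {x | x ∈ C.support}.ncard = C.length := by
  classical
  have : {x | x ∈ C.support} = (C.support.tail.toFinset : Set V) := by
    ext x
    rw [List.coe_toFinset]
    exact ⟨mem_support_tail_of_isCycle hC, List.mem_of_mem_tail⟩
  rw [this, Set.ncard_coe_finset, List.toFinset_card_of_nodup hC.support_nodup, List.length_tail,
    SimpleGraph.Walk.length_support, Nat.add_sub_cancel]

end Walk

namespace RotationSystem

variable {V : Type*} {M : RotationSystem V} {E : Set M.graph.Dart} {a b : V}

theorem IsOrientation.ncard_symm_closed [Finite V] (hE : M.IsOrientation E)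
    {S : Set M.graph.Dart} (hS : ∀ d ∈ S, d.symm ∈ S) : S.ncard = 2 * (E ∩ S).ncard := by
  have hunion : S = (E ∩ S) ∪ SimpleGraph.Dart.symm '' (E ∩ S) := by
    ext d
    constructor
    · intro hd
      by_cases h : d ∈ E
      · exact Or.inl ⟨h, hd⟩
      · exact Or.inr ⟨d.symm, ⟨(hE d).2 h, hS d hd⟩, d.symm_symm⟩
    · rintro (h | ⟨g, h, rfl⟩)
      · exact h.2
      · exact hS g h.2
  have hdisj : Disjoint (E ∩ S) (SimpleGraph.Dart.symm '' (E ∩ S)) := by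
    rw [Set.disjoint_left]
    rintro _ ⟨h, -⟩ ⟨g, hg, rfl⟩
    exact (hE g).1 h hg.1
  conv_lhs => rw [hunion]
  rw [Set.ncard_union_eq hdisj,
    Set.ncard_image_of_injective _ SimpleGraph.Dart.symm_involutive.injective, two_mul]

theorem IsOrientation.ncard_edge_mem_edges (hE : M.IsOrientation E) {W : M.graph.Walk a b}
    (hW : W.IsTrail) : {d | d ∈ E ∧ d.edge ∈ W.edges}.ncard = W.length := by
  classical
  have hinj : Set.InjOn SimpleGraph.Dart.edge {d | d ∈ E ∧ d.edge ∈ W.edges} :=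
    fun d hd d' hd' h => congrArg Subtype.val
      (hE.bijective_edge.1 (a₁ := ⟨d, hd.1⟩) (a₂ := ⟨d', hd'.1⟩) (Subtype.ext h))
  have himage : SimpleGraph.Dart.edge '' {d | d ∈ E ∧ d.edge ∈ W.edges} = W.edges.toFinset := by
    ext s
    rw [List.coe_toFinset]
    refine ⟨?_, fun hs => ?_⟩
    · rintro ⟨d, hd, rfl⟩
      exact hd.2
    · obtain ⟨⟨d, hd⟩, h⟩ := hE.bijective_edge.2 ⟨s, W.edges_subset_edgeSet hs⟩
      obtain rfl : d.edge = s := congrArg Subtype.val h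
      exact ⟨d, ⟨hd, hs⟩, rfl⟩
  rw [← hinj.ncard_image, himage, Set.ncard_coe_finset,
    List.toFinset_card_of_nodup hW.edges_nodup, SimpleGraph.Walk.length_edges]

theorem AdjOff.symm {W : M.graph.Walk a a} {f g : M.Face} (h : M.AdjOff W f g) :
    M.AdjOff W g f := by
  obtain ⟨d, hd, rfl, rfl⟩ := h
  exact ⟨d.symm, by rwa [SimpleGraph.Dart.edge_symm], rfl, M.rightFace_symm d⟩

theorem reflTransGen_adjOff_symm {W : M.graph.Walk a a} {f g : M.Face}
    (h : Relation.ReflTransGen (M.AdjOff W) f g) : Relation.ReflTransGen (M.AdjOff W) g f :=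
  have : Std.Symm (M.AdjOff W) := ⟨fun _ _ h => h.symm⟩
  Relation.ReflTransGen.stdSymm.symm _ _ h

theorem adjOff_reverse (W : M.graph.Walk a a) : M.AdjOff W.reverse = M.AdjOff W := by
  ext f g; simp [AdjOff]

theorem leftFaces_reverse (W : M.graph.Walk a a) : M.leftFaces W.reverse = M.rightFaces W := by
  ext f
  simp only [leftFaces, rightFaces, adjOff_reverse, Set.mem_ofPred_eq]
  constructor
  · rintro ⟨d, hd, h⟩
    exact ⟨d.symm, by simpa using hd, by rwa [M.rightFace_symm]⟩
  · rintro ⟨d, hd, h⟩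
    exact ⟨d.symm, by simpa using hd, h⟩

section Cycle

variable [Finite V] {C : M.graph.Walk a a}

/-- Turn around the common vertex of `d` and `d'`, clockwise from `d` to `d'`: the edges met on the
way are not on `C`. -/
theorem reflTransGen_leftFace_of_snd_eq_fst (hC : C.IsCycle) {d d' : M.graph.Dart}
    (hd : d ∈ C.darts) (hd' : d' ∈ C.darts) (h : d.snd = d'.fst) :
    Relation.ReflTransGen (M.AdjOff C) (M.leftFace d) (M.leftFace d') := by
  have hfst : (M.rot.symm d').fst = d'.fst := by
    rw [← M.rot_fst (M.rot.symm d'), Equiv.apply_symm_apply]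
  have hnext : M.leftFace (M.rot d.symm) = M.leftFace d := M.leftFace_faceNext d
  have hturn : Relation.ReflTransGen (M.AdjOff C) (M.leftFace d) (M.leftFace d') ∨
      Relation.ReflTransGen (M.AdjOff C) (M.leftFace d)
        (M.leftFace (M.rot (M.rot.symm d'))) := by
    refine M.rot_induction (d := d.symm) (p := fun g =>
      Relation.ReflTransGen (M.AdjOff C) (M.leftFace d) (M.leftFace d') ∨
        Relation.ReflTransGen (M.AdjOff C) (M.leftFace d) (M.leftFace (M.rot g)))
      (Or.inr (by rw [hnext])) (h.trans hfst.symm) ?_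
    rintro g hg (hreach | hreach)
    · exact Or.inl hreach
    by_cases hend : M.rot g = d'
    · exact Or.inl (hend ▸ hreach)
    by_cases hstart : M.rot g = d.symm
    · rw [hstart, hnext]; exact Or.inr .refl
    refine Or.inr (hreach.tail ⟨M.rot g, ?_, rfl, (M.leftFace_rot _).symm⟩)
    have hg' : (M.rot g).fst = d.snd := by rw [M.rot_fst, hg]; rfl
    rw [dart_edge_mem_edges_iff]
    rintro (hmem | hmem)
    · exact hend (eq_of_fst_eq_of_isCycle hC hmem hd' (hg'.trans h))
    · exact hstart (by
        rw [← eq_of_snd_eq_of_isCycle hC hmem hd hg', SimpleGraph.Dart.symm_symm])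
  rw [Equiv.apply_symm_apply, or_self] at hturn
  exact hturn

theorem reflTransGen_leftFace (hC : C.IsCycle) {d d' : M.graph.Dart} (hd : d ∈ C.darts)
    (hd' : d' ∈ C.darts) : Relation.ReflTransGen (M.AdjOff C) (M.leftFace d) (M.leftFace d') := by
  have hl : 0 < C.darts.length := List.length_pos_of_mem hd
  have hfirst : ∀ k (hk : k < C.darts.length), Relation.ReflTransGen (M.AdjOff C)
      (M.leftFace C.darts[0]) (M.leftFace C.darts[k]) := by
    intro k
    induction k with
    | zero => exact fun _ => .refl
    | succ k ih =>
      exact fun hk => (ih (by omega)).trans (reflTransGen_leftFace_of_snd_eq_fst hC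
        (List.getElem_mem _) (List.getElem_mem _)
        (List.isChain_iff_getElem.1 C.isChain_dartAdj_darts k hk))
  obtain ⟨k, hk, rfl⟩ := List.getElem_of_mem hd
  obtain ⟨k', hk', rfl⟩ := List.getElem_of_mem hd'
  exact (reflTransGen_adjOff_symm (hfirst k hk)).trans (hfirst k' hk')

theorem reflTransGen_of_mem_leftFaces (hC : C.IsCycle) {f g : M.Face} (hf : f ∈ M.leftFaces C)
    (hg : g ∈ M.leftFaces C) : Relation.ReflTransGen (M.AdjOff C) f g := by
  obtain ⟨d, hd, h⟩ := hf
  obtain ⟨d', hd', h'⟩ := hg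
  exact (reflTransGen_adjOff_symm h).trans ((reflTransGen_leftFace hC hd hd').trans h')

omit [Finite V] in
theorem mem_leftFaces_of_reflTransGen {f g : M.Face} (hf : f ∈ M.leftFaces C)
    (h : Relation.ReflTransGen (M.AdjOff C) f g) : g ∈ M.leftFaces C := by
  obtain ⟨d, hd, h'⟩ := hf
  exact ⟨d, hd, h'.trans h⟩

theorem isFaceConnected_leftFaces (hC : C.IsCycle) : M.IsFaceConnected (M.leftFaces C) := by
  intro f hf g hg
  have hfg := reflTransGen_of_mem_leftFaces hC hf hg
  clear hg
  induction hfg with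
  | refl => exact .refl
  | tail hb hc ih =>
    have hmem := mem_leftFaces_of_reflTransGen hf hb
    obtain ⟨d, -, hl, hr⟩ := id hc
    exact ih.tail ⟨hmem, mem_leftFaces_of_reflTransGen hmem (.single hc), d, hl, hr⟩

theorem mem_leftFaces_or_mem_rightFaces (hC : C.IsCycle) (f : M.Face) :
    f ∈ M.leftFaces C ∨ f ∈ M.rightFaces C := by
  obtain ⟨d₀, hd₀⟩ := exists_mem_darts_of_isCycle hC
  refine M.face_induction (p := fun f => f ∈ M.leftFaces C ∨ f ∈ M.rightFaces C) (fun d h => ?_)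
    (Or.inl ⟨d₀, hd₀, .refl⟩) f
  by_cases hdC : d.edge ∈ C.edges
  · rcases dart_edge_mem_edges_iff.1 hdC with hd | hd
    · exact Or.inr ⟨d, hd, .refl⟩
    · exact Or.inl ⟨d.symm, hd, .refl⟩
  · rcases h with ⟨g, hg, h⟩ | ⟨g, hg, h⟩
    · exact Or.inl ⟨g, hg, h.tail ⟨d, hdC, rfl, rfl⟩⟩
    · exact Or.inr ⟨g, hg, h.tail ⟨d, hdC, rfl, rfl⟩⟩

end Cycle

open Classical in
/-- The indicator function of the left side of the closed walk `C`. -/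
noncomputable def leftIndicator (C : M.graph.Walk a a) (f : M.Face) : ℤ :=
  if f ∈ M.leftFaces C then 1 else 0

theorem mem_leftFaces_iff {C : M.graph.Walk a a} {f : M.Face} :
    f ∈ M.leftFaces C ↔ leftIndicator C f = 1 := by
  unfold leftIndicator
  split_ifs with h <;> simp [h]

end RotationSystem

namespace PlanarMap

open RotationSystem

variable {V : Type*} [Finite V] {M : PlanarMap V} {E : Set M.graph.Dart} {a : V}

theorem exists_isPotential_walkFlow (M : PlanarMap V) (W : M.graph.Walk a a) :
    ∃ h, M.IsPotential (walkFlow W) h :=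
  M.exists_isPotential (walkFlow_symm W) fun g => by
    rw [sum_walkFlow_mul_sub, sub_self, mul_zero]

variable {C : M.graph.Walk a a}

/-- The Jordan curve theorem for planar maps: a potential of the flow of `C` is constant on each
side of `C`, and the two constants differ by one. -/
theorem disjoint_leftFaces_rightFaces (hC : C.IsCycle) :
    Disjoint (M.leftFaces C) (M.rightFaces C) := by
  obtain ⟨h, hh⟩ := M.exists_isPotential_walkFlow C
  have hoff : ∀ f g, Relation.ReflTransGen (M.AdjOff C) f g → h f = h g := by
    intro f g hfg
    induction hfg with
    | refl => rfl
    | tail _ hg ih =>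
      obtain ⟨d, hd, rfl, rfl⟩ := hg
      rw [ih, ← sub_eq_zero, hh d, walkFlow_eq_zero hd]
  rw [Set.disjoint_left]
  rintro f hl ⟨d, hd, hr⟩
  have hleft := hoff _ _ (reflTransGen_of_mem_leftFaces hC ⟨d, hd, .refl⟩ hl)
  have hright := hoff _ _ hr
  have := hh d
  rw [walkFlow_eq_one_of_isTrail hC.isTrail hd] at this
  omega

theorem mem_rightFaces_iff_notMem_leftFaces (hC : C.IsCycle) {f : M.Face} :
    f ∈ M.rightFaces C ↔ f ∉ M.leftFaces C :=
  ⟨fun h => Set.disjoint_right.1 (disjoint_leftFaces_rightFaces hC) h,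
    (mem_leftFaces_or_mem_rightFaces hC f).resolve_left⟩

theorem rightFaces_eq_compl (hC : C.IsCycle) : M.rightFaces C = (M.leftFaces C)ᶜ :=
  Set.ext fun _ => mem_rightFaces_iff_notMem_leftFaces hC

theorem mem_rightFaces_iff (hC : C.IsCycle) {f : M.Face} :
    f ∈ M.rightFaces C ↔ leftIndicator C f = 0 := by
  rw [mem_rightFaces_iff_notMem_leftFaces hC, leftIndicator]
  split_ifs with h <;> simp [h]

omit [Finite V] in
theorem leftFace_mem_leftFaces_iff {d : M.graph.Dart} (hd : d.edge ∉ C.edges) :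
    M.leftFace d ∈ M.leftFaces C ↔ M.rightFace d ∈ M.leftFaces C :=
  have hadj : M.AdjOff C (M.leftFace d) (M.rightFace d) := ⟨d, hd, rfl, rfl⟩
  ⟨fun h => mem_leftFaces_of_reflTransGen h (.single hadj),
    fun h => mem_leftFaces_of_reflTransGen h (.single hadj.symm)⟩

theorem isPotential_leftIndicator (hC : C.IsCycle) :
    M.IsPotential (walkFlow C) (leftIndicator C) := by
  have hcycle : ∀ d ∈ C.darts, leftIndicator C (M.leftFace d) = 1 ∧
      leftIndicator C (M.rightFace d) = 0 := fun d hd =>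
    ⟨mem_leftFaces_iff.1 ⟨d, hd, .refl⟩, (mem_rightFaces_iff hC).1 ⟨d, hd, .refl⟩⟩
  intro d
  by_cases hd : d.edge ∈ C.edges
  · rcases dart_edge_mem_edges_iff.1 hd with hd | hd
    · rw [(hcycle d hd).1, (hcycle d hd).2, walkFlow_eq_one_of_isTrail hC.isTrail hd, sub_zero]
    · rw [← M.rightFace_symm d, ← M.leftFace_symm d, (hcycle _ hd).1, (hcycle _ hd).2,
        ← neg_neg (walkFlow C d), ← walkFlow_symm, walkFlow_eq_one_of_isTrail hC.isTrail hd,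
        zero_sub]
  · rw [walkFlow_eq_zero hd, sub_eq_zero]
    simp only [leftIndicator]
    rw [leftFace_mem_leftFaces_iff hd]

theorem rightFace_notMem_leftFaces (hC : C.IsCycle) {d : M.graph.Dart} (hd : d ∈ C.darts) :
    M.rightFace d ∉ M.leftFaces C :=
  (mem_rightFaces_iff_notMem_leftFaces hC).1 ⟨d, hd, .refl⟩

theorem edge_notMem_edges_of_leftFace_iff (hC : C.IsCycle) {d : M.graph.Dart}
    (h : M.leftFace d ∈ M.leftFaces C ↔ M.rightFace d ∈ M.leftFaces C) : d.edge ∉ C.edges := by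
  intro hd
  rcases dart_edge_mem_edges_iff.1 hd with hd | hd
  · exact rightFace_notMem_leftFaces hC hd (h.1 ⟨d, hd, .refl⟩)
  · exact rightFace_notMem_leftFaces hC hd
      (by rw [M.rightFace_symm]; exact h.2 ⟨d.symm, hd, .refl⟩)

theorem leftFace_mem_leftFaces_iff_of_fst_eq {d d' : M.graph.Dart} (hd : d.fst ∉ C.support)
    (h : d.fst = d'.fst) : M.leftFace d ∈ M.leftFaces C ↔ M.leftFace d' ∈ M.leftFaces C := by
  refine M.rot_induction (p := fun g => M.leftFace d ∈ M.leftFaces C ↔ M.leftFace g ∈ M.leftFaces C)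
    Iff.rfl h fun g hg hgl => ?_
  rw [M.leftFace_rot, ← leftFace_mem_leftFaces_iff fun h =>
    hd (hg ▸ C.fst_mem_support_of_mem_edges h)]
  exact hgl

theorem mem_innerVertices_or (hC : C.IsCycle) {x : V} (hx : x ∉ C.support) :
    x ∈ M.innerVertices (M.leftFaces C) ∨ x ∈ M.innerVertices (M.rightFaces C) := by
  by_cases hd : ∃ d : M.graph.Dart, d.fst = x ∧ M.leftFace d ∈ M.leftFaces C
  · obtain ⟨d, rfl, hd⟩ := hd
    exact Or.inl fun d' hd' => (leftFace_mem_leftFaces_iff_of_fst_eq hx hd'.symm).1 hd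
  · exact Or.inr fun d' hd' => (mem_rightFaces_iff_notMem_leftFaces hC).2 fun h => hd ⟨d', hd', h⟩

theorem notMem_innerVertices_leftFaces (hC : C.IsCycle) {d : M.graph.Dart} (hd : d ∈ C.darts) :
    d.fst ∉ M.innerVertices (M.leftFaces C) := fun hx =>
  rightFace_notMem_leftFaces hC hd (leftFace_mem_of_mem_innerVertices hx).2

theorem ncard_leftFaces_add_le (hE : M.IsOrientation E) (hC : C.IsCycle) :
    (M.leftFaces C).ncard + (M.innerVertices (M.leftFaces C)).ncard ≤
      (M.innerDarts E (M.leftFaces C)).ncard + 1 := by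
  obtain ⟨d, hd⟩ := exists_mem_darts_of_isCycle hC
  have := (isFaceConnected_leftFaces hC).ncard_add_ncard_le hE ⟨M.leftFace d, d, hd, .refl⟩ d.fst
  rwa [Set.sdiff_singleton_eq_self (notMem_innerVertices_leftFaces hC hd)] at this

theorem ncard_leftFaces_add_ncard_rightFaces (hC : C.IsCycle) :
    (M.leftFaces C).ncard + (M.rightFaces C).ncard = Nat.card M.Face := by
  rw [rightFaces_eq_compl hC, Set.ncard_add_ncard_compl]

theorem card_le_ncard_innerVertices_add (hC : C.IsCycle) :
    Nat.card V ≤ (M.innerVertices (M.leftFaces C)).ncard +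
      (M.innerVertices (M.rightFaces C)).ncard + C.length := by
  rw [← ncard_support_of_isCycle hC, ← Set.ncard_univ]
  calc (Set.univ : Set V).ncard
      ≤ ((M.innerVertices (M.leftFaces C) ∪ M.innerVertices (M.rightFaces C)) ∪
          {x | x ∈ C.support}).ncard := Set.ncard_le_ncard fun x _ =>
        or_iff_not_imp_right.2 fun hx => mem_innerVertices_or hC hx
    _ ≤ _ := (Set.ncard_union_le _ _).trans (Nat.add_le_add_right (Set.ncard_union_le _ _) _)

theorem ncard_innerDarts_add_le (hE : M.IsOrientation E) (hC : C.IsCycle) :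
    (M.innerDarts E (M.leftFaces C)).ncard + (M.innerDarts E (M.rightFaces C)).ncard + C.length ≤
      Nat.card M.graph.edgeSet := by
  have hoff : ∀ d ∈ M.innerDarts E (M.leftFaces C) ∪ M.innerDarts E (M.rightFaces C),
      d.edge ∉ C.edges := by
    intro d hd
    apply edge_notMem_edges_of_leftFace_iff hC
    rcases hd with ⟨-, hl, hr⟩ | ⟨-, hl, hr⟩
    · exact iff_of_true hl hr
    · rw [rightFaces_eq_compl hC] at hl hr
      exact iff_of_false hl hr
  rw [← hE.ncard_eq, ← hE.ncard_edge_mem_edges hC.isTrail, ← Set.ncard_union_eq,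
    ← Set.ncard_union_eq]
  · refine Set.ncard_le_ncard ?_
    rintro d ((h | h) | h) <;> exact h.1
  · exact Set.disjoint_left.2 fun d hd hd' => hoff d hd hd'.2
  · exact Set.disjoint_left.2 fun d hd hd' =>
      Set.disjoint_left.1 (disjoint_leftFaces_rightFaces hC) hd.2.1 hd'.2.1

/-- Both sides satisfy `≤`, and the two inequalities add up to Euler's formula for `M`. -/
theorem ncard_rightFaces_add (hE : M.IsOrientation E) (hC : C.IsCycle) :
    (M.rightFaces C).ncard + (M.innerVertices (M.rightFaces C)).ncard =
      (M.innerDarts E (M.rightFaces C)).ncard + 1 := by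
  have hleft := ncard_leftFaces_add_le hE hC
  have hright := ncard_leftFaces_add_le hE hC.reverse
  rw [leftFaces_reverse] at hright
  have := ncard_leftFaces_add_ncard_rightFaces hC
  have := card_le_ncard_innerVertices_add hC
  have := ncard_innerDarts_add_le hE hC
  have := M.euler
  omega

end PlanarMap

theorem ncard_eq_mul_ncard_of_fiber {α β : Type*} [Finite α] [Finite β] {S : Set α} {t : Set β}
    {f : α → β} {n : ℕ} (hf : Set.MapsTo f S t)
    (hn : ∀ b ∈ t, {a | a ∈ S ∧ f a = b}.ncard = n) : S.ncard = n * t.ncard := by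
  classical
  have := Fintype.ofFinite α
  have := Fintype.ofFinite β
  rw [Set.ncard_eq_toFinset_card' S, Set.ncard_eq_toFinset_card' t, mul_comm,
    Finset.card_eq_sum_card_fiberwise (f := f) (t := t.toFinset) (by simpa using hf)]
  refine Finset.sum_const_nat fun b hb => ?_
  rw [← hn b (by simpa using hb), Set.ncard_eq_toFinset_card']
  congr 1
  ext a
  simp

namespace PlantedTriangulation

open RotationSystem PlanarMap

section Face

variable {V : Type*} (G : PlantedTriangulation V)

theorem faceNext_ne (d : G.graph.Dart) : G.faceNext d ≠ d := fun h =>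
  d.adj.ne (by rw [← G.faceNext_fst d, h])

theorem faceNext_faceNext_ne (d : G.graph.Dart) : G.faceNext (G.faceNext d) ≠ d := fun h =>
  G.faceNext_ne d (by conv_rhs => rw [← G.triangle d, h])

theorem faceNext_root_fst : (G.faceNext G.root).fst = G.A := G.faceNext_fst _

theorem leftFace_faceNext_root : G.leftFace (G.faceNext G.root) = G.rootFace :=
  G.leftFace_faceNext _

theorem faceNext_faceNext_root_fst : (G.faceNext (G.faceNext G.root)).fst = G.B :=
  G.faceNext_fst _

theorem faceNext_faceNext_root_snd : (G.faceNext (G.faceNext G.root)).snd = G.rootVertex := by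
  rw [← G.faceNext_fst, G.triangle]; rfl

theorem leftFace_faceNext_faceNext_root :
    G.leftFace (G.faceNext (G.faceNext G.root)) = G.rootFace := by
  simp only [G.leftFace_faceNext]; rfl

variable [Finite V]

theorem leftFace_eq_leftFace_iff {d d' : G.graph.Dart} : G.leftFace d' = G.leftFace d ↔
    d' = d ∨ d' = G.faceNext d ∨ d' = G.faceNext (G.faceNext d) := by
  constructor
  · intro h
    obtain ⟨n, rfl⟩ := (G.leftFace_eq_iff.1 h.symm).exists_nat_pow_eq
    clear h
    induction n with
    | zero => exact Or.inl rfl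
    | succ n ih =>
      rw [pow_succ', Equiv.Perm.mul_apply]
      rcases ih with h | h | h <;> rw [h]
      · exact Or.inr (Or.inl rfl)
      · exact Or.inr (Or.inr rfl)
      · exact Or.inl (G.triangle d)
  · rintro (rfl | rfl | rfl) <;> simp only [G.leftFace_faceNext]

theorem ncard_leftFace_eq (f : G.Face) : {d | G.leftFace d = f}.ncard = 3 := by
  induction f using Quotient.ind with | _ d
  rw [Set.ncard_eq_three]
  exact ⟨_, _, _, (G.faceNext_ne d).symm, (G.faceNext_faceNext_ne d).symm,
    (G.faceNext_ne _).symm, Set.ext fun _ => G.leftFace_eq_leftFace_iff⟩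

theorem ncard_leftFace_mem (R : Set G.Face) : {d | G.leftFace d ∈ R}.ncard = 3 * R.ncard := by
  refine ncard_eq_mul_ncard_of_fiber (f := G.leftFace) (fun _ hd => hd) fun f hf => ?_
  rw [← G.ncard_leftFace_eq f]
  congr 1
  ext d
  simp only [Set.mem_ofPred_eq]
  exact ⟨fun h => h.2, fun h => ⟨h ▸ hf, h⟩⟩

end Face

variable {V : Type*} {G : PlantedTriangulation V} {E : Set G.graph.Dart} {a : V}
  {C : G.graph.Walk a a}

/-- The darts of `E` that leave a vertex of the cycle `C` into the right side of `C`. -/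
def rightOut (E : Set G.graph.Dart) (C : G.graph.Walk a a) : Set G.graph.Dart :=
  {d | d ∈ G.innerDarts E (G.rightFaces C) ∧ d.fst ∈ C.support}

variable [Finite V]

theorem IsThreeOrientation.ncard_fst_mem_innerVertices (hE : G.IsThreeOrientation E)
    {R : Set G.Face} (hroot : G.rootFace ∉ R) :
    {d | d ∈ E ∧ d.fst ∈ G.innerVertices R}.ncard = 3 * (G.innerVertices R).ncard := by
  refine ncard_eq_mul_ncard_of_fiber (f := fun d => d.fst) (fun _ hd => hd.2) fun x hx => ?_
  rw [← hE.outdeg x]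
  · congr 1
    ext d
    exact ⟨fun h => ⟨h.1.1, h.2⟩, fun h => ⟨⟨h.1, h.2 ▸ hx⟩, h.2⟩⟩
  · rintro rfl
    exact hroot (G.leftFace_faceNext_root ▸ hx _ G.faceNext_root_fst)
  · rintro rfl
    exact hroot (G.leftFace_faceNext_faceNext_root ▸ hx _ G.faceNext_faceNext_root_fst)
  · rintro rfl
    exact hroot (hx G.root rfl)

theorem notMem_support_of_mem_innerVertices_rightFaces (hC : C.IsCycle) {x : V}
    (hx : x ∈ G.innerVertices (G.rightFaces C)) : x ∉ C.support := by
  intro hxC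
  obtain ⟨d, hd, rfl⟩ := exists_dart_fst_eq_of_isCycle hC hxC
  exact (mem_rightFaces_iff_notMem_leftFaces (M := G.toPlanarMap) hC).1 (hx d rfl) ⟨d, hd, .refl⟩

theorem innerDarts_rightFaces_eq_union (hC : C.IsCycle) : G.innerDarts E (G.rightFaces C) =
    {d | d ∈ E ∧ d.fst ∈ G.innerVertices (G.rightFaces C)} ∪ rightOut E C := by
  ext d
  constructor
  · intro hd
    by_cases hdC : d.fst ∈ C.support
    · exact Or.inr ⟨hd, hdC⟩
    refine Or.inl ⟨hd.1, ?_⟩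
    refine (mem_innerVertices_or (M := G.toPlanarMap) hC hdC).resolve_left fun h => ?_
    exact (mem_rightFaces_iff_notMem_leftFaces (M := G.toPlanarMap) hC).1 hd.2.1 (h d rfl)
  · rintro (⟨hd, hd'⟩ | hd)
    · exact ⟨hd, leftFace_mem_of_mem_innerVertices hd'⟩
    · exact hd.1

theorem leftFace_preimage_rightFaces (hC : C.IsCycle) : {d | G.leftFace d ∈ G.rightFaces C} =
    {d | G.leftFace d ∈ G.rightFaces C ∧ G.rightFace d ∈ G.rightFaces C} ∪
      SimpleGraph.Dart.symm '' {d | d ∈ C.darts} := by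
  have hcompl := fun f => mem_rightFaces_iff_notMem_leftFaces (M := G.toPlanarMap) hC (f := f)
  ext d
  constructor
  · intro hd
    by_cases hdr : G.rightFace d ∈ G.rightFaces C
    · exact Or.inl ⟨hd, hdr⟩
    · refine Or.inr ⟨d.symm, ?_, d.symm_symm⟩
      have hdC : d.edge ∈ C.edges := by
        by_contra h
        exact hdr ((hcompl _).2 fun hl => (hcompl _).1 hd
          ((leftFace_mem_leftFaces_iff (M := G.toPlanarMap) h).2 hl))
      exact (dart_edge_mem_edges_iff.1 hdC).resolve_left fun h => (hcompl _).1 hd ⟨d, h, .refl⟩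
  · rintro (h | ⟨d, hd, rfl⟩)
    · exact h.1
    · exact ⟨d, hd, .refl⟩

theorem ncard_leftFace_preimage_rightFaces (hE : G.IsOrientation E) (hC : C.IsCycle) :
    {d | G.leftFace d ∈ G.rightFaces C}.ncard =
      2 * (G.innerDarts E (G.rightFaces C)).ncard + C.length := by
  classical
  rw [leftFace_preimage_rightFaces hC, Set.ncard_union_eq, hE.ncard_symm_closed,
    Set.ncard_image_of_injective _ SimpleGraph.Dart.symm_involutive.injective]
  · congr 1
    rw [← C.length_darts, ← List.toFinset_card_of_nodup (hC.edges_nodup.of_map _),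
      ← Set.ncard_coe_finset, List.coe_toFinset]
  · rintro d ⟨hl, hr⟩
    exact ⟨hr, by rwa [G.rightFace_symm]⟩
  · rw [Set.disjoint_left]
    rintro _ ⟨-, hr⟩ ⟨d, hd, rfl⟩
    rw [G.rightFace_symm] at hr
    exact (mem_rightFaces_iff_notMem_leftFaces (M := G.toPlanarMap) hC).1 hr ⟨d, hd, .refl⟩

/-- Euler's formula for the right side, in which every inner vertex has outdegree three and every
face has degree three. -/
theorem IsThreeOrientation.ncard_rightOut (hE : G.IsThreeOrientation E) (hC : C.IsCycle)
    (hroot : G.rootFace ∈ G.leftFaces C) : (rightOut E C).ncard + 3 = C.length := by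
  have hO : G.IsOrientation E := hE.orientation
  have hroot' : G.rootFace ∉ G.rightFaces C := fun h =>
    (mem_rightFaces_iff_notMem_leftFaces (M := G.toPlanarMap) hC).1 h hroot
  have heuler := ncard_rightFaces_add (M := G.toPlanarMap) hO hC
  have hdarts := ncard_leftFace_preimage_rightFaces hO hC
  rw [G.ncard_leftFace_mem] at hdarts
  have hinner : (G.innerDarts E (G.rightFaces C)).ncard =
      3 * (G.innerVertices (G.rightFaces C)).ncard + (rightOut E C).ncard := by
    rw [innerDarts_rightFaces_eq_union hC, Set.ncard_union_eq,
      hE.ncard_fst_mem_innerVertices hroot']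
    exact Set.disjoint_left.2 fun d hd hd' =>
      notMem_support_of_mem_innerVertices_rightFaces hC hd.2 hd'.2
  omega

end PlantedTriangulation

section Cycles

variable {V : Type*} {G : SimpleGraph V} {a : V} {C : G.Walk a a}

theorem edge_notMem_edges_of_isCycle (hC : C.IsCycle) {c c' g : G.Dart} (hc : c ∈ C.darts)
    (hc' : c' ∈ C.darts) (hgc : g.fst = c.snd) (hgc' : g.fst = c'.fst) (hne : g ≠ c.symm)
    (hne' : g ≠ c') : g.edge ∉ C.edges := by
  rw [dart_edge_mem_edges_iff]
  rintro (h | h)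
  · exact hne' (eq_of_fst_eq_of_isCycle hC h hc' hgc')
  · exact hne (by rw [← eq_of_snd_eq_of_isCycle hC h hc hgc, SimpleGraph.Dart.symm_symm])

theorem walkFlow_nonneg_of_isCycle (hC : C.IsCycle) {d g : G.Dart} (hd : d ∈ C.darts)
    (hg : g.fst = d.snd) (hne : g ≠ d.symm) : 0 ≤ walkFlow C g := by
  by_cases h : g.edge ∈ C.edges
  · rcases dart_edge_mem_edges_iff.1 h with h | h
    · exact (walkFlow_eq_one_of_isTrail hC.isTrail h).symm ▸ zero_le_one
    · exact absurd (by rw [← eq_of_snd_eq_of_isCycle hC h hd hg, SimpleGraph.Dart.symm_symm]) hne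
  · exact (walkFlow_eq_zero h).ge

theorem walkFlow_eq_ite_of_isCycle [DecidableEq G.Dart] (hC : C.IsCycle) {d d' g : G.Dart}
    (hd : d ∈ C.darts) (hd' : d' ∈ C.darts) (h : d.snd = d'.fst) (hg : g.fst = d'.fst) :
    walkFlow C g = (if g = d' then 1 else 0) - (if g = d.symm then 1 else 0) := by
  have hne : d' ≠ d.symm := fun h => dart_symm_notMem_of_isTrail hC.isTrail hd (h ▸ hd')
  by_cases h1 : g = d'
  · rw [if_pos h1, if_neg (h1 ▸ hne), h1, walkFlow_eq_one_of_isTrail hC.isTrail hd', sub_zero]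
  by_cases h2 : g = d.symm
  · rw [if_neg h1, if_pos h2, h2, walkFlow_symm, walkFlow_eq_one_of_isTrail hC.isTrail hd,
      zero_sub]
  · rw [if_neg h1, if_neg h2, walkFlow_eq_zero, sub_zero]
    exact edge_notMem_edges_of_isCycle hC hd hd' (hg.trans h.symm) hg h2 h1

theorem isPath_of_forall_isSubwalk_not_isCycle {a b : V} {P : G.Walk a b}
    (hanti : ∀ d ∈ P.darts, d.symm ∉ P.darts)
    (hcycle : ∀ (v : V) (C : G.Walk v v), C.IsSubwalk P → ¬ C.IsCycle) : P.IsPath := by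
  classical
  induction P with
  | nil => exact .nil
  | @cons u v _ huv P ih =>
    have hP : P.IsPath := ih
      (fun d hd hd' => hanti d (List.mem_cons_of_mem _ hd) (List.mem_cons_of_mem _ hd'))
      fun _ C hC => hcycle _ C (hC.trans (P.isSubwalk_cons huv))
    refine (SimpleGraph.Walk.cons_isPath_iff huv P).2 ⟨hP, fun hu => ?_⟩
    have hsub : (SimpleGraph.Walk.cons huv (P.takeUntil u hu)).IsSubwalk (.cons huv P) :=
      ⟨.nil, P.dropUntil u hu, by simp⟩
    refine hcycle _ _ hsub ((SimpleGraph.Walk.cons_isCycle_iff _ huv).2 ⟨hP.takeUntil hu, ?_⟩)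
    intro hmem
    rcases dart_edge_mem_edges_iff (d := ⟨(u, v), huv⟩).1 hmem with h | h
    · have htail : u ∈ (P.takeUntil u hu).support.dropLast := by
        rw [← SimpleGraph.Walk.map_fst_darts]
        exact List.mem_map_of_mem (f := fun d : G.Dart => d.fst) h
      have hnodup := (hP.takeUntil hu).support_nodup
      rw [← SimpleGraph.Walk.dropLast_support_concat] at hnodup
      exact List.disjoint_of_nodup_append hnodup htail (List.mem_singleton_self u)
    · exact hanti ⟨(u, v), huv⟩ (List.mem_cons_self ..) (List.mem_cons_of_mem _
        (P.darts_takeUntil_subset_darts hu h))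

end Cycles

section Segments

variable {V : Type*} {G : SimpleGraph V} {a b : V}

theorem fst_getElem_darts (P : G.Walk a b) {k : ℕ} (hk : k < P.darts.length) :
    P.darts[k].fst = P.getVert k := by
  rw [SimpleGraph.Walk.darts_getElem_eq_getVert]

theorem snd_getElem_darts (P : G.Walk a b) {k : ℕ} (hk : k < P.darts.length) :
    P.darts[k].snd = P.getVert (k + 1) := by
  rw [SimpleGraph.Walk.darts_getElem_eq_getVert]

/-- The part of a walk between two of its positions. -/
def walkSegment (P : G.Walk a b) (i j : ℕ) (hij : i ≤ j) : G.Walk (P.getVert i) (P.getVert j) :=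
  ((P.drop i).take (j - i)).copy rfl
    (by rw [SimpleGraph.Walk.drop_getVert, Nat.add_sub_cancel' hij])

variable {P : G.Walk a b} {i j : ℕ} {hij : i ≤ j}

theorem length_walkSegment (hj : j ≤ P.length) : (walkSegment P i j hij).length = j - i := by
  simp only [walkSegment, SimpleGraph.Walk.length_copy, SimpleGraph.Walk.take_length,
    SimpleGraph.Walk.drop_length]
  omega

theorem darts_walkSegment : (walkSegment P i j hij).darts = (P.darts.drop i).take (j - i) := by
  simp only [walkSegment, SimpleGraph.Walk.darts_copy, SimpleGraph.Walk.darts_take,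
    SimpleGraph.Walk.darts_drop]

theorem mem_darts_walkSegment {d : G.Dart} : d ∈ (walkSegment P i j hij).darts ↔
    ∃ k, i ≤ k ∧ k < j ∧ ∃ h : k < P.darts.length, P.darts[k] = d := by
  rw [darts_walkSegment, List.mem_iff_getElem]
  simp only [List.getElem_take, List.getElem_drop, List.length_take, List.length_drop]
  constructor
  · rintro ⟨k, hk, rfl⟩
    exact ⟨i + k, by omega, by omega, by omega, rfl⟩
  · rintro ⟨k, h1, h2, h3, rfl⟩
    exact ⟨k - i, by omega, by simp only [Nat.add_sub_cancel' h1]⟩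

theorem mem_support_walkSegment (hj : j ≤ P.length) {x : V} :
    x ∈ (walkSegment P i j hij).support ↔ ∃ k, i ≤ k ∧ k ≤ j ∧ P.getVert k = x := by
  rw [SimpleGraph.Walk.mem_support_iff_exists_getVert, length_walkSegment hj]
  simp only [walkSegment, SimpleGraph.Walk.getVert_copy, SimpleGraph.Walk.take_getVert,
    SimpleGraph.Walk.drop_getVert]
  constructor
  · rintro ⟨k, rfl, hk⟩
    exact ⟨i + k, by omega, by omega, by rw [Nat.min_eq_right hk]⟩
  · rintro ⟨k, h1, h2, rfl⟩
    exact ⟨k - i, by rw [Nat.min_eq_right (by omega), Nat.add_sub_cancel' h1], by omega⟩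

theorem isPath_walkSegment (hP : P.IsPath) : (walkSegment P i j hij).IsPath := by
  rw [walkSegment, SimpleGraph.Walk.isPath_copy]
  exact (hP.drop i).take (j - i)

end Segments

namespace RotationSystem

variable {V : Type*} {M : RotationSystem V}

theorem IsPotential.rot_pow {φ : M.graph.Dart → ℤ} {h : M.Face → ℤ} (hh : M.IsPotential φ h)
    (s : M.graph.Dart) (n : ℕ) : h (M.leftFace ((M.rot ^ n) s)) =
      h (M.leftFace s) - ∑ b ∈ Finset.range n, φ ((M.rot ^ b) s) := by
  induction n with
  | zero => simp
  | succ n ih =>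
    rw [pow_succ', Equiv.Perm.mul_apply, M.leftFace_rot, Finset.sum_range_succ]
    linarith [hh ((M.rot ^ n) s)]

theorem exists_rot_pow_injOn [Finite V] {s g : M.graph.Dart} (h : s.fst = g.fst) :
    ∃ n, (M.rot ^ n) s = g ∧ Set.InjOn (fun i => (M.rot ^ i) s) (Set.Iic n) := by
  classical
  have hex : ∃ n, (M.rot ^ n) s = g := (M.rot_sameCycle s g h).exists_nat_pow_eq
  refine ⟨Nat.find hex, Nat.find_spec hex, ?_⟩
  have hne : ∀ i j, i < j → j ≤ Nat.find hex → (M.rot ^ i) s ≠ (M.rot ^ j) s := by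
    intro i j hij hj he
    refine Nat.find_min hex (m := Nat.find hex - j + i) (by omega) ?_
    rw [pow_add, Equiv.Perm.mul_apply, he, ← Equiv.Perm.mul_apply, ← pow_add,
      Nat.sub_add_cancel hj]
    exact Nat.find_spec hex
  intro i hi j hj he
  rcases lt_trichotomy i j with hij | hij | hij
  · exact absurd he (hne i j hij hj)
  · exact hij
  · exact absurd he.symm (hne j i hij hi)

end RotationSystem

namespace PlanarMap

open RotationSystem

variable {V : Type*} [Finite V] {M : PlanarMap V} {a : V} {C : M.graph.Walk a a}

/-- Both edges of the cycle at the vertex are crossed, in opposite directions. -/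
theorem leftFace_rot_pow_mem_leftFaces_iff (hC : C.IsCycle) {d d' s : M.graph.Dart}
    (hd : d ∈ C.darts) (hd' : d' ∈ C.darts) (hdd : d.snd = d'.fst) {n i j : ℕ}
    (hinj : Set.InjOn (fun i => (M.rot ^ i) s) (Set.Iic n)) (hi : i < n)
    (hid : (M.rot ^ i) s = d') (hj : j < n) (hjd : (M.rot ^ j) s = d.symm) :
    M.leftFace ((M.rot ^ n) s) ∈ M.leftFaces C ↔ M.leftFace s ∈ M.leftFaces C := by
  classical
  have hs : s.fst = d'.fst := by rw [← hid, M.rot_pow_fst]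
  have hflow : ∀ k ∈ Finset.range n, walkFlow C ((M.rot ^ k) s) =
      (if k = i then 1 else 0) - (if k = j then 1 else 0) := by
    intro k hk
    have hkn : k ∈ Set.Iic n := (Finset.mem_range.1 hk).le
    have hki : (M.rot ^ k) s = d' ↔ k = i := hid ▸ hinj.eq_iff hkn hi.le
    have hkj : (M.rot ^ k) s = d.symm ↔ k = j := hjd ▸ hinj.eq_iff hkn hj.le
    rw [walkFlow_eq_ite_of_isCycle hC hd hd' hdd (by rw [M.rot_pow_fst, hs])]
    simp only [hki, hkj]
  rw [mem_leftFaces_iff, mem_leftFaces_iff, (isPotential_leftIndicator hC).rot_pow,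
    Finset.sum_congr rfl hflow, Finset.sum_sub_distrib, Finset.sum_ite_eq', Finset.sum_ite_eq',
    if_pos (Finset.mem_range.2 hi), if_pos (Finset.mem_range.2 hj), sub_self, sub_zero]

theorem exists_rot_pow_eq_symm (hC : C.IsCycle) {d s : M.graph.Dart} (hd : d ∈ C.darts)
    (hs : s.fst = d.snd) {n : ℕ} (hleft : M.leftFace s ∉ M.leftFaces C)
    (hright : M.leftFace ((M.rot ^ n) s) ∈ M.leftFaces C) : ∃ i < n, (M.rot ^ i) s = d.symm := by
  by_contra! hne
  have hsum : 0 ≤ ∑ i ∈ Finset.range n, walkFlow C ((M.rot ^ i) s) :=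
    Finset.sum_nonneg fun i hi => walkFlow_nonneg_of_isCycle hC hd
      (by rw [M.rot_pow_fst, hs]) (hne i (Finset.mem_range.1 hi))
  have hrot := (isPotential_leftIndicator hC).rot_pow s n
  rw [mem_leftFaces_iff.1 hright,
    (mem_rightFaces_iff hC).1 ((mem_rightFaces_iff_notMem_leftFaces hC).2 hleft)] at hrot
  omega

end PlanarMap

namespace PlantedTriangulation

open RotationSystem PlanarMap

variable {V : Type*} {G : PlantedTriangulation V} {E : Set G.graph.Dart} {a : V}
  {C : G.graph.Walk a a}

theorem IsFirstOutgoing.fst_eq {d p : G.graph.Dart} (hp : G.IsFirstOutgoing E d p) :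
    p.fst = d.snd := by
  obtain ⟨-, k, -, rfl, -⟩ := hp
  rw [G.rot_pow_fst]
  rfl

variable [Finite V]

theorem IsFirstOutgoing.exists_rot_pow (hE : G.IsOrientation E) {d p g : G.graph.Dart}
    (hd : d ∈ E) (hp : G.IsFirstOutgoing E d p) (hg : g ∈ E) (hgd : g.fst = d.snd) :
    ∃ k n : ℕ, 1 ≤ k ∧ k ≤ n ∧ (G.rot ^ k) d.symm = p ∧ (G.rot ^ n) d.symm = g ∧
      Set.InjOn (fun i => (G.rot ^ i) d.symm) (Set.Iic n) := by
  obtain ⟨-, k, hk, hkp, hmin⟩ := hp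
  obtain ⟨n, rfl, hinj⟩ := exists_rot_pow_injOn (M := G.toRotationSystem) (s := d.symm) hgd.symm
  refine ⟨k, n, hk, ?_, hkp, rfl, hinj⟩
  by_contra! hlt
  refine hmin n (Nat.one_le_iff_ne_zero.2 ?_) hlt hg
  rintro rfl
  exact (hE d).1 hg hd

theorem IsFirstOutgoing.side_of_mem (hE : G.IsOrientation E) (hC : C.IsCycle)
    {d p g : G.graph.Dart} (hd : d ∈ E) (hp : G.IsFirstOutgoing E d p) (hg : g ∈ E)
    (hgd : g.fst = d.snd) (hne : g ≠ p)
    (hdC : d ∈ C.darts ∧ p ∈ C.darts ∨ d.symm ∈ C.darts ∧ p.symm ∈ C.darts) :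
    G.leftFace g ∈ G.leftFaces C ↔ G.rightFace d ∈ G.leftFaces C := by
  obtain ⟨k, n, hk, hkn, rfl, rfl, hinj⟩ := hp.exists_rot_pow hE hd hg hgd
  have hkn : k < n := hkn.lt_of_ne fun h => hne (h ▸ rfl)
  rw [← G.leftFace_symm]
  rcases hdC with ⟨h1, h2⟩ | ⟨h1, h2⟩
  · exact leftFace_rot_pow_mem_leftFaces_iff (M := G.toPlanarMap) hC h1 h2 hp.fst_eq.symm hinj
      hkn rfl (by omega : 0 < n) rfl
  · exact leftFace_rot_pow_mem_leftFaces_iff (M := G.toPlanarMap) hC h2 h1 hp.fst_eq hinj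
      (by omega : 0 < n) rfl hkn (SimpleGraph.Dart.symm_symm _).symm

theorem IsFirstOutgoing.side_of_leave (hE : G.IsOrientation E) (hC : C.IsCycle)
    {c d p g : G.graph.Dart} (hd : d ∈ E) (hp : G.IsFirstOutgoing E d p) (hg : g ∈ E)
    (hgd : g.fst = d.snd) (hc : c ∈ C.darts) (hcd : c.snd = d.snd) (hdC : d.symm ∈ C.darts)
    (hpC : G.leftFace p ∈ G.leftFaces C) : G.leftFace g ∈ G.leftFaces C ∧ g ≠ c.symm := by
  obtain ⟨k, n, hk, hkn, rfl, rfl, hinj⟩ := hp.exists_rot_pow hE hd hg hgd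
  obtain ⟨k, rfl⟩ := Nat.exists_eq_add_of_le' hk
  have hright : G.leftFace (G.rot d.symm) ∉ G.leftFaces C := by
    rw [G.leftFace_rot]
    exact rightFace_notMem_leftFaces (M := G.toPlanarMap) hC hdC
  rw [pow_succ, Equiv.Perm.mul_apply] at hpC
  obtain ⟨i, hi, hic⟩ := exists_rot_pow_eq_symm (M := G.toPlanarMap) hC hc
    (by rw [G.rot_fst]; exact hcd.symm) hright hpC
  rw [← Equiv.Perm.mul_apply, ← pow_succ] at hic
  have hleft := (leftFace_rot_pow_mem_leftFaces_iff (M := G.toPlanarMap) hC hc hdC hcd hinj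
    (by omega : 0 < n) rfl (by omega : i + 1 < n) hic).2 ⟨_, hdC, .refl⟩
  exact ⟨hleft, fun he => rightFace_notMem_leftFaces (M := G.toPlanarMap) hC hc
    (by rwa [he] at hleft)⟩

theorem IsFirstOutgoing.side_of_join (hE : G.IsOrientation E) (hC : C.IsCycle)
    {c d p g : G.graph.Dart} (hd : d ∈ E) (hp : G.IsFirstOutgoing E d p) (hg : g ∈ E)
    (hgd : g.fst = d.snd) (hne : g ≠ p) (hc : c ∈ C.darts) (hcd : c.snd = d.snd)
    (hpC : p ∈ C.darts) (hdC : G.rightFace d ∉ G.leftFaces C) :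
    G.leftFace g ∉ G.leftFaces C ∧ g ≠ c.symm := by
  obtain ⟨k, n, hk, hkn, rfl, rfl, hinj⟩ := hp.exists_rot_pow hE hd hg hgd
  have hkn : k < n := hkn.lt_of_ne fun h => hne (h ▸ rfl)
  rw [← G.leftFace_symm] at hdC
  obtain ⟨i, hi, hic⟩ := exists_rot_pow_eq_symm (M := G.toPlanarMap) hC hc hcd.symm hdC
    ⟨_, hpC, .refl⟩
  refine ⟨fun h => hdC ((leftFace_rot_pow_mem_leftFaces_iff (M := G.toPlanarMap) hC hc hpC
    (hcd.trans hp.fst_eq.symm) hinj hkn rfl (hi.trans hkn) hic).1 h), fun he => ?_⟩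
  have := hinj (hi.trans hkn).le Set.self_mem_Iic (hic.trans he.symm)
  omega

end PlantedTriangulation

theorem mul_ncard_le_of_fiber {α β : Type*} [Finite α] [Finite β] {S : Set α} {t : Set β}
    {f : α → β} {n : ℕ} (hn : ∀ b ∈ t, n ≤ {a | a ∈ S ∧ f a = b}.ncard) :
    n * t.ncard ≤ S.ncard := by
  classical
  have := Fintype.ofFinite α
  have := Fintype.ofFinite β
  have hS : {a | a ∈ S ∧ f a ∈ t}.ncard ≤ S.ncard := Set.ncard_le_ncard fun a ha => ha.1
  refine le_trans ?_ hS
  rw [Set.ncard_eq_toFinset_card' t, Set.ncard_eq_toFinset_card', mul_comm,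
    Finset.card_eq_sum_card_fiberwise (f := f) (t := t.toFinset)
      (by intro a; simp +contextual), ← smul_eq_mul]
  refine Finset.card_nsmul_le_sum _ _ _ fun b hb => (hn b (by simpa using hb)).trans (le_of_eq ?_)
  rw [Set.ncard_eq_toFinset_card']
  congr 1
  ext a
  have hb : b ∈ t := by simpa using hb
  simp only [Set.mem_toFinset, Set.mem_ofPred_eq, Finset.mem_filter]
  exact ⟨fun h => ⟨⟨h.1, h.2 ▸ hb⟩, h.2⟩, fun h => ⟨h.1.1, h.2⟩⟩

namespace PlantedTriangulation

open RotationSystem PlanarMap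

variable {V : Type*} {G : PlantedTriangulation V} {E : Set G.graph.Dart}

theorem A_ne_B : G.A ≠ G.B :=
  G.faceNext_root_fst ▸ (G.faceNext G.root).adj.ne

theorem rootVertex_ne_A : G.rootVertex ≠ G.A := G.root.adj.ne

theorem B_ne_rootVertex : G.B ≠ G.rootVertex :=
  G.faceNext_faceNext_root_fst ▸ G.faceNext_faceNext_root_snd ▸
    (G.faceNext (G.faceNext G.root)).adj.ne

section ThreeOrientation

variable [Finite V]

theorem IsThreeOrientation.fst_ne_A (hE : G.IsThreeOrientation E) {d : G.graph.Dart}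
    (hd : d ∈ E) : d.fst ≠ G.A := fun h =>
  Set.eq_empty_iff_forall_notMem.1 ((Set.ncard_eq_zero (Set.toFinite _)).1 hE.outdeg_A) d ⟨hd, h⟩

theorem IsThreeOrientation.eq_of_fst_eq_B (hE : G.IsThreeOrientation E) {d : G.graph.Dart}
    (hd : d ∈ E) (h : d.fst = G.B) : d = (G.faceNext G.root).symm := by
  obtain ⟨d₀, hd₀⟩ := Set.ncard_eq_one.1 hE.outdeg_B
  have hd' : d ∈ ({d₀} : Set _) := hd₀ ▸ ⟨hd, h⟩
  have hroot : (G.faceNext G.root).symm ∈ ({d₀} : Set _) :=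
    hd₀ ▸ ⟨(hE.orientation _).2 fun h' => hE.fst_ne_A h' G.faceNext_root_fst, rfl⟩
  exact hd'.trans hroot.symm

theorem IsThreeOrientation.snd_eq_A (hE : G.IsThreeOrientation E) {d : G.graph.Dart}
    (hd : d ∈ E) (h : d.fst = G.B) : d.snd = G.A := by
  rw [hE.eq_of_fst_eq_B hd h]
  exact G.faceNext_root_fst

omit [Finite V] in
theorem IsThreeOrientation.outdeg_le (hE : G.IsThreeOrientation E) (x : V) :
    {d | d ∈ E ∧ d.fst = x}.ncard ≤ 3 := by
  by_cases hA : x = G.A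
  · rw [hA, hE.outdeg_A]; omega
  by_cases hB : x = G.B
  · rw [hB, hE.outdeg_B]; omega
  by_cases hroot : x = G.rootVertex
  · rw [hroot, hE.outdeg_root]; omega
  · rw [hE.outdeg x hA hB hroot]

theorem IsThreeOrientation.two_mul_ncard_le (hE : G.IsThreeOrientation E) {t : Set V}
    (hA : G.A ∉ t) (hB : G.B ∉ t) {S : Set G.graph.Dart}
    (hS : ∀ x ∈ t, ∃ d, ∀ g ∈ E, g.fst = x → g ≠ d → g ∈ S) : 2 * t.ncard ≤ S.ncard + 1 := by
  have := G.finite_dart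
  have hout : ∀ x ∈ t, {g | g ∈ E ∧ g.fst = x}.ncard ≤ {g | g ∈ S ∧ g.fst = x}.ncard + 1 := by
    intro x hx
    obtain ⟨d, hd⟩ := hS x hx
    refine (Set.ncard_le_ncard fun g hg => ?_).trans (Set.ncard_insert_le d _)
    exact or_iff_not_imp_left.2 fun hne => ⟨hd g hg.1 hg.2 hne, hg.2⟩
  set F := {g | g ∈ S ∧ g.fst = G.rootVertex} with hF
  have hrest : 2 * (t \ {G.rootVertex}).ncard ≤ (S \ F).ncard := by
    refine mul_ncard_le_of_fiber (f := fun g => g.fst) fun x ⟨hx, hne⟩ => ?_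
    have hdeg := hout x hx
    rw [hE.outdeg x (fun h => hA (h ▸ hx)) (fun h => hB (h ▸ hx)) hne] at hdeg
    have hle : {g | g ∈ S ∧ g.fst = x}.ncard ≤ {g | g ∈ S \ F ∧ g.fst = x}.ncard :=
      Set.ncard_le_ncard fun g hg => ⟨⟨hg.1, fun h => hne (hg.2.symm.trans h.2)⟩, hg.2⟩
    omega
  have hSF := Set.ncard_sdiff_add_ncard_of_subset (s := F) (t := S) fun g hg => hg.1
  by_cases hroot : G.rootVertex ∈ t
  · have hdeg := hout _ hroot
    rw [hE.outdeg_root, ← hF] at hdeg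
    have := Set.ncard_sdiff_singleton_add_one hroot
    omega
  · rw [Set.sdiff_singleton_eq_self hroot] at hrest
    omega

variable {a : V} {C : G.graph.Walk a a}

theorem mem_rightOut (hC : C.IsCycle) {c c' g : G.graph.Dart} (hg : g ∈ E) (hc : c ∈ C.darts)
    (hc' : c' ∈ C.darts) (hgc : g.fst = c.snd) (hgc' : g.fst = c'.fst) (hne : g ≠ c.symm)
    (hne' : g ≠ c') (hgC : G.leftFace g ∉ G.leftFaces C) : g ∈ rightOut E C := by
  refine ⟨⟨hg, (mem_rightFaces_iff_notMem_leftFaces (M := G.toPlanarMap) hC).2 hgC,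
    (mem_rightFaces_iff_notMem_leftFaces (M := G.toPlanarMap) hC).2 fun h => hgC ?_⟩, ?_⟩
  · exact (leftFace_mem_leftFaces_iff (M := G.toPlanarMap)
      (edge_notMem_edges_of_isCycle hC hc hc' hgc hgc' hne hne')).2 h
  · exact hgc' ▸ C.dart_fst_mem_support_of_mem_darts hc'

end ThreeOrientation

variable (G) in
/-- A walk in which every dart is the first outgoing dart of `E` after its predecessor, in clockwise
order. -/
structure IsLeftmost (E : Set G.graph.Dart) {a b : V} (P : G.graph.Walk a b) : Prop where
  mem : ∀ d ∈ P.darts, d ∈ E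
  chain : P.darts.IsChain (G.IsFirstOutgoing E)

theorem IsLeftmostPath.isLeftmost {e : G.graph.Dart} (he : e ∈ E) {P : G.graph.Walk e.fst G.A}
    (hP : G.IsLeftmostPath E e P) : G.IsLeftmost E P := by
  refine ⟨fun d hd => ?_, hP.2⟩
  obtain ⟨k, hk, rfl⟩ := List.getElem_of_mem hd
  cases k with
  | zero =>
    have hhead := hP.1
    rw [List.head?_eq_getElem?, List.getElem?_eq_getElem hk] at hhead
    rw [Option.some.inj hhead]
    exact he
  | succ k => exact (List.isChain_iff_getElem.1 hP.2 k hk).1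

section Leftmost

variable {a b : V} {P : G.graph.Walk a b}

theorem IsLeftmost.first (hP : G.IsLeftmost E P) {k : ℕ} (hk : k + 1 < P.darts.length) :
    G.IsFirstOutgoing E P.darts[k] P.darts[k + 1] :=
  List.isChain_iff_getElem.1 hP.chain k hk

theorem IsLeftmost.of_isSubwalk (hP : G.IsLeftmost E P) {a' b' : V} {W : G.graph.Walk a' b'}
    (hW : W.IsSubwalk P) : G.IsLeftmost E W :=
  ⟨fun d hd => hP.mem d (hW.darts_isInfix.subset hd), hP.chain.infix hW.darts_isInfix⟩

variable [Finite V]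

theorem IsLeftmost.getVert_ne_A (hE : G.IsThreeOrientation E) (hP : G.IsLeftmost E P) {k : ℕ}
    (hk : k < P.darts.length) : P.getVert k ≠ G.A := by
  rw [← fst_getElem_darts P hk]
  exact hE.fst_ne_A (hP.mem _ (List.getElem_mem hk))

theorem IsLeftmost.getVert_succ_eq_A (hE : G.IsThreeOrientation E) (hP : G.IsLeftmost E P)
    {k : ℕ} (hk : k < P.darts.length) (h : P.getVert k = G.B) : P.getVert (k + 1) = G.A := by
  rw [← snd_getElem_darts P hk]
  exact hE.snd_eq_A (hP.mem _ (List.getElem_mem hk)) ((fst_getElem_darts P hk).trans h)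

theorem IsLeftmost.not_isCycle (hE : G.IsMinimalThreeOrientation E) {C : G.graph.Walk a a}
    (hleft : G.IsLeftmost E C) : ¬ C.IsCycle := by
  intro hC
  have hE' := hE.toIsThreeOrientation
  have hA : G.A ∉ C.support := fun h => by
    obtain ⟨d, hd, hdA⟩ := exists_dart_fst_eq_of_isCycle hC h
    exact hE'.fst_ne_A (hleft.mem d hd) hdA
  have hB : G.B ∉ C.support := fun h => by
    obtain ⟨d, hd, hdB⟩ := exists_dart_fst_eq_of_isCycle hC h
    exact hA (hE'.snd_eq_A (hleft.mem d hd) hdB ▸ C.dart_snd_mem_support_of_mem_darts hd)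
  have hout : 2 * ({x | x ∈ C.support} \ {a}).ncard ≤ (rightOut E C).ncard + 1 := by
    refine hE'.two_mul_ncard_le (fun h => hA h.1) (fun h => hB h.1) fun x ⟨hx, hne⟩ => ?_
    obtain ⟨d, hd, rfl⟩ := exists_dart_fst_eq_of_isCycle hC hx
    obtain ⟨k, hk, rfl⟩ := List.getElem_of_mem hd
    obtain ⟨k, rfl⟩ : ∃ l, k = l + 1 := Nat.exists_eq_succ_of_ne_zero <| by
      rintro rfl
      exact hne (by simp)
    have hfirst := hleft.first hk
    have hk' : C.darts[k] ∈ C.darts := List.getElem_mem _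
    refine ⟨C.darts[k + 1], fun g hg hgx hgk => ?_⟩
    have hgsnd := hgx.trans hfirst.fst_eq
    refine mem_rightOut hC hg hk' hd hgsnd hgx
      (fun h => (hE.orientation _).1 (h ▸ hg) (hleft.mem _ hk')) hgk fun h => ?_
    exact rightFace_notMem_leftFaces (M := G.toPlanarMap) hC hk'
      ((hfirst.side_of_mem hE.orientation hC (hleft.mem _ hk') hg hgsnd hgk
        (Or.inl ⟨hk', hd⟩)).1 h)
  have hroot := hE'.ncard_rightOut hC (hE.minimal _ C hC hleft.mem)
  have hcard := Set.ncard_sdiff_singleton_add_one (s := {x | x ∈ C.support}) C.start_mem_support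
    (Set.toFinite _)
  rw [ncard_support_of_isCycle hC] at hcard
  omega

theorem IsLeftmost.isPath (hE : G.IsMinimalThreeOrientation E) (hP : G.IsLeftmost E P) :
    P.IsPath :=
  isPath_of_forall_isSubwalk_not_isCycle
    (fun d hd hd' => (hE.orientation d).1 (hP.mem _ hd') (hP.mem d hd))
    fun _ _ hC => (hP.of_isSubwalk hC).not_isCycle hE

end Leftmost

end PlantedTriangulation

section Geodesics

variable {V : Type*} {G : SimpleGraph V} {x y : V}

theorem isCycle_append_of_isPath {W : G.Walk x y} {W' : G.Walk y x} (hW : W.IsPath)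
    (hW' : W'.IsPath) (hne : x ≠ y) (hdisj : ∀ z ∈ W.support, z ∈ W'.support → z = x ∨ z = y)
    (hlen : ¬ (W.length = 1 ∧ W'.length = 1)) : (W.append W').IsCycle := by
  have hpos : W.length ≠ 0 := fun h => hne (SimpleGraph.Walk.eq_of_length_eq_zero h)
  have hpos' : W'.length ≠ 0 := fun h => hne (SimpleGraph.Walk.eq_of_length_eq_zero h).symm
  refine hW.isCycle_append hW' (fun z hz hz' => ?_) (by omega)
  have hnodup := hW.support_nodup
  have hnodup' := hW'.support_nodup
  rw [← SimpleGraph.Walk.cons_tail_support, List.nodup_cons] at hnodup hnodup'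
  rcases hdisj z (List.mem_of_mem_tail hz) (List.mem_of_mem_tail hz') with rfl | rfl
  · exact hnodup.1 hz
  · exact hnodup'.1 hz'

variable {P Q : G.Walk x y} {s t i j : ℕ}

theorem sub_le_length_of_length_eq_dist (hQ : Q.length = G.dist x y) (hst : s ≤ t)
    (ht : t ≤ Q.length) (W : G.Walk (Q.getVert s) (Q.getVert t)) : t - s ≤ W.length := by
  have hdist := SimpleGraph.dist_le ((Q.take s).append (W.append (Q.drop t)))
  simp only [SimpleGraph.Walk.length_append, SimpleGraph.Walk.take_length,
    SimpleGraph.Walk.drop_length] at hdist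
  omega

theorem le_of_getVert_eq (hQ : Q.length = G.dist x y) (ht : t ≤ Q.length) (hj : j ≤ P.length)
    (h : Q.getVert t = P.getVert j) : t ≤ j := by
  have hle := sub_le_length_of_length_eq_dist hQ (Nat.zero_le t) ht
    ((P.take j).copy Q.getVert_zero.symm h.symm)
  rw [SimpleGraph.Walk.length_copy, SimpleGraph.Walk.take_length] at hle
  omega

theorem sub_le_of_getVert_eq (hQ : Q.length = G.dist x y) (ht : t ≤ Q.length)
    (h : Q.getVert t = P.getVert j) : Q.length - t ≤ P.length - j := by
  have hle := sub_le_length_of_length_eq_dist hQ ht le_rfl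
    ((P.drop j).copy h.symm Q.getVert_length.symm)
  rwa [SimpleGraph.Walk.length_copy, SimpleGraph.Walk.drop_length] at hle

theorem walkFlow_take_eq (P : G.Walk x y) (hij : i ≤ j) (d : G.Dart) :
    walkFlow (P.take j) d = walkFlow (P.take i) d + walkFlow (walkSegment P i j hij) d := by
  have hdarts : (P.take j).darts = (P.take i).darts ++ (walkSegment P i j hij).darts := by
    rw [SimpleGraph.Walk.darts_take, SimpleGraph.Walk.darts_take, darts_walkSegment,
      ← List.take_add, Nat.add_sub_cancel' hij]
  simp only [walkFlow, hdarts, List.count_append]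
  push_cast; ring

theorem eq_of_length_eq_one {a b : V} {W W' : G.Walk a b} (hW : W.length = 1)
    (hW' : W'.length = 1) : W = W' := by
  refine SimpleGraph.Walk.ext_getVert_le_length (hW.trans hW'.symm) fun k hk => ?_
  rw [hW] at hk
  interval_cases k
  · rw [W.getVert_zero, W'.getVert_zero]
  · rw [W.getVert_of_length_le hW.le, W'.getVert_of_length_le hW'.le]

end Geodesics

section Excursions

variable {V : Type*} {G : SimpleGraph V} {x y : V} {P Q : G.Walk x y} {s t i j : ℕ}

variable (P Q s t i j) in
/-- The part of `Q` between the positions `s` and `t` meets the walk `P` only at its ends, which are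
at the positions `i` and `j` of `P`. -/
structure IsExcursion : Prop where
  lt : s < t
  le_length : t ≤ Q.length
  left_le : i ≤ P.length
  right_le : j ≤ P.length
  left_eq : Q.getVert s = P.getVert i
  right_eq : Q.getVert t = P.getVert j
  notMem : ∀ r, s < r → r < t → Q.getVert r ∉ P.support

namespace IsExcursion

/-- The excursion as a walk between two vertices of `P`. -/
def arc (hx : IsExcursion P Q s t i j) : G.Walk (P.getVert i) (P.getVert j) :=
  (walkSegment Q s t hx.lt.le).copy hx.left_eq hx.right_eq

/-- The closed walk formed by an excursion that goes ahead along `P` and the part of `P` between its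
ends, traversed backwards. -/
def forwardCycle (hx : IsExcursion P Q s t i j) (hij : i ≤ j) :
    G.Walk (P.getVert i) (P.getVert i) :=
  hx.arc.append (walkSegment P i j hij).reverse

/-- The closed walk formed by an excursion that goes back along `P` and the part of `P` between its
ends. -/
def backwardCycle (hx : IsExcursion P Q s t i j) (hji : j ≤ i) :
    G.Walk (P.getVert i) (P.getVert i) :=
  hx.arc.append (walkSegment P j i hji)

theorem length_arc (hx : IsExcursion P Q s t i j) : hx.arc.length = t - s := by
  rw [arc, SimpleGraph.Walk.length_copy, length_walkSegment hx.le_length]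

theorem mem_support_arc (hx : IsExcursion P Q s t i j) {z : V} :
    z ∈ hx.arc.support ↔ ∃ r, s ≤ r ∧ r ≤ t ∧ Q.getVert r = z := by
  rw [arc, SimpleGraph.Walk.support_copy, mem_support_walkSegment hx.le_length]

theorem isPath_arc (hx : IsExcursion P Q s t i j) (hQ : Q.IsPath) : hx.arc.IsPath := by
  rw [arc, SimpleGraph.Walk.isPath_copy]
  exact isPath_walkSegment hQ

theorem walkFlow_arc (hx : IsExcursion P Q s t i j) (d : G.Dart) :
    walkFlow hx.arc d = walkFlow (Q.take t) d - walkFlow (Q.take s) d := by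
  rw [walkFlow_take_eq Q hx.lt.le, arc, walkFlow_copy, add_sub_cancel_left]

theorem exists_mem_darts_arc_snd_eq (hx : IsExcursion P Q s t i j) :
    ∃ c ∈ hx.arc.darts, c.snd = P.getVert j := by
  have hst := hx.lt
  have htQ := hx.le_length
  have hlen := Q.length_darts
  refine ⟨Q.darts[t - 1], ?_, ?_⟩
  · rw [arc, SimpleGraph.Walk.darts_copy]
    exact mem_darts_walkSegment.2 ⟨t - 1, by omega, by omega, by omega, rfl⟩
  · rw [snd_getElem_darts, Nat.sub_add_cancel (by omega), hx.right_eq]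

theorem eq_or_eq_of_mem_support (hx : IsExcursion P Q s t i j) {z : V} (hz : z ∈ hx.arc.support)
    (hzP : z ∈ P.support) : z = P.getVert i ∨ z = P.getVert j := by
  obtain ⟨r, hsr, hrt, rfl⟩ := hx.mem_support_arc.1 hz
  rcases hsr.eq_or_lt with rfl | hsr
  · exact Or.inl hx.left_eq
  rcases hrt.eq_or_lt with rfl | hrt
  · exact Or.inr hx.right_eq
  · exact absurd hzP (hx.notMem r hsr hrt)

theorem ne (hx : IsExcursion P Q s t i j) (hQ : Q.IsPath) : i ≠ j := by
  rintro rfl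
  exact hx.lt.ne (hQ.getVert_injOn (hx.lt.le.trans hx.le_length) hx.le_length
    (hx.left_eq.trans hx.right_eq.symm))

theorem length_le_of_le (hx : IsExcursion P Q s t i j) (hQ : Q.length = G.dist x y)
    (hij : i ≤ j) : t - s ≤ j - i := by
  have hle := sub_le_length_of_length_eq_dist hQ hx.lt.le hx.le_length
    ((walkSegment P i j hij).copy hx.left_eq.symm hx.right_eq.symm)
  rwa [SimpleGraph.Walk.length_copy, length_walkSegment hx.right_le] at hle

theorem length_le_of_ge (hx : IsExcursion P Q s t i j) (hQ : Q.length = G.dist x y)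
    (hji : j ≤ i) : t - s ≤ i - j := by
  have hle := sub_le_length_of_length_eq_dist hQ hx.lt.le hx.le_length
    ((walkSegment P j i hji).reverse.copy hx.left_eq.symm hx.right_eq.symm)
  rwa [SimpleGraph.Walk.length_copy, SimpleGraph.Walk.length_reverse,
    length_walkSegment hx.left_le] at hle

theorem length_forwardCycle (hx : IsExcursion P Q s t i j) (hij : i ≤ j) :
    (hx.forwardCycle hij).length = (t - s) + (j - i) := by
  rw [forwardCycle, SimpleGraph.Walk.length_append, SimpleGraph.Walk.length_reverse, hx.length_arc,
    length_walkSegment hx.right_le]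

theorem length_backwardCycle (hx : IsExcursion P Q s t i j) (hji : j ≤ i) :
    (hx.backwardCycle hji).length = (t - s) + (i - j) := by
  rw [backwardCycle, SimpleGraph.Walk.length_append, hx.length_arc, length_walkSegment hx.left_le]

theorem mem_support_forwardCycle (hx : IsExcursion P Q s t i j) (hij : i ≤ j) {z : V} :
    z ∈ (hx.forwardCycle hij).support ↔
      z ∈ hx.arc.support ∨ ∃ k, i ≤ k ∧ k ≤ j ∧ P.getVert k = z := by
  rw [forwardCycle, SimpleGraph.Walk.mem_support_append_iff, SimpleGraph.Walk.support_reverse,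
    List.mem_reverse, mem_support_walkSegment hx.right_le]

theorem mem_support_backwardCycle (hx : IsExcursion P Q s t i j) (hji : j ≤ i) {z : V} :
    z ∈ (hx.backwardCycle hji).support ↔
      z ∈ hx.arc.support ∨ ∃ k, j ≤ k ∧ k ≤ i ∧ P.getVert k = z := by
  rw [backwardCycle, SimpleGraph.Walk.mem_support_append_iff, mem_support_walkSegment hx.left_le]

theorem isCycle_forwardCycle (hx : IsExcursion P Q s t i j) (hP : P.IsPath) (hQ : Q.IsPath)
    (hij : i ≤ j) (hlen : ¬ (t - s = 1 ∧ j - i = 1)) : (hx.forwardCycle hij).IsCycle := by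
  refine isCycle_append_of_isPath (hx.isPath_arc hQ) (isPath_walkSegment hP).reverse
    (fun h => hx.ne hQ (hP.getVert_injOn hx.left_le hx.right_le h)) (fun z hz hzP => ?_) ?_
  · rw [SimpleGraph.Walk.support_reverse, List.mem_reverse,
      mem_support_walkSegment hx.right_le] at hzP
    obtain ⟨k, -, -, rfl⟩ := hzP
    exact hx.eq_or_eq_of_mem_support hz (P.getVert_mem_support k)
  · rwa [hx.length_arc, SimpleGraph.Walk.length_reverse, length_walkSegment hx.right_le]

theorem isCycle_backwardCycle (hx : IsExcursion P Q s t i j) (hP : P.IsPath) (hQ : Q.IsPath)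
    (hji : j ≤ i) (hlen : ¬ (t - s = 1 ∧ i - j = 1)) : (hx.backwardCycle hji).IsCycle := by
  refine isCycle_append_of_isPath (hx.isPath_arc hQ) (isPath_walkSegment hP)
    (fun h => hx.ne hQ (hP.getVert_injOn hx.left_le hx.right_le h)) (fun z hz hzP => ?_) ?_
  · rw [mem_support_walkSegment hx.left_le] at hzP
    obtain ⟨k, -, -, rfl⟩ := hzP
    exact hx.eq_or_eq_of_mem_support hz (P.getVert_mem_support k)
  · rwa [hx.length_arc, length_walkSegment hx.left_le]

theorem walkFlow_forwardCycle (hx : IsExcursion P Q s t i j) (hij : i ≤ j) (d : G.Dart) :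
    walkFlow (hx.forwardCycle hij) d = (walkFlow (Q.take t) d - walkFlow (P.take j) d) -
      (walkFlow (Q.take s) d - walkFlow (P.take i) d) := by
  rw [forwardCycle, walkFlow_append, walkFlow_reverse, hx.walkFlow_arc, walkFlow_take_eq P hij]
  ring

theorem walkFlow_backwardCycle (hx : IsExcursion P Q s t i j) (hji : j ≤ i) (d : G.Dart) :
    walkFlow (hx.backwardCycle hji) d = (walkFlow (Q.take t) d - walkFlow (P.take j) d) -
      (walkFlow (Q.take s) d - walkFlow (P.take i) d) := by
  rw [backwardCycle, walkFlow_append, hx.walkFlow_arc, walkFlow_take_eq P hji]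
  ring

theorem walkFlow_forwardCycle_eq_zero (hx : IsExcursion P Q s t i j) (hij : i ≤ j)
    (hts : t - s = 1) (hji : j - i = 1) (d : G.Dart) : walkFlow (hx.forwardCycle hij) d = 0 := by
  rw [forwardCycle, walkFlow_append, walkFlow_reverse, eq_of_length_eq_one
    (hx.length_arc.trans hts) ((length_walkSegment (hij := hij) hx.right_le).trans hji),
    add_neg_cancel]

theorem walkFlow_backwardCycle_eq_zero (hx : IsExcursion P Q s t i j) (hji : j ≤ i)
    (hts : t - s = 1) (hij : i - j = 1) (d : G.Dart) : walkFlow (hx.backwardCycle hji) d = 0 := by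
  have harc : hx.arc = (walkSegment P j i hji).reverse :=
    eq_of_length_eq_one (hx.length_arc.trans hts)
      (by rw [SimpleGraph.Walk.length_reverse, length_walkSegment hx.left_le, hij])
  rw [backwardCycle, walkFlow_append, harc, walkFlow_reverse, neg_add_cancel]

theorem eq_or_eq_of_getVert_mem_support (hx : IsExcursion P Q s t i j) (hP : P.IsPath) {k : ℕ}
    (hk : k ≤ P.length) (h : P.getVert k ∈ hx.arc.support) : k = i ∨ k = j :=
  (hx.eq_or_eq_of_mem_support h (P.getVert_mem_support k)).imp
    (hP.getVert_injOn hk hx.left_le) (hP.getVert_injOn hk hx.right_le)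

theorem mem_Icc_of_getVert_mem_forwardCycle (hx : IsExcursion P Q s t i j) (hP : P.IsPath)
    (hij : i ≤ j) {k : ℕ} (hk : k ≤ P.length) (h : P.getVert k ∈ (hx.forwardCycle hij).support) :
    k ∈ Set.Icc i j := by
  rcases (hx.mem_support_forwardCycle hij).1 h with h | ⟨l, hil, hlj, h⟩
  · rcases hx.eq_or_eq_of_getVert_mem_support hP hk h with rfl | rfl
    · exact ⟨le_rfl, hij⟩
    · exact ⟨hij, le_rfl⟩
  · exact hP.getVert_injOn (hlj.trans hx.right_le) hk h ▸ ⟨hil, hlj⟩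

theorem mem_Icc_of_getVert_mem_backwardCycle (hx : IsExcursion P Q s t i j) (hP : P.IsPath)
    (hji : j ≤ i) {k : ℕ} (hk : k ≤ P.length) (h : P.getVert k ∈ (hx.backwardCycle hji).support) :
    k ∈ Set.Icc j i := by
  rcases (hx.mem_support_backwardCycle hji).1 h with h | ⟨l, hjl, hli, h⟩
  · rcases hx.eq_or_eq_of_getVert_mem_support hP hk h with rfl | rfl
    · exact ⟨hji, le_rfl⟩
    · exact ⟨le_rfl, hji⟩
  · exact hP.getVert_injOn (hli.trans hx.left_le) hk h ▸ ⟨hjl, hli⟩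

theorem symm_getElem_mem_darts_forwardCycle (hx : IsExcursion P Q s t i j) (hij : i ≤ j) {k : ℕ}
    (hik : i ≤ k) (hkj : k < j) (hk : k < P.darts.length) :
    P.darts[k].symm ∈ (hx.forwardCycle hij).darts := by
  rw [forwardCycle, SimpleGraph.Walk.darts_append, List.mem_append,
    SimpleGraph.Walk.mem_darts_reverse, SimpleGraph.Dart.symm_symm]
  exact Or.inr (mem_darts_walkSegment.2 ⟨k, hik, hkj, hk, rfl⟩)

theorem getElem_mem_darts_backwardCycle (hx : IsExcursion P Q s t i j) (hji : j ≤ i) {k : ℕ}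
    (hjk : j ≤ k) (hki : k < i) (hk : k < P.darts.length) :
    P.darts[k] ∈ (hx.backwardCycle hji).darts := by
  rw [backwardCycle, SimpleGraph.Walk.darts_append, List.mem_append]
  exact Or.inr (mem_darts_walkSegment.2 ⟨k, hjk, hki, hk, rfl⟩)

theorem exists_mem_darts_forwardCycle_snd_eq (hx : IsExcursion P Q s t i j) (hij : i ≤ j) :
    ∃ c ∈ (hx.forwardCycle hij).darts, c.snd = P.getVert j := by
  obtain ⟨c, hc, hcj⟩ := hx.exists_mem_darts_arc_snd_eq
  exact ⟨c, by rw [forwardCycle, SimpleGraph.Walk.darts_append]; exact List.mem_append_left _ hc,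
    hcj⟩

theorem exists_mem_darts_backwardCycle_snd_eq (hx : IsExcursion P Q s t i j) (hji : j ≤ i) :
    ∃ c ∈ (hx.backwardCycle hji).darts, c.snd = P.getVert j := by
  obtain ⟨c, hc, hcj⟩ := hx.exists_mem_darts_arc_snd_eq
  exact ⟨c, by rw [backwardCycle, SimpleGraph.Walk.darts_append]; exact List.mem_append_left _ hc,
    hcj⟩

end IsExcursion

end Excursions

theorem ncard_le_mul_ncard_of_fiber {α β : Type*} [Finite α] [Finite β] {S : Set α} {t : Set β}
    {f : α → β} {n : ℕ} (hf : Set.MapsTo f S t)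
    (hn : ∀ b ∈ t, {a | a ∈ S ∧ f a = b}.ncard ≤ n) : S.ncard ≤ n * t.ncard := by
  classical
  have := Fintype.ofFinite α
  have := Fintype.ofFinite β
  rw [Set.ncard_eq_toFinset_card' S, Set.ncard_eq_toFinset_card' t]
  refine Finset.card_le_mul_card_image_of_maps_to (f := f)
    (by simpa [Set.MapsTo] using hf) n fun b hb => ?_
  refine le_trans (le_of_eq ?_) (hn b (by simpa using hb))
  rw [Set.ncard_eq_toFinset_card']
  congr 1
  ext a
  simp

namespace PlanarMap

open RotationSystem

variable {V : Type*} [Finite V] {M : PlanarMap V} {a b c : V} {C : M.graph.Walk a a}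

theorem rightFace_getElem_mem_leftFaces_iff (P : M.graph.Walk b c) {j : ℕ}
    (hP : ∀ k < j, P.getVert k ∉ C.support) {k : ℕ} (hk : k < j) (hkP : k < P.darts.length) :
    M.rightFace P.darts[k] ∈ M.leftFaces C ↔
      M.rightFace (P.darts[0]'(by omega)) ∈ M.leftFaces C := by
  induction k with
  | zero => exact Iff.rfl
  | succ k ih =>
    have hoff : P.darts[k + 1].fst ∉ C.support := by
      rw [fst_getElem_darts]
      exact hP _ hk
    rw [← ih (by omega) (by omega), ← leftFace_mem_leftFaces_iff
      fun h => hoff (C.fst_mem_support_of_mem_edges h), ← M.leftFace_symm]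
    refine leftFace_mem_leftFaces_iff_of_fst_eq hoff ?_
    rw [fst_getElem_darts]
    exact (snd_getElem_darts P (by omega)).symm

theorem leftFace_getElem_mem_leftFaces_iff (P : M.graph.Walk b c) {j : ℕ}
    (hP : ∀ k, j < k → k ≤ P.length → P.getVert k ∉ C.support) {d : M.graph.Dart} (hd : d.fst = c)
    {k : ℕ} (hk : j ≤ k) (hkP : k < P.darts.length) :
    M.leftFace P.darts[k] ∈ M.leftFaces C ↔ M.leftFace d ∈ M.leftFaces C := by
  have hlen := P.length_darts
  obtain ⟨n, hn⟩ : ∃ n, P.length = k + 1 + n := ⟨P.length - (k + 1), by omega⟩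
  have hoff : ∀ l (hl : l < P.darts.length), j ≤ l → P.darts[l].snd ∉ C.support := fun l hl hjl =>
    snd_getElem_darts P hl ▸ hP _ (by omega) (by omega)
  have hcross : ∀ l (hl : l < P.darts.length), j ≤ l →
      (M.leftFace P.darts[l] ∈ M.leftFaces C ↔ M.leftFace P.darts[l].symm ∈ M.leftFaces C) :=
    fun l hl hjl => leftFace_mem_leftFaces_iff fun h =>
      hoff l hl hjl (C.snd_mem_support_of_mem_edges h)
  induction n generalizing k with
  | zero =>
    rw [hcross k hkP hk]
    refine leftFace_mem_leftFaces_iff_of_fst_eq (hoff k hkP hk) ?_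
    rw [hd]
    refine (snd_getElem_darts P hkP).trans ?_
    rw [show k + 1 = P.length by omega, P.getVert_length]
  | succ n ih =>
    have hk' : k + 1 < P.darts.length := by omega
    refine (hcross k hkP hk).trans (Iff.trans ?_ (ih (by omega) hk' (by omega)))
    refine leftFace_mem_leftFaces_iff_of_fst_eq (hoff k hkP hk) ?_
    rw [fst_getElem_darts]
    exact snd_getElem_darts P hkP

end PlanarMap

namespace PlantedTriangulation

open RotationSystem PlanarMap

variable {V : Type*} [Finite V] {G : PlantedTriangulation V} {E : Set G.graph.Dart} {u : V}
  {P Q : G.graph.Walk u G.A} {s t i j : ℕ}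

theorem IsLeftmost.mem_rightOut_backwardCycle (hE : G.IsThreeOrientation E)
    (hP : G.IsLeftmost E P) (hPp : P.IsPath) (hx : IsExcursion P Q s t i j) (hji : j ≤ i)
    (hC : (hx.backwardCycle hji).IsCycle)
    (hright : ∀ h : 0 < P.darts.length,
      G.rightFace P.darts[0] ∉ G.leftFaces (hx.backwardCycle hji))
    {k : ℕ} (hk : k + 1 < P.darts.length) (hjk : j ≤ k + 1) (hki : k + 1 < i)
    {g : G.graph.Dart} (hg : g ∈ E) (hgk : g.fst = P.getVert (k + 1)) (hne : g ≠ P.darts[k + 1]) :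
    g ∈ rightOut E (hx.backwardCycle hji) := by
  have hk' : k < P.darts.length := by omega
  have hdE : P.darts[k] ∈ E := hP.mem _ (List.getElem_mem hk')
  have hnext := hx.getElem_mem_darts_backwardCycle hji hjk hki hk
  have hgsnd : g.fst = P.darts[k].snd := by rw [hgk, snd_getElem_darts]
  have hgfst : g.fst = P.darts[k + 1].fst := by rw [hgk, fst_getElem_darts]
  rcases hjk.eq_or_lt with rfl | hjk
  · obtain ⟨c, hc, hcj⟩ := hx.exists_mem_darts_backwardCycle_snd_eq hji
    have hbefore : ∀ l < k + 1, P.getVert l ∉ (hx.backwardCycle hji).support := fun l hl h => by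
      have := hx.mem_Icc_of_getVert_mem_backwardCycle hPp hji
        (P.length_darts ▸ (hl.trans hk).le) h
      exact hl.not_ge this.1
    obtain ⟨hgC, hgc⟩ := (hP.first hk).side_of_join hE.orientation hC hdE hg hgsnd hne hc
      (hcj.trans (snd_getElem_darts P hk').symm) hnext fun h => hright (by omega)
        ((rightFace_getElem_mem_leftFaces_iff (M := G.toPlanarMap) P hbefore
          (Nat.lt_succ_self k) hk').1 h)
    exact mem_rightOut hC hg hc hnext (hgk.trans hcj.symm) hgfst hgc hne hgC
  · have hprev := hx.getElem_mem_darts_backwardCycle hji (by omega) (by omega) hk'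
    refine mem_rightOut hC hg hprev hnext hgsnd hgfst
      (fun h => (hE.orientation _).1 (h ▸ hg) hdE) hne fun h => ?_
    exact rightFace_notMem_leftFaces (M := G.toPlanarMap) hC hprev
      (((hP.first hk).side_of_mem hE.orientation hC hdE hg hgsnd hne (Or.inl ⟨hprev, hnext⟩)).1 h)

theorem IsLeftmost.exists_rightFace_mem_leftFaces_backwardCycle (hE : G.IsThreeOrientation E)
    (hP : G.IsLeftmost E P) (hPp : P.IsPath) (hQ : Q.length = G.graph.dist u G.A)
    (hx : IsExcursion P Q s t i j) (hji : j ≤ i) (hC : (hx.backwardCycle hji).IsCycle)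
    (hroot : G.rootFace ∈ G.leftFaces (hx.backwardCycle hji)) :
    ∃ h : 0 < P.darts.length, G.rightFace P.darts[0] ∈ G.leftFaces (hx.backwardCycle hji) := by
  by_contra! hright
  have hQp := Q.isPath_of_length_eq_dist hQ
  have hlen := P.length_darts
  have hst := hx.lt
  have htQ := hx.le_length
  have hiP := hx.left_le
  have hj0 : j ≠ 0 := by
    rintro rfl
    have h0 := hx.right_eq
    rw [P.getVert_zero, hQp.getVert_eq_start_iff htQ] at h0
    omega
  have hinj : Set.InjOn P.getVert (Set.Ico j i) :=
    hPp.getVert_injOn.mono fun k hk => (hk.2.le.trans hiP : k ≤ P.length)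
  have hA : G.A ∉ P.getVert '' Set.Ico j i := by
    rintro ⟨k, hk, hkA⟩
    exact hP.getVert_ne_A hE (hlen ▸ hk.2.trans_le hiP) hkA
  have hB : G.B ∉ P.getVert '' Set.Ico j i := by
    rintro ⟨k, hk, hkB⟩
    have hkA := hP.getVert_succ_eq_A hE (hlen ▸ hk.2.trans_le hiP) hkB
    rcases (show k + 1 ≤ P.length from hk.2.trans_le hiP).eq_or_lt with hkP | hkP
    · have hend := hx.left_eq
      rw [show i = k + 1 by have := hk.2; omega, hkA, hQp.getVert_eq_end_iff (by omega)] at hend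
      omega
    · exact hP.getVert_ne_A hE (by omega) hkA
  have hcount := hE.two_mul_ncard_le hA hB (S := rightOut E (hx.backwardCycle hji)) <| by
    rintro _ ⟨k, hk, rfl⟩
    obtain ⟨l, rfl⟩ : ∃ l, k = l + 1 := Nat.exists_eq_succ_of_ne_zero (by have := hk.1; omega)
    have hl : l + 1 < P.darts.length := hlen ▸ hk.2.trans_le hiP
    exact ⟨P.darts[l + 1], fun g hg hgl hne =>
      hP.mem_rightOut_backwardCycle hE hPp hx hji hC hright hl hk.1 hk.2 hg hgl hne⟩
  rw [hinj.ncard_image, ← Finset.coe_Ico, Set.ncard_coe_finset, Nat.card_Ico]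
    at hcount
  have hout := hE.ncard_rightOut hC hroot
  rw [hx.length_backwardCycle] at hout
  have := hx.length_le_of_ge hQ hji
  omega

theorem IsLeftmost.leftFace_mem_and_edge_notMem_forwardCycle (hE : G.IsThreeOrientation E)
    (hP : G.IsLeftmost E P) (hPp : P.IsPath) (hx : IsExcursion P Q s t i j) (hij : i ≤ j)
    (hC : (hx.forwardCycle hij).IsCycle) (hroot : G.rootFace ∈ G.leftFaces (hx.forwardCycle hij))
    {k : ℕ} (hik : i ≤ k) (hkj : k + 1 ≤ j) {g : G.graph.Dart} (hg : g ∈ E)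
    (hgk : g.fst = P.getVert (k + 1))
    (hne : k + 1 < j → ∀ h : k + 1 < P.darts.length, g ≠ P.darts[k + 1]) :
    G.leftFace g ∈ G.leftFaces (hx.forwardCycle hij) ∧ g.edge ∉ (hx.forwardCycle hij).edges := by
  have hlen := P.length_darts
  have hjP := hx.right_le
  have hk : k < P.darts.length := by omega
  have hk' : k + 1 < P.darts.length := by
    by_contra! hlast
    exact hE.fst_ne_A hg (by rw [hgk, P.getVert_of_length_le (by omega)])
  have hdE : P.darts[k] ∈ E := hP.mem _ (List.getElem_mem hk)
  have hdC := hx.symm_getElem_mem_darts_forwardCycle hij hik hkj hk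
  have hgsnd : g.fst = P.darts[k].snd := by rw [hgk, snd_getElem_darts]
  have hgd : g ≠ P.darts[k].symm := fun h => (hE.orientation _).1 (h ▸ hg) hdE
  rcases hkj.eq_or_lt with rfl | hkj
  · obtain ⟨c, hc, hcj⟩ := hx.exists_mem_darts_forwardCycle_snd_eq hij
    have hafter : ∀ l, k + 1 < l → l ≤ P.length → P.getVert l ∉ (hx.forwardCycle hij).support :=
      fun l hl hlP h => hl.not_ge (hx.mem_Icc_of_getVert_mem_forwardCycle hPp hij hlP h).2
    obtain ⟨hgC, hgc⟩ := (hP.first hk').side_of_leave hE.orientation hC hdE hg hgsnd hc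
      (hcj.trans (snd_getElem_darts P hk).symm) hdC
      ((leftFace_getElem_mem_leftFaces_iff (M := G.toPlanarMap) P hafter G.faceNext_root_fst le_rfl
        hk').2 (by rwa [G.leftFace_faceNext_root]))
    exact ⟨hgC, edge_notMem_edges_of_isCycle hC hc hdC (hgk.trans hcj.symm) hgsnd hgc hgd⟩
  · have hnext := hx.symm_getElem_mem_darts_forwardCycle hij (by omega) hkj hk'
    refine ⟨((hP.first hk').side_of_mem hE.orientation hC hdE hg hgsnd (hne hkj hk')
      (Or.inr ⟨hdC, hnext⟩)).2 ⟨_, hdC, .refl⟩, ?_⟩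
    refine edge_notMem_edges_of_isCycle hC hnext hdC ?_ hgsnd ?_ hgd
    · rw [hgk]
      exact (fst_getElem_darts P hk').symm
    · rw [SimpleGraph.Dart.symm_symm]
      exact hne hkj hk'

theorem IsThreeOrientation.ncard_fst_mem_le (hE : G.IsThreeOrientation E) (t : Set V) :
    {d | d ∈ E ∧ d.fst ∈ t}.ncard ≤ 3 * t.ncard :=
  ncard_le_mul_ncard_of_fiber (f := fun d => d.fst) (fun _ hd => hd.2) fun x _ => by
    have hle : {d | d ∈ {d | d ∈ E ∧ d.fst ∈ t} ∧ d.fst = x}.ncard ≤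
      {d | d ∈ E ∧ d.fst = x}.ncard := Set.ncard_le_ncard fun d hd => ⟨hd.1.1, hd.2⟩
    exact hle.trans (hE.outdeg_le x)

theorem IsLeftmost.rightOut_union_subset_forwardCycle (hE : G.IsThreeOrientation E)
    (hP : G.IsLeftmost E P) (hPp : P.IsPath) (hx : IsExcursion P Q s t i j) (hij : i < j)
    (hC : (hx.forwardCycle hij.le).IsCycle)
    (hroot : G.rootFace ∈ G.leftFaces (hx.forwardCycle hij.le)) :
    rightOut E (hx.forwardCycle hij.le) ∪ {d | d ∈ E ∧ d.edge ∈ (hx.forwardCycle hij.le).edges} ⊆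
      {d | d ∈ (walkSegment P (i + 1) j hij).darts} ∪
        {d | d ∈ E ∧ d.fst ∈ Q.getVert '' Set.Ico s t} := by
  rintro g hg
  have hgE : g ∈ E := hg.elim (fun h => h.1.1) fun h => h.1
  have hgC : g.fst ∈ (hx.forwardCycle hij.le).support :=
    hg.elim (fun h => h.2) fun h => SimpleGraph.Walk.fst_mem_support_of_mem_edges _ h.2
  have hpath : ∀ l, i ≤ l → l + 1 ≤ j → g.fst = P.getVert (l + 1) →
      g ∈ (walkSegment P (i + 1) j hij).darts := fun l hil hlj hgl => by
    by_contra hgP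
    obtain ⟨hleft, hedge⟩ := hP.leftFace_mem_and_edge_notMem_forwardCycle hE hPp hx hij.le hC hroot
      hil hlj hgE hgl fun hlj' hl h => hgP
        (mem_darts_walkSegment.2 ⟨l + 1, by omega, hlj', hl, h.symm⟩)
    refine hg.elim (fun h => ?_) fun h => hedge h.2
    exact Set.disjoint_left.1 (disjoint_leftFaces_rightFaces (M := G.toPlanarMap) hC) hleft h.1.2.1
  rcases (hx.mem_support_forwardCycle hij.le).1 hgC with hgC | ⟨k, hik, hkj, hgk⟩
  · obtain ⟨r, hsr, hrt, hgr⟩ := hx.mem_support_arc.1 hgC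
    rcases hrt.eq_or_lt with rfl | hrt
    · exact Or.inl (hpath (j - 1) (by omega) (by omega)
        (by rw [Nat.sub_add_cancel (by omega), ← hgr, hx.right_eq]))
    · exact Or.inr ⟨hgE, r, ⟨hsr, hrt⟩, hgr⟩
  · rcases hik.eq_or_lt with rfl | hik
    · exact Or.inr ⟨hgE, s, ⟨le_rfl, hx.lt⟩, hx.left_eq.trans hgk⟩
    · exact Or.inl (hpath (k - 1) (by omega) (by omega)
        (by rw [Nat.sub_add_cancel (by omega), hgk]))

theorem IsLeftmost.sub_le_add_two (hE : G.IsThreeOrientation E) (hP : G.IsLeftmost E P)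
    (hPp : P.IsPath) (hx : IsExcursion P Q s t i j) (hij : i < j)
    (hC : (hx.forwardCycle hij.le).IsCycle)
    (hroot : G.rootFace ∈ G.leftFaces (hx.forwardCycle hij.le)) : j - i ≤ t - s + 2 := by
  classical
  have hO : G.IsOrientation E := hE.orientation
  have hsub := Set.ncard_le_ncard (hP.rightOut_union_subset_forwardCycle hE hPp hx hij hC hroot)
  have hdisj : Disjoint (rightOut E (hx.forwardCycle hij.le))
      {d | d ∈ E ∧ d.edge ∈ (hx.forwardCycle hij.le).edges} := by
    refine Set.disjoint_left.2 fun d hd hd' => ?_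
    refine edge_notMem_edges_of_leftFace_iff (M := G.toPlanarMap) hC ?_ hd'.2
    exact iff_of_false ((mem_rightFaces_iff_notMem_leftFaces (M := G.toPlanarMap) hC).1 hd.1.2.1)
      ((mem_rightFaces_iff_notMem_leftFaces (M := G.toPlanarMap) hC).1 hd.1.2.2)
  have hpath : {d | d ∈ (walkSegment P (i + 1) j hij).darts}.ncard ≤ j - (i + 1) := by
    rw [← length_walkSegment (hij := hij) hx.right_le, ← SimpleGraph.Walk.length_darts,
      ← List.coe_toFinset, Set.ncard_coe_finset]
    exact List.toFinset_card_le _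
  have harc : (Q.getVert '' Set.Ico s t).ncard ≤ t - s := by
    rw [← Nat.card_Ico, ← Set.ncard_coe_finset, Finset.coe_Ico]
    exact Set.ncard_image_le
  have hstars := hE.ncard_fst_mem_le (Q.getVert '' Set.Ico s t)
  have hunion := Set.ncard_union_le {d | d ∈ (walkSegment P (i + 1) j hij).darts}
    {d | d ∈ E ∧ d.fst ∈ Q.getVert '' Set.Ico s t}
  have hout := hE.ncard_rightOut hC hroot
  rw [Set.ncard_union_eq hdisj, hO.ncard_edge_mem_edges hC.isTrail] at hsub
  rw [hx.length_forwardCycle] at hout hsub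
  omega

end PlantedTriangulation

section Interleaved

variable {T s : ℕ → ℕ} {L k m n r : ℕ}

theorem add_le_of_interleaved (hTs : ∀ n < k, T n ≤ s n) (hsT : ∀ n < k, s n < T (n + 1))
    (hk : r + n ≤ k) : T r + n ≤ T (r + n) := by
  induction n with
  | zero => exact le_rfl
  | succ n ih =>
    have := ih (by omega)
    have := hTs (r + n) (by omega)
    have := hsT (r + n) (by omega)
    rw [← add_assoc r]
    omega

theorem sum_sub_le_of_interleaved (hTs : ∀ n < k, T n ≤ s n) (hsT : ∀ n < k, s n < T (n + 1))
    (hk : r + n ≤ k) :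
    ∑ l ∈ Finset.range n, (T (r + l + 1) - s (r + l)) ≤ T (r + n) - T r := by
  induction n with
  | zero => exact Nat.zero_le _
  | succ n ih =>
    have := ih (by omega)
    have := hTs (r + n) (by omega)
    have := hsT (r + n) (by omega)
    have := add_le_of_interleaved hTs hsT (r := r) (n := n) (by omega)
    rw [Finset.sum_range_succ, ← add_assoc r]
    omega

theorem exists_short_step (hTs : ∀ n < k, T n ≤ s n) (hsT : ∀ n < k, s n < T (n + 1))
    (hTL : T k ≤ L) (hm : 1 ≤ m) (hk : 3 * m ≤ k) :
    ∃ n < k, m * (T (n + 1) - s n) + 2 * m ≤ L ∧ m ≤ s n ∧ m + T (n + 1) ≤ L := by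
  have hT : ∀ r n, r + n ≤ k → T r + n ≤ T (r + n) := fun _ _ => add_le_of_interleaved hTs hsT
  have hT0 : m ≤ T m := by simpa using (Nat.le_add_left m (T 0)).trans (hT 0 m (by omega))
  have hT2 : T m + m ≤ T (2 * m) := two_mul m ▸ hT m m (by omega)
  have hTk : T (2 * m) + m ≤ L := by
    have := hT (2 * m) (k - 2 * m) (by omega)
    rw [Nat.add_sub_cancel' (by omega)] at this
    omega
  obtain ⟨n, hn, hle⟩ : ∃ n ∈ Finset.range m, m * (T (m + n + 1) - s (m + n)) ≤ L - 2 * m := by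
    refine Finset.exists_le_of_sum_le (Finset.nonempty_range_iff.2 (by omega)) ?_
    rw [← Finset.mul_sum, Finset.sum_const, Finset.card_range, smul_eq_mul]
    refine Nat.mul_le_mul_left m ((sum_sub_le_of_interleaved hTs hsT (by omega)).trans ?_)
    rw [← two_mul]
    omega
  rw [Finset.mem_range] at hn
  have hTn := hT m n (by omega)
  have hTs := hTs (m + n) (by omega)
  have hlast := hT (m + n + 1) (2 * m - (m + n + 1)) (by omega)
  rw [Nat.add_sub_cancel' (by omega)] at hlast
  exact ⟨m + n, by omega, by omega, by omega, by omega⟩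

end Interleaved

section Descent

variable {S : ℕ → Prop} {ω : ℕ → ℤ} {r t : ℕ}

variable (S ω r t) in
/-- `t` is the first of the positions in `S` at which `ω` has decreased to `-r`. -/
structure IsFirstPassage : Prop where
  mem : S t
  le : ω t ≤ -r
  lt : ∀ t' < t, S t' → -(r : ℤ) < ω t'

theorem exists_isFirstPassage {L : ℕ} (hL : S L) (hω : ω L ≤ -r) :
    ∃ t ≤ L, IsFirstPassage S ω r t := by
  classical
  have hex : ∃ t, S t ∧ ω t ≤ -r := ⟨L, hL, hω⟩
  refine ⟨Nat.find hex, Nat.find_min' hex ⟨hL, hω⟩, (Nat.find_spec hex).1, (Nat.find_spec hex).2,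
    fun t' ht' hS => ?_⟩
  by_contra! h
  exact Nat.find_min hex ht' ⟨hS, h⟩

theorem IsFirstPassage.exists_step (h : IsFirstPassage S ω (r + 1) t) (h0 : S 0) (hω0 : 0 ≤ ω 0)
    (hstep : ∀ s, S s → s < t → (∀ l, s < l → l < t → ¬ S l) → ω s - 1 ≤ ω t) :
    ∃ s < t, S s ∧ (∀ l, s < l → l < t → ¬ S l) ∧ ω t = ω s - 1 ∧
      ∀ t', IsFirstPassage S ω r t' → t' ≤ s := by
  classical
  have hle := h.le
  have ht : 0 < t := Nat.pos_of_ne_zero fun h0 => by rw [h0] at hle; push_cast at hle; omega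
  obtain ⟨s, hst, hs, hgap⟩ : ∃ s < t, S s ∧ ∀ l, s < l → l < t → ¬ S l := by
    have hs := Nat.findGreatest_spec (P := S) (Nat.zero_le (t - 1)) h0
    have hst := Nat.findGreatest_le (P := S) (t - 1)
    exact ⟨_, by omega, hs, fun l hl hlt => Nat.findGreatest_is_greatest hl (by omega)⟩
  have hdown := hstep s hs hst hgap
  have hlt := h.lt s hst hs
  push_cast at hle hlt
  refine ⟨s, hst, hs, hgap, by omega, fun t' ht' => ?_⟩
  by_contra! hs'
  have := ht'.lt s hs' hs
  omega

theorem exists_short_descent {L k m : ℕ} (h0 : S 0) (hL : S L) (hω0 : 0 ≤ ω 0) (hωL : ω L ≤ -k)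
    (hstep : ∀ s t, S s → S t → s < t → t ≤ L → (∀ r, s < r → r < t → ¬ S r) → ω s - 1 ≤ ω t)
    (hm : 1 ≤ m) (hk : 3 * m ≤ k) :
    ∃ s t, S s ∧ S t ∧ s < t ∧ t ≤ L ∧ (∀ r, s < r → r < t → ¬ S r) ∧ ω t = ω s - 1 ∧
      m * (t - s) + 2 * m ≤ L ∧ m ≤ s ∧ m + t ≤ L := by
  have hpassage : ∀ r, ∃ t, r ≤ k → t ≤ L ∧ IsFirstPassage S ω r t := fun r => by
    by_cases hr : r ≤ k
    · obtain ⟨t, ht⟩ := exists_isFirstPassage (ω := ω) (r := r) hL (by omega)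
      exact ⟨t, fun _ => ht⟩
    · exact ⟨0, fun h => absurd h hr⟩
  choose T hT using hpassage
  have hpred : ∀ r, ∃ s, r < k → s < T (r + 1) ∧ S s ∧ (∀ l, s < l → l < T (r + 1) → ¬ S l) ∧
      ω (T (r + 1)) = ω s - 1 ∧ ∀ t', IsFirstPassage S ω r t' → t' ≤ s := fun r => by
    by_cases hr : r < k
    · obtain ⟨hTL, hfirst⟩ := hT (r + 1) hr
      obtain ⟨s, hs⟩ := hfirst.exists_step h0 hω0 fun s hs hst => hstep s _ hs hfirst.mem hst hTL
      exact ⟨s, fun _ => hs⟩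
    · exact ⟨0, fun h => absurd h hr⟩
  choose s hs using hpred
  obtain ⟨n, hn, hshort⟩ := exists_short_step (fun n hn => (hs n hn).2.2.2.2 _ (hT n hn.le).2)
    (fun n hn => (hs n hn).1) (hT k le_rfl).1 hm hk
  obtain ⟨hst, hSs, hgap, hω, -⟩ := hs n hn
  exact ⟨s n, T (n + 1), hSs, (hT (n + 1) hn).2.mem, hst, (hT (n + 1) hn).1, hgap, hω, hshort⟩

end Descent

namespace RotationSystem

variable {V : Type*} [Finite V] {M : RotationSystem V} {a : V} {W : M.graph.Walk a a}

theorem IsPotential.wind_eq {h : M.Face → ℤ} (hh : M.IsPotential (walkFlow W) h) (r x : M.Face) :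
    M.wind r x W = h x - h r := by
  have hex : ∃ f, M.IsWindingFunction W r f :=
    ⟨fun f => h f - h r, sub_self _, fun d => (sub_sub_sub_cancel_right _ _ _).trans (hh d)⟩
  have hwind : M.IsPotential (walkFlow W) hex.choose := hex.choose_spec.2
  rw [wind, dif_pos hex, ← hwind.sub_eq hh, hex.choose_spec.1, sub_zero]

theorem wind_eq_zero (h : ∀ d, walkFlow W d = 0) (r x : M.Face) : M.wind r x W = 0 :=
  IsPotential.wind_eq (h := 0) (fun d => by simp [h d]) r x

end RotationSystem

namespace PlanarMap

open RotationSystem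

variable {V : Type*} [Finite V] {M : PlanarMap V} {a b c : V} {W : M.graph.Walk a a}
  {W₁ : M.graph.Walk b b} {W₂ : M.graph.Walk c c}

theorem wind_eq_add (h : ∀ d, walkFlow W d = walkFlow W₁ d + walkFlow W₂ d) (r x : M.Face) :
    M.wind r x W = M.wind r x W₁ + M.wind r x W₂ := by
  obtain ⟨h₁, hh₁⟩ := M.exists_isPotential_walkFlow W₁
  obtain ⟨h₂, hh₂⟩ := M.exists_isPotential_walkFlow W₂
  have hh : M.IsPotential (walkFlow W) (fun f => h₁ f + h₂ f) := fun d => by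
    rw [h d, ← hh₁ d, ← hh₂ d]
    ring
  rw [hh.wind_eq, hh₁.wind_eq, hh₂.wind_eq]
  ring

theorem wind_cases_of_isCycle (hW : W.IsCycle) (r x : M.Face) :
    (r ∈ M.leftFaces W ∧ x ∈ M.rightFaces W ∧ M.wind r x W = -1) ∨ 0 ≤ M.wind r x W := by
  rw [(isPotential_leftIndicator hW).wind_eq, mem_leftFaces_iff, mem_rightFaces_iff hW]
  unfold leftIndicator
  split_ifs <;> simp

theorem wind_congr (h : ∀ d, walkFlow W d = walkFlow W₁ d) (r x : M.Face) :
    M.wind r x W = M.wind r x W₁ := by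
  obtain ⟨f, hf⟩ := M.exists_isPotential_walkFlow W₁
  rw [hf.wind_eq, IsPotential.wind_eq (h := f) fun d => (hf d).trans (h d).symm]

end PlanarMap

section Lasso

variable {V : Type*} {G : SimpleGraph V} {x y : V} {P Q : G.Walk x y} {s t i j : ℕ}

/-- The closed walk that follows `Q` up to the position `s`, and comes back along `P` from the
position `i`. -/
def lasso (h : Q.getVert s = P.getVert i) : G.Walk x x :=
  (Q.take s).append ((P.take i).reverse.copy h.symm rfl)

theorem walkFlow_lasso (h : Q.getVert s = P.getVert i) (d : G.Dart) :
    walkFlow (lasso h) d = walkFlow (Q.take s) d - walkFlow (P.take i) d := by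
  rw [lasso, walkFlow_append, walkFlow_copy, walkFlow_reverse, sub_eq_add_neg]

end Lasso

namespace IsExcursion

open RotationSystem PlanarMap

variable {V : Type*} [Finite V] {M : PlanarMap V} {x y : V} {P Q : M.graph.Walk x y} {s t i j : ℕ}

theorem wind_lasso_of_le (hx : IsExcursion P Q s t i j) (hij : i ≤ j) (f g : M.Face) :
    M.wind f g (lasso hx.right_eq) =
      M.wind f g (lasso hx.left_eq) + M.wind f g (hx.forwardCycle hij) :=
  wind_eq_add (fun d => by
    rw [hx.walkFlow_forwardCycle, walkFlow_lasso, walkFlow_lasso, add_sub_cancel]) f g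

theorem wind_lasso_of_ge (hx : IsExcursion P Q s t i j) (hji : j ≤ i) (f g : M.Face) :
    M.wind f g (lasso hx.right_eq) =
      M.wind f g (lasso hx.left_eq) + M.wind f g (hx.backwardCycle hji) :=
  wind_eq_add (fun d => by
    rw [hx.walkFlow_backwardCycle, walkFlow_lasso, walkFlow_lasso, add_sub_cancel]) f g

theorem wind_forwardCycle_cases (hx : IsExcursion P Q s t i j) (hP : P.IsPath) (hQ : Q.IsPath)
    (hij : i ≤ j) (f g : M.Face) :
    ((hx.forwardCycle hij).IsCycle ∧ f ∈ M.leftFaces (hx.forwardCycle hij) ∧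
      g ∈ M.rightFaces (hx.forwardCycle hij) ∧ M.wind f g (hx.forwardCycle hij) = -1) ∨
      0 ≤ M.wind f g (hx.forwardCycle hij) := by
  by_cases hone : t - s = 1 ∧ j - i = 1
  · exact Or.inr (wind_eq_zero (hx.walkFlow_forwardCycle_eq_zero hij hone.1 hone.2) f g).ge
  · have hC := hx.isCycle_forwardCycle hP hQ hij hone
    exact (wind_cases_of_isCycle hC f g).imp_left fun h => ⟨hC, h⟩

theorem wind_backwardCycle_cases (hx : IsExcursion P Q s t i j) (hP : P.IsPath) (hQ : Q.IsPath)
    (hji : j ≤ i) (f g : M.Face) :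
    ((hx.backwardCycle hji).IsCycle ∧ f ∈ M.leftFaces (hx.backwardCycle hji) ∧
      g ∈ M.rightFaces (hx.backwardCycle hji)) ∨ 0 ≤ M.wind f g (hx.backwardCycle hji) := by
  by_cases hone : t - s = 1 ∧ i - j = 1
  · exact Or.inr (wind_eq_zero (hx.walkFlow_backwardCycle_eq_zero hji hone.1 hone.2) f g).ge
  · have hC := hx.isCycle_backwardCycle hP hQ hji hone
    exact (wind_cases_of_isCycle hC f g).imp_left fun h => ⟨hC, h.1, h.2.1⟩

end IsExcursion

section LassoEnds

open RotationSystem PlanarMap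

variable {V : Type*} [Finite V] {M : PlanarMap V} {x y : V} {P Q : M.graph.Walk x y} {i : ℕ}

theorem wind_lasso_zero (hP : P.IsPath) (hi : i ≤ P.length) (h : Q.getVert 0 = P.getVert i)
    (f g : M.Face) : M.wind f g (lasso h) = 0 := by
  obtain rfl : i = 0 := (hP.getVert_eq_start_iff hi).1 (h.symm.trans Q.getVert_zero)
  refine wind_eq_zero (fun d => ?_) f g
  rw [walkFlow_lasso]
  simp [walkFlow]

theorem wind_lasso_length (hP : P.IsPath) (hi : i ≤ P.length)
    (h : Q.getVert Q.length = P.getVert i) (f g : M.Face) :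
    M.wind f g (lasso h) = M.wind f g (Q.append P.reverse) := by
  obtain rfl : i = P.length := (hP.getVert_eq_end_iff hi).1 (h.symm.trans Q.getVert_length)
  have hflow : ∀ (W : M.graph.Walk x y) d, walkFlow (W.take W.length) d = walkFlow W d :=
    fun W d => by simp only [walkFlow, SimpleGraph.Walk.darts_take, ← W.length_darts,
      List.take_length]
  refine wind_congr (fun d => ?_) f g
  rw [walkFlow_lasso, hflow, hflow, walkFlow_append, walkFlow_reverse, sub_eq_add_neg]

end LassoEnds

namespace PlantedTriangulation

open RotationSystem PlanarMap

variable {V : Type*} [Finite V] {G : PlantedTriangulation V} {E : Set G.graph.Dart}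
  {e : G.graph.Dart} {P Q : G.graph.Walk e.fst G.A} {s t i j : ℕ}

theorem IsLeftmostPath.wind_backwardCycle_nonneg (hE : G.IsMinimalThreeOrientation E) (he : e ∈ E)
    (hP : G.IsLeftmostPath E e P) (hQ : Q.length = G.graph.dist e.fst G.A)
    (hx : IsExcursion P Q s t i j) (hji : j ≤ i) :
    0 ≤ G.wind G.rootFace (G.rightFace e) (hx.backwardCycle hji) := by
  have hPl := hP.isLeftmost he
  have hPp := hPl.isPath hE
  refine (hx.wind_backwardCycle_cases (M := G.toPlanarMap) hPp (Q.isPath_of_length_eq_dist hQ) hji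
    _ _).resolve_left ?_
  rintro ⟨hC, hroot, hright⟩
  obtain ⟨h0, hleft⟩ := hPl.exists_rightFace_mem_leftFaces_backwardCycle
    hE.toIsThreeOrientation hPp hQ hx hji hC hroot
  have hfirst : P.darts[0] = e := by
    have := hP.1
    rwa [List.head?_eq_getElem?, List.getElem?_eq_getElem h0, Option.some_inj] at this
  rw [hfirst] at hleft
  exact (mem_rightFaces_iff_notMem_leftFaces (M := G.toPlanarMap) hC).1 hright hleft

theorem IsLeftmostPath.wind_lasso_cases (hE : G.IsMinimalThreeOrientation E) (he : e ∈ E)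
    (hP : G.IsLeftmostPath E e P) (hQ : Q.length = G.graph.dist e.fst G.A)
    (hx : IsExcursion P Q s t i j) :
    (G.wind G.rootFace (G.rightFace e) (lasso hx.right_eq) =
        G.wind G.rootFace (G.rightFace e) (lasso hx.left_eq) - 1 ∧
      ∃ hij : i < j, (hx.forwardCycle hij.le).IsCycle ∧
        G.rootFace ∈ G.leftFaces (hx.forwardCycle hij.le) ∧
        G.rightFace e ∈ G.rightFaces (hx.forwardCycle hij.le)) ∨
    G.wind G.rootFace (G.rightFace e) (lasso hx.left_eq) ≤
      G.wind G.rootFace (G.rightFace e) (lasso hx.right_eq) := by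
  have hQp := Q.isPath_of_length_eq_dist hQ
  rcases (hx.ne hQp).lt_or_gt with hij | hji
  · rw [hx.wind_lasso_of_le (M := G.toPlanarMap) hij.le]
    rcases hx.wind_forwardCycle_cases (M := G.toPlanarMap) ((hP.isLeftmost he).isPath hE) hQp hij.le
      G.rootFace (G.rightFace e) with ⟨hC, hroot, hright, hwind⟩ | hwind
    · exact Or.inl ⟨by rw [hwind]; rfl, hij, hC, hroot, hright⟩
    · exact Or.inr (le_add_of_nonneg_right hwind)
  · rw [hx.wind_lasso_of_ge (M := G.toPlanarMap) hji.le]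
    exact Or.inr (le_add_of_nonneg_right (hP.wind_backwardCycle_nonneg hE he hQ hx hji.le))

theorem IsLeftmostPath.exists_short_cycle (hE : G.IsMinimalThreeOrientation E) (he : e ∈ E)
    (hP : G.IsLeftmostPath E e P) (hQ : Q.length = G.graph.dist e.fst G.A) {m : ℕ} (hm : 1 ≤ m)
    (hw : 3 * (m : ℤ) ≤ -G.windingNumber P Q) :
    ∃ s t i j, ∃ hx : IsExcursion P Q s t i j, ∃ hij : i < j, (hx.forwardCycle hij.le).IsCycle ∧
      G.rootFace ∈ G.leftFaces (hx.forwardCycle hij.le) ∧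
      G.rightFace e ∈ G.rightFaces (hx.forwardCycle hij.le) ∧
      m * (t - s) + 2 * m ≤ Q.length ∧ m ≤ s ∧ m + t ≤ Q.length := by
  classical
  have hPp := (hP.isLeftmost he).isPath hE
  set index : ℕ → ℕ := fun s => P.support.idxOf (Q.getVert s)
  have hindex_le : ∀ s, Q.getVert s ∈ P.support → index s ≤ P.length := fun s hs => by
    have := List.idxOf_lt_length_of_mem hs
    rw [P.length_support] at this
    exact Nat.le_of_lt_succ this
  have hindex : ∀ s, Q.getVert s ∈ P.support → Q.getVert s = P.getVert (index s) :=
    fun s hs => (P.getVert_support_idxOf hs).symm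
  let ω : ℕ → ℤ := fun s => if h : Q.getVert s ∈ P.support then
    G.wind G.rootFace (G.rightFace e) (lasso (hindex s h)) else 0
  have hω : ∀ s (h : Q.getVert s ∈ P.support),
      ω s = G.wind G.rootFace (G.rightFace e) (lasso (hindex s h)) := fun s h => dif_pos h
  have hS0 : Q.getVert 0 ∈ P.support := by
    rw [Q.getVert_zero]; exact P.start_mem_support
  have hSL : Q.getVert Q.length ∈ P.support := by
    rw [Q.getVert_length]; exact P.end_mem_support
  have hω0 : ω 0 = 0 := (hω 0 hS0).trans
    (wind_lasso_zero (M := G.toPlanarMap) hPp (hindex_le 0 hS0) (hindex 0 hS0) _ _)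
  have hωL : ω Q.length = G.windingNumber P Q := (hω _ hSL).trans
    (wind_lasso_length (M := G.toPlanarMap) hPp (hindex_le _ hSL) (hindex _ hSL) _ _)
  have hexcursion : ∀ s t, Q.getVert s ∈ P.support → Q.getVert t ∈ P.support → s < t →
      t ≤ Q.length → (∀ r, s < r → r < t → Q.getVert r ∉ P.support) →
      IsExcursion P Q s t (index s) (index t) := fun s t hs ht hst htL hgap =>
    ⟨hst, htL, hindex_le s hs, hindex_le t ht, hindex s hs, hindex t ht, hgap⟩
  obtain ⟨s, t, hs, ht, hst, htL, hgap, hdown, hshort⟩ :=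
    exists_short_descent (S := fun s => Q.getVert s ∈ P.support) (ω := ω)
      (k := (-G.windingNumber P Q).toNat) hS0 hSL hω0.ge (by omega)
      (fun s t hs ht hst htL hgap => by
        have := hP.wind_lasso_cases hE he hQ (hexcursion s t hs ht hst htL hgap)
        rw [hω s hs, hω t ht]
        omega) hm (by omega)
  have hx := hexcursion s t hs ht hst htL hgap
  rw [hω s hs, hω t ht] at hdown
  rcases hP.wind_lasso_cases hE he hQ hx with ⟨-, hij, hC, hroot, hright⟩ | hle
  · exact ⟨s, t, index s, index t, hx, hij, hC, hroot, hright, hshort⟩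
  · omega

end PlantedTriangulation

namespace RotationSystem

variable {V : Type*} {M : RotationSystem V}

theorem exists_bijOn_rot_pow [Finite V] (d : M.graph.Dart) : ∃ p, (M.rot ^ p) (M.rot d) = d ∧
    Set.BijOn (fun i => (M.rot ^ i) (M.rot d)) (Set.Iic p) {g | g.fst = d.fst} := by
  obtain ⟨p, hp, hinj⟩ := exists_rot_pow_injOn (M.rot_fst d)
  refine ⟨p, hp, fun i _ => (M.rot_pow_fst _ i).trans (M.rot_fst d), hinj, fun g hg => ?_⟩
  refine M.rot_induction (p := fun g => g ∈ (fun i => (M.rot ^ i) (M.rot d)) '' Set.Iic p)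
    (d := M.rot d) ⟨0, Nat.zero_le p, rfl⟩ ((M.rot_fst d).trans (Eq.symm hg)) ?_
  rintro _ - ⟨i, hi, rfl⟩
  rcases (Set.mem_Iic.1 hi).eq_or_lt with rfl | hlt
  · exact ⟨0, Nat.zero_le i, congrArg M.rot hp.symm⟩
  · exact ⟨i + 1, hlt, M.rot_pow_succ_apply _ i⟩

open Classical in
theorem count_rot_pow_eq {d : M.graph.Dart} {p : ℕ}
    (hp : Set.BijOn (fun i => (M.rot ^ i) d) (Set.Iic p) {g | g.fst = d.fst})
    (E : Set M.graph.Dart) :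
    Nat.count (fun i => (M.rot ^ i) d ∈ E) (p + 1) = {g | g ∈ E ∧ g.fst = d.fst}.ncard := by
  have himage : {g | g ∈ E ∧ g.fst = d.fst} = (fun i => (M.rot ^ i) d) ''
      ↑({i ∈ Finset.range (p + 1) | (M.rot ^ i) d ∈ E} : Finset ℕ) := by
    ext g
    simp only [Finset.coe_filter, Finset.mem_range, Nat.lt_succ_iff]
    constructor
    · rintro ⟨hg, hgd⟩
      obtain ⟨i, hi, rfl⟩ := hp.surjOn hgd
      exact ⟨i, ⟨hi, hg⟩, rfl⟩
    · rintro ⟨i, ⟨-, hi⟩, rfl⟩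
      exact ⟨hi, M.rot_pow_fst d i⟩
  rw [himage, Set.InjOn.ncard_image, Set.ncard_coe_finset, Nat.count_eq_card_filter_range]
  refine hp.injOn.mono fun i hi => ?_
  simp only [Finset.coe_filter, Finset.mem_range, Nat.lt_succ_iff] at hi
  exact hi.1

end RotationSystem

namespace PlantedTriangulation

open RotationSystem

section Contour

variable {V : Type*} {G : PlantedTriangulation V} {T E : Set G.graph.Dart}
  {g g' g'' : G.graph.Dart} {l l' : ℤ}

theorem contour_succ (t : ℕ) : G.contour T (t + 1) = G.contourNext T (G.contour T t) :=
  Function.iterate_succ_apply' _ _ _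

theorem contourNext_of_mem (h : g ∈ T ∨ g.symm ∈ T) : G.contourNext T g = G.faceNext g := if_pos h

theorem contourNext_of_notMem (h : ¬(g ∈ T ∨ g.symm ∈ T)) : G.contourNext T g = G.rot g := if_neg h

theorem contourNext_injective : Function.Injective (G.contourNext T) := by
  intro d d' h
  by_cases h1 : d ∈ T ∨ d.symm ∈ T <;> by_cases h2 : d' ∈ T ∨ d'.symm ∈ T
  · rw [contourNext_of_mem h1, contourNext_of_mem h2] at h
    exact G.faceNext.injective h
  · rw [contourNext_of_mem h1, contourNext_of_notMem h2, faceNext_apply] at h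
    rw [← G.rot.injective h, SimpleGraph.Dart.symm_symm] at h2
    exact absurd h1.symm h2
  · rw [contourNext_of_notMem h1, contourNext_of_mem h2, faceNext_apply] at h
    rw [G.rot.injective h, SimpleGraph.Dart.symm_symm] at h1
    exact absurd h2.symm h1
  · rw [contourNext_of_notMem h1, contourNext_of_notMem h2] at h
    exact G.rot.injective h

theorem contourLength_pos [Finite V] : 0 < G.contourLength T :=
  Function.minimalPeriod_pos_of_mem_periodicPts (contourNext_injective.mem_periodicPts _)

theorem contour_contourLength : G.contour T (G.contourLength T) = G.root :=
  Function.iterate_minimalPeriod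

theorem contour_injOn : Set.InjOn (G.contour T) (Set.Iio (G.contourLength T)) :=
  Function.iterate_injOn_Iio_minimalPeriod

open Classical in
variable (T E g) in
/-- The change of the label in the step of the contour exploration that starts at the corner `g`. -/
noncomputable def labelStep : ℤ :=
  if g ∈ T ∨ g.symm ∈ T then -1 else if g ∈ E then 1 else 0

theorem cornerLabel_succ (t : ℕ) :
    G.cornerLabel T E (t + 1) = G.cornerLabel T E t + labelStep T E (G.contour T t) := by
  rw [cornerLabel, labelStep]
  split_ifs <;> ring

variable (T E g) in
/-- The contour exploration leads from the corner `g` to the corner `g'` without returning to the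
root corner, and the label changes by `l` on the way. -/
inductive ContourLeads : ℤ → G.graph.Dart → Prop
  | refl : ContourLeads 0 g
  | tail {l : ℤ} {g' : G.graph.Dart} (h : ContourLeads l g') (hr : G.contourNext T g' ≠ G.root) :
    ContourLeads (l + labelStep T E g') (G.contourNext T g')

theorem ContourLeads.trans (h : ContourLeads T E g l g') (h' : ContourLeads T E g' l' g'') :
    ContourLeads T E g (l + l') g'' := by
  induction h' with
  | refl => rwa [add_zero]
  | tail _ hr ih => rw [← add_assoc]; exact ih.tail hr

theorem contourLeads_faceNext (hg : g ∈ T ∨ g.symm ∈ T) (hr : G.faceNext g ≠ G.root) :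
    ContourLeads T E g (-1) (G.faceNext g) := by
  rw [← contourNext_of_mem hg] at hr ⊢
  simpa only [labelStep, if_pos hg, zero_add] using ContourLeads.refl.tail hr

open Classical in
theorem contourLeads_rot_of_notMem (hg : ¬(g ∈ T ∨ g.symm ∈ T)) (hr : G.rot g ≠ G.root) :
    ContourLeads T E g (if g ∈ E then 1 else 0) (G.rot g) := by
  rw [← contourNext_of_notMem hg] at hr ⊢
  simpa only [labelStep, if_neg hg, zero_add] using ContourLeads.refl.tail hr

theorem ContourLeads.exists_contour_eq (h : ContourLeads T E g l g') {s : ℕ}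
    (hs : s < G.contourLength T) (hg : G.contour T s = g) :
    ∃ t < G.contourLength T, s ≤ t ∧ G.contour T t = g' ∧
      G.cornerLabel T E t = G.cornerLabel T E s + l := by
  induction h with
  | refl => exact ⟨s, hs, le_rfl, hg, (add_zero _).symm⟩
  | tail _ hr ih =>
    obtain ⟨t, ht, hst, rfl, hl⟩ := ih
    rw [← contour_succ] at hr ⊢
    refine ⟨t + 1, lt_of_le_of_ne ht ?_, by omega, rfl, by rw [cornerLabel_succ, hl, add_assoc]⟩
    exact fun hlast => hr (hlast ▸ contour_contourLength)

end Contour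

namespace IsBlossomingTree

variable {V : Type*} {G : PlantedTriangulation V} {E T : Set G.graph.Dart} {d g : G.graph.Dart}

theorem rot_pow_rot_ne_root (hT : G.IsBlossomingTree T E) (hd : d ∈ T) (n : ℕ) :
    (G.rot ^ n) (G.rot d) ≠ G.root := fun h =>
  hT.root_no_parent d hd (by rw [← G.rot_fst, ← G.rot_pow_fst _ n, h]; rfl)

open Classical in
theorem contourLeads_rot (hO : G.IsOrientation E) (hT : G.IsBlossomingTree T E) (hg : g ∉ T)
    (hr : G.rot g ≠ G.root)
    (htour : ∀ d ∈ T, d.snd = g.fst → ContourLeads T E (G.rot d) 2 d) :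
    ContourLeads T E g (if g ∈ E then 1 else 0) (G.rot g) := by
  by_cases h : g.symm ∈ T
  · have hup : ContourLeads T E g (-1) (G.rot g.symm) :=
      contourLeads_faceNext (Or.inr h) (hT.rot_pow_rot_ne_root h 0)
    have hrot : G.faceNext g.symm = G.rot g := by rw [faceNext_apply, SimpleGraph.Dart.symm_symm]
    have hdown : ContourLeads T E g.symm (-1) (G.rot g) :=
      hrot ▸ contourLeads_faceNext (Or.inl h) (hrot ▸ hr)
    rw [if_neg ((hO g).1 (hT.oriented h))]
    exact (hup.trans (htour _ h rfl)).trans hdown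
  · exact contourLeads_rot_of_notMem (by tauto) hr

open Classical in
theorem contourLeads_rot_pow (hO : G.IsOrientation E) (hT : G.IsBlossomingTree T E)
    (htour : ∀ d ∈ T, d.snd = g.fst → ContourLeads T E (G.rot d) 2 d) {n : ℕ}
    (hg : ∀ i < n, (G.rot ^ i) g ∉ T) (hr : ∀ i < n, (G.rot ^ (i + 1)) g ≠ G.root) :
    ContourLeads T E g (Nat.count (fun i => (G.rot ^ i) g ∈ E) n) ((G.rot ^ n) g) := by
  induction n with
  | zero => exact .refl
  | succ n ih =>
    have hn := hr n (Nat.lt_succ_self n)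
    rw [G.rot_pow_succ_apply] at hn ⊢
    have hstep := hT.contourLeads_rot hO (hg n (Nat.lt_succ_self n)) hn
      (by rwa [G.rot_pow_fst])
    rw [Nat.count_succ]
    push_cast
    exact (ih (fun i hi => hg i (by omega)) fun i hi => hr i (by omega)).trans hstep

variable [Finite V]

theorem contourLeads_of_mem_of_forall (hE : G.IsThreeOrientation E) (hT : G.IsBlossomingTree T E)
    (hd : d ∈ T) (htour : ∀ d' ∈ T, d'.snd = d.fst → ContourLeads T E (G.rot d') 2 d') :
    ContourLeads T E (G.rot d) 2 d ∧
      ∀ g : G.graph.Dart, g.fst = d.fst → ∃ n : ℕ, n ≤ 2 ∧ ContourLeads T E (G.rot d) n g := by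
  classical
  obtain ⟨p, hpd, hbij⟩ := exists_bijOn_rot_pow (M := G.toRotationSystem) d
  have hleads : ∀ i ≤ p, ContourLeads T E (G.rot d)
      (Nat.count (fun i => (G.rot ^ i) (G.rot d) ∈ E) i) ((G.rot ^ i) (G.rot d)) := by
    refine fun i hi => hT.contourLeads_rot_pow hE.orientation (by rwa [G.rot_fst])
      (fun j hj hjT => ?_) fun j _ => hT.rot_pow_rot_ne_root hd _
    have hdj := hT.parent_unique _ hjT d hd (by rw [G.rot_pow_fst, G.rot_fst])
    have := hbij.injOn (Set.mem_Iic.2 (by omega : j ≤ p)) (Set.mem_Iic.2 le_rfl)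
      (hdj.trans hpd.symm)
    omega
  have hcount := count_rot_pow_eq (M := G.toRotationSystem) (by rwa [G.rot_fst]) E
  rw [Nat.count_succ, hpd, if_pos (hT.oriented hd), G.rot_fst,
    hE.outdeg _ (hT.avoids d hd).1 (hT.avoids d hd).2.1 (hT.root_no_parent d hd)] at hcount
  have hcount : Nat.count (fun i => (G.rot ^ i) (G.rot d) ∈ E) p = 2 := Nat.succ.inj hcount
  refine ⟨?_, fun g hg => ?_⟩
  · have := hleads p le_rfl
    rwa [hcount, hpd] at this
  · obtain ⟨i, hi, rfl⟩ := hbij.surjOn hg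
    exact ⟨_, hcount ▸ Nat.count_monotone _ hi, hleads i hi⟩

omit [Finite V] in
theorem not_transGen_parent_self (hT : G.IsBlossomingTree T E) {x : V} (hA : x ≠ G.A)
    (hB : x ≠ G.B) :
    ¬ Relation.TransGen (fun x y => ∃ d ∈ T, d.fst = x ∧ d.snd = y) x x := by
  induction hT.reaches_root x hA hB using Relation.ReflTransGen.head_induction_on with
  | refl =>
    intro h
    obtain ⟨_, ⟨d, hd, hroot, -⟩, -⟩ := Relation.TransGen.head'_iff.1 h
    exact hT.root_no_parent d hd hroot
  | head hxy _ ih =>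
    intro h
    have hparent := hxy
    obtain ⟨_, ⟨d', hd', hx, rfl⟩, hz⟩ := Relation.TransGen.head'_iff.1 h
    obtain ⟨d, hd, rfl, rfl⟩ := hxy
    rw [hT.parent_unique d' hd' d hd hx] at hz
    exact ih (hT.avoids d hd).2.2.1 (hT.avoids d hd).2.2.2 (.tail' hz hparent)

theorem wellFounded_parent (hT : G.IsBlossomingTree T E) :
    WellFounded fun x y => ∃ d ∈ T, d.fst = x ∧ d.snd = y := by
  have hirrefl : Std.Irrefl (Relation.TransGen fun x y => ∃ d ∈ T, d.fst = x ∧ d.snd = y) := by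
    refine ⟨fun x h => ?_⟩
    obtain ⟨_, ⟨d, hd, rfl, -⟩, -⟩ := Relation.TransGen.head'_iff.1 h
    exact hT.not_transGen_parent_self (hT.avoids d hd).1 (hT.avoids d hd).2.1 h
  exact Subrelation.wf (fun h => Relation.TransGen.single h) (Finite.wellFounded_of_trans_of_irrefl
    (Relation.TransGen fun x y => ∃ d ∈ T, d.fst = x ∧ d.snd = y))

theorem contourLeads_of_mem (hE : G.IsThreeOrientation E) (hT : G.IsBlossomingTree T E)
    (hd : d ∈ T) : ContourLeads T E (G.rot d) 2 d := by
  induction hx : d.fst using hT.wellFounded_parent.induction generalizing d with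
  | _ x ih =>
    subst hx
    exact (hT.contourLeads_of_mem_of_forall hE hd fun d' hd' h => ih _ ⟨d', hd', rfl, h⟩ hd' rfl).1

theorem exists_contourLeads_of_fst_eq (hE : G.IsThreeOrientation E) (hT : G.IsBlossomingTree T E)
    (hd : d ∈ T) (hg : g.fst = d.fst) : ∃ n : ℕ, n ≤ 2 ∧ ContourLeads T E (G.rot d) n g :=
  (hT.contourLeads_of_mem_of_forall hE hd fun _ hd' _ => hT.contourLeads_of_mem hE hd').2 g hg

theorem exists_contourLeads_root (hE : G.IsThreeOrientation E) (hT : G.IsBlossomingTree T E)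
    (hg : g.fst = G.rootVertex) : ∃ n : ℕ, n ≤ 2 ∧ ContourLeads T E G.root n g := by
  classical
  obtain ⟨p, -, hbij⟩ := exists_bijOn_rot_pow (M := G.toRotationSystem) (G.rot.symm G.root)
  have hfst : (G.rot.symm G.root).fst = G.rootVertex := by
    rw [← G.rot_fst, Equiv.apply_symm_apply]; rfl
  rw [Equiv.apply_symm_apply, hfst] at hbij
  obtain ⟨i, hi, rfl⟩ := hbij.surjOn hg
  refine ⟨_, ?_, hT.contourLeads_rot_pow hE.orientation
    (fun d hd _ => hT.contourLeads_of_mem hE hd) (fun j _ h => ?_) fun j hj h => ?_⟩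
  · rw [← hE.outdeg_root]
    exact (Nat.count_monotone _ (Nat.le_succ_of_le hi)).trans
      (count_rot_pow_eq (M := G.toRotationSystem) hbij E).le
  · exact hT.root_no_parent _ h (G.rot_pow_fst _ _)
  · have hi : i ≤ p := hi
    have := hbij.injOn (Set.mem_Iic.2 (by omega : j + 1 ≤ p)) (Set.mem_Iic.2 (Nat.zero_le p)) h
    omega

theorem exists_contour_eq (hE : G.IsThreeOrientation E) (hT : G.IsBlossomingTree T E)
    (hA : g.fst ≠ G.A) (hB : g.fst ≠ G.B) : ∃ t < G.contourLength T, G.contour T t = g := by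
  have hreach := hT.reaches_root _ hA hB
  generalize hx : g.fst = x at hreach hA hB
  induction hreach using Relation.ReflTransGen.head_induction_on generalizing g with
  | refl =>
    obtain ⟨n, -, h⟩ := hT.exists_contourLeads_root hE hx
    obtain ⟨t, ht, -, htg, -⟩ := h.exists_contour_eq contourLength_pos rfl
    exact ⟨t, ht, htg⟩
  | head hxy _ ih =>
    obtain ⟨d, hd, rfl, rfl⟩ := hxy
    obtain ⟨s, hs, hsd⟩ := ih (g := d.symm) rfl (hT.avoids d hd).2.2.1 (hT.avoids d hd).2.2.2
    obtain ⟨n, -, h⟩ := hT.exists_contourLeads_of_fst_eq hE hd hx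
    have hup : ContourLeads T E d.symm (-1) (G.rot d) :=
      contourLeads_faceNext (Or.inr hd) (hT.rot_pow_rot_ne_root hd 0)
    obtain ⟨t, ht, -, htg, -⟩ := (hup.trans h).exists_contour_eq hs hsd
    exact ⟨t, ht, htg⟩

end IsBlossomingTree

end PlantedTriangulation

namespace PlantedTriangulation

open RotationSystem

section VisitTime

variable {V : Type*} {G : PlantedTriangulation V} {T E : Set G.graph.Dart} {d g g' : G.graph.Dart}
  {l : ℤ}

variable (G) in
/-- The vertices of the blossoming tree that are not buds. -/
def IsInner (x : V) : Prop := x ≠ G.A ∧ x ≠ G.B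

theorem isInner_rootVertex : G.IsInner G.rootVertex := ⟨rootVertex_ne_A, B_ne_rootVertex.symm⟩

theorem rot_ne (g : G.graph.Dart) : G.rot g ≠ g := by
  intro h
  have hface : G.faceNext g.symm = g := by rw [faceNext_apply, SimpleGraph.Dart.symm_symm, h]
  have htriangle : G.faceNext (G.faceNext g) = g.symm := by
    conv_lhs => rw [← hface, G.triangle]
  refine (G.faceNext g).adj.ne ?_
  rw [G.faceNext_fst, ← G.faceNext_fst (G.faceNext g), htriangle]
  rfl

variable (T g) in
/-- The time at which the contour exploration visits the corner `g` for the first time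
(`0` if it never does). -/
noncomputable def visitTime : ℕ := sInf {t | G.contour T t = g}

variable (T E g) in
/-- The label of the corner `g`, read at its first visit. -/
noncomputable def visitLabel : ℤ := G.cornerLabel T E (visitTime T g)

theorem visitTime_eq {t : ℕ} (ht : t < G.contourLength T) (h : G.contour T t = g) :
    visitTime T g = t :=
  contour_injOn (lt_of_le_of_lt (Nat.sInf_le h) ht) ht
    ((Nat.sInf_mem (s := {t | G.contour T t = g}) ⟨t, h⟩).trans h.symm)

theorem visitLabel_eq {t : ℕ} (ht : t < G.contourLength T) (h : G.contour T t = g) :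
    visitLabel T E g = G.cornerLabel T E t := by
  rw [visitLabel, visitTime_eq ht h]

variable [Finite V]

theorem visitLabel_root : visitLabel T E G.root = 2 :=
  visitLabel_eq contourLength_pos rfl

namespace IsBlossomingTree

omit [Finite V] in
theorem isInner_snd (hT : G.IsBlossomingTree T E) (hd : d ∈ T) : G.IsInner d.snd :=
  (hT.avoids d hd).2.2

theorem contour_visitTime (hE : G.IsThreeOrientation E) (hT : G.IsBlossomingTree T E)
    (hg : G.IsInner g.fst) :
    visitTime T g < G.contourLength T ∧ G.contour T (visitTime T g) = g := by
  obtain ⟨t, ht, hgt⟩ := hT.exists_contour_eq hE hg.1 hg.2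
  rw [visitTime_eq ht hgt]
  exact ⟨ht, hgt⟩

theorem visitTime_le_and_visitLabel_eq (hE : G.IsThreeOrientation E) (hT : G.IsBlossomingTree T E)
    (hg : G.IsInner g.fst) (h : ContourLeads T E g l g') :
    visitTime T g ≤ visitTime T g' ∧ visitLabel T E g' = visitLabel T E g + l := by
  obtain ⟨hlt, hcontour⟩ := hT.contour_visitTime hE hg
  obtain ⟨t, ht, hle, htg, hl⟩ := h.exists_contour_eq hlt hcontour
  rw [visitTime_eq ht htg, visitLabel_eq ht htg]
  exact ⟨hle, hl⟩

theorem visitTime_lt (hE : G.IsThreeOrientation E) (hT : G.IsBlossomingTree T E)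
    (hg : G.IsInner g.fst) (hg' : G.IsInner g'.fst) (hle : visitTime T g ≤ visitTime T g')
    (hne : g ≠ g') : visitTime T g < visitTime T g' := by
  refine lt_of_le_of_ne hle fun h => hne ?_
  rw [← (hT.contour_visitTime hE hg).2, h, (hT.contour_visitTime hE hg').2]

theorem exists_forall_visitLabel_mem_Icc (hE : G.IsThreeOrientation E)
    (hT : G.IsBlossomingTree T E) {x : V} (hx : G.IsInner x) :
    ∃ l : ℤ, ∀ g : G.graph.Dart, g.fst = x → visitLabel T E g ∈ Set.Icc l (l + 2) := by
  have hleads : ∃ s : G.graph.Dart, G.IsInner s.fst ∧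
      ∀ g : G.graph.Dart, g.fst = x → ∃ n : ℕ, n ≤ 2 ∧ ContourLeads T E s n g := by
    rcases Relation.ReflTransGen.cases_head (hT.reaches_root x hx.1 hx.2) with
      rfl | ⟨y, ⟨d, hd, rfl, -⟩, -⟩
    · exact ⟨G.root, isInner_rootVertex, fun g => hT.exists_contourLeads_root hE⟩
    · exact ⟨G.rot d, by rwa [G.rot_fst], fun g => hT.exists_contourLeads_of_fst_eq hE hd⟩
  obtain ⟨s, hs, hleads⟩ := hleads
  refine ⟨visitLabel T E s, fun g hg => ?_⟩
  obtain ⟨n, hn, h⟩ := hleads g hg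
  rw [(hT.visitTime_le_and_visitLabel_eq hE hs h).2, Set.mem_Icc]
  omega

theorem two_le_visitLabel (hE : G.IsThreeOrientation E) (hT : G.IsBlossomingTree T E)
    (hg : g.fst = G.rootVertex) : 2 ≤ visitLabel T E g := by
  obtain ⟨n, -, h⟩ := hT.exists_contourLeads_root hE hg
  rw [(hT.visitTime_le_and_visitLabel_eq hE isInner_rootVertex h).2, visitLabel_root]
  omega

theorem label_fst_mem_Icc (hE : G.IsThreeOrientation E) (hT : G.IsBlossomingTree T E)
    (hg : G.IsInner g.fst) :
    G.label T E g.fst ∈ Set.Icc (visitLabel T E g - 2) (visitLabel T E g) := by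
  obtain ⟨l, hl⟩ := hT.exists_forall_visitLabel_mem_Icc hE hg
  rw [label, if_neg hg.1, if_neg hg.2]
  set S := {k | ∃ t < G.contourLength T, (G.contour T t).fst = g.fst ∧ G.cornerLabel T E t = k}
  have hlower : l ∈ lowerBounds S := by
    rintro _ ⟨t, ht, hgt, rfl⟩
    rw [← visitLabel_eq ht rfl]
    exact (hl _ hgt).1
  have hmem : visitLabel T E g ∈ S := by
    obtain ⟨hlt, hcontour⟩ := hT.contour_visitTime hE hg
    exact ⟨_, hlt, by rw [hcontour], rfl⟩
  have hle := le_csInf ⟨_, hmem⟩ hlower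
  have hge := (hl g rfl).2
  exact ⟨by linarith, csInf_le ⟨l, hlower⟩ hmem⟩

theorem visitTime_le_and_visitLabel_faceNext (hE : G.IsThreeOrientation E)
    (hT : G.IsBlossomingTree T E) (hg : G.IsInner g.fst) (h : g ∈ T ∨ g.symm ∈ T)
    (hr : G.faceNext g ≠ G.root) : visitTime T g ≤ visitTime T (G.faceNext g) ∧
      visitLabel T E (G.faceNext g) = visitLabel T E g - 1 :=
  hT.visitTime_le_and_visitLabel_eq hE hg (contourLeads_faceNext h hr)

open Classical in
theorem visitTime_le_and_visitLabel_rot (hE : G.IsThreeOrientation E)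
    (hT : G.IsBlossomingTree T E) (hg : G.IsInner g.fst) (h : g ∉ T) (hr : G.rot g ≠ G.root) :
    visitTime T g ≤ visitTime T (G.rot g) ∧
      visitLabel T E (G.rot g) = visitLabel T E g + if g ∈ E then 1 else 0 :=
  hT.visitTime_le_and_visitLabel_eq hE hg
    (hT.contourLeads_rot hE.orientation h hr fun _ hd _ => hT.contourLeads_of_mem hE hd)

theorem visitLabel_rot (hE : G.IsThreeOrientation E) (hT : G.IsBlossomingTree T E)
    (hg : G.IsInner g.fst) (h : g ∉ T) (h' : g ∈ E) (hr : G.rot g ≠ G.root) :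
    visitLabel T E (G.rot g) = visitLabel T E g + 1 := by
  rw [(hT.visitTime_le_and_visitLabel_rot hE hg h hr).2, if_pos h']

theorem visitLabel_rot_le (hE : G.IsThreeOrientation E) (hT : G.IsBlossomingTree T E)
    (hg : G.IsInner g.fst) (h : g ∉ E) : visitLabel T E (G.rot g) ≤ visitLabel T E g := by
  by_cases hr : G.rot g = G.root
  · rw [hr, visitLabel_root]
    exact hT.two_le_visitLabel hE (by rw [← G.rot_fst, hr]; rfl)
  · rw [(hT.visitTime_le_and_visitLabel_rot hE hg (fun h' => h (hT.oriented h')) hr).2, if_neg h,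
      add_zero]

theorem visitLabel_symm_of_mem (hE : G.IsThreeOrientation E) (hT : G.IsBlossomingTree T E)
    (hd : d ∈ T) : visitLabel T E d.symm = visitLabel T E d - 1 := by
  have hup : ContourLeads T E d.symm (-1) (G.rot d) :=
    contourLeads_faceNext (Or.inr hd) (hT.rot_pow_rot_ne_root hd 0)
  have h := hT.visitTime_le_and_visitLabel_eq hE (hT.isInner_snd hd)
    (hup.trans (hT.contourLeads_of_mem hE hd))
  linarith [h.2]

end IsBlossomingTree

end VisitTime

section StemEnd

variable {V : Type*} {G : PlantedTriangulation V} {T E : Set G.graph.Dart} {d g : G.graph.Dart}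

variable (T E g) in
/-- The reverse of `g` is an edge of `E` outside the tree. The corner `g` is then the one at which
the closure attaches the bud of the stem `g.symm`. -/
def IsStemEnd : Prop := g.symm ∈ E ∧ g.symm ∉ T

theorem symm_mem_or_mem_of_not_isStemEnd (hO : G.IsOrientation E) (h : ¬IsStemEnd T E g) :
    g.symm ∈ T ∨ g ∈ E := by
  by_contra! h'
  exact h ⟨(hO _).2 h'.2, h'.1⟩

theorem ne_root_of_leftFace_ne (h : G.leftFace g ≠ G.rootFace) : g ≠ G.root :=
  fun h' => h (by rw [h']; rfl)

theorem faceNext_ne_root_of_leftFace_ne (h : G.leftFace g ≠ G.rootFace) : G.faceNext g ≠ G.root :=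
  ne_root_of_leftFace_ne ((G.leftFace_faceNext g).trans_ne h)

namespace IsBlossomingTree

theorem visitTime_lt_symm (hT : G.IsBlossomingTree T E) (hd : d ∈ E) (hd' : d ∉ T)
    (h : G.IsInner d.snd) : visitTime T d < visitTime T d.symm := by
  obtain ⟨s, t, hst, ht, hs, ht'⟩ := hT.tail_first d hd hd' h.1 h.2
  rwa [visitTime_eq (hst.trans ht) hs, visitTime_eq ht ht']

variable [Finite V]

theorem isInner_fst_of_not_isStemEnd (hE : G.IsThreeOrientation E) (hT : G.IsBlossomingTree T E)
    (h : ¬IsStemEnd T E g) (hsnd : g.snd ≠ G.A) : G.IsInner g.fst := by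
  rcases symm_mem_or_mem_of_not_isStemEnd hE.orientation h with h | h
  · exact hT.isInner_snd h
  · exact ⟨hE.fst_ne_A h, fun hB => hsnd (hE.snd_eq_A h hB)⟩

theorem fst_ne_A_of_not_isStemEnd (hE : G.IsThreeOrientation E) (hT : G.IsBlossomingTree T E)
    (h : ¬IsStemEnd T E g) : g.fst ≠ G.A :=
  (symm_mem_or_mem_of_not_isStemEnd hE.orientation h).elim (fun h => (hT.isInner_snd h).1)
    hE.fst_ne_A

theorem visitTime_symm_le_faceNext (hE : G.IsThreeOrientation E) (hT : G.IsBlossomingTree T E)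
    (hsnd : G.IsInner g.snd) (hf : G.leftFace g ≠ G.rootFace) (hg : g.symm ∉ T) :
    visitTime T g.symm ≤ visitTime T (G.faceNext g) :=
  (hT.visitTime_le_and_visitLabel_rot hE (g := g.symm) hsnd hg
    (faceNext_ne_root_of_leftFace_ne hf)).1

theorem visitTime_le_faceNext (hE : G.IsThreeOrientation E) (hT : G.IsBlossomingTree T E)
    (hfst : G.IsInner g.fst) (hsnd : G.IsInner g.snd) (hf : G.leftFace g ≠ G.rootFace)
    (hg : ¬IsStemEnd T E g) : visitTime T g ≤ visitTime T (G.faceNext g) := by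
  by_cases h : g ∈ T ∨ g.symm ∈ T
  · exact (hT.visitTime_le_and_visitLabel_faceNext hE hfst h
      (faceNext_ne_root_of_leftFace_ne hf)).1
  · push Not at h
    have hgE := (symm_mem_or_mem_of_not_isStemEnd hE.orientation hg).resolve_left h.2
    exact (hT.visitTime_lt_symm hgE h.1 hsnd).le.trans
      (hT.visitTime_symm_le_faceNext hE hsnd hf h.2)

theorem exists_isStemEnd (hE : G.IsThreeOrientation E) (hT : G.IsBlossomingTree T E) {f : G.Face}
    (hf : f ≠ G.rootFace) : ∃ d, IsStemEnd T E d ∧ G.leftFace d = f := by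
  by_contra! hno
  have hinner : ∀ d, G.leftFace d = f → G.IsInner d.fst := fun d hd => by
    refine hT.isInner_fst_of_not_isStemEnd hE (fun h => hno d h hd) ?_
    rw [← G.faceNext_fst]
    exact hT.fst_ne_A_of_not_isStemEnd hE fun h => hno _ h ((G.leftFace_faceNext d).trans hd)
  have hlt : ∀ d, G.leftFace d = f → visitTime T d < visitTime T (G.faceNext d) := fun d hd => by
    have hnext : G.leftFace (G.faceNext d) = f := (G.leftFace_faceNext d).trans hd
    refine hT.visitTime_lt hE (hinner d hd) (hinner _ hnext) ?_ (G.faceNext_ne d).symm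
    exact hT.visitTime_le_faceNext hE (hinner d hd) (G.faceNext_fst d ▸ hinner _ hnext)
      (hd.trans_ne hf) fun h => hno d h hd
  obtain ⟨d, hd⟩ := Quotient.exists_rep f
  have hd₁ : G.leftFace (G.faceNext d) = f := (G.leftFace_faceNext d).trans hd
  have hd₂ : G.leftFace (G.faceNext (G.faceNext d)) = f := (G.leftFace_faceNext _).trans hd₁
  have hlt₂ := hlt _ hd₂
  rw [G.triangle] at hlt₂
  exact lt_asymm ((hlt d hd).trans (hlt _ hd₁)) hlt₂

theorem isStemEnd_faceNext_root (hE : G.IsThreeOrientation E) (hT : G.IsBlossomingTree T E) :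
    IsStemEnd T E (G.faceNext G.root) := by
  by_contra h
  exact hT.fst_ne_A_of_not_isStemEnd hE h G.faceNext_root_fst

theorem isStemEnd_faceNext_faceNext_root (hE : G.IsThreeOrientation E)
    (hT : G.IsBlossomingTree T E) : IsStemEnd T E (G.faceNext (G.faceNext G.root)) := by
  by_contra h
  refine (hT.isInner_fst_of_not_isStemEnd hE h ?_).2 G.faceNext_faceNext_root_fst
  rw [G.faceNext_faceNext_root_snd]
  exact rootVertex_ne_A

theorem card_le_ncard_add_three (hT : G.IsBlossomingTree T E) : Nat.card V ≤ T.ncard + 3 := by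
  have hcover : (Set.univ : Set V) ⊆
      (fun d : G.graph.Dart => d.fst) '' T ∪ {G.A, G.B, G.rootVertex} := by
    intro x _
    by_cases hx : x = G.A ∨ x = G.B ∨ x = G.rootVertex
    · exact Or.inr hx
    · push Not at hx
      rcases Relation.ReflTransGen.cases_head (hT.reaches_root x hx.1 hx.2.1) with
        h | ⟨y, ⟨d, hd, h, -⟩, -⟩
      · exact absurd h hx.2.2
      · exact Or.inl ⟨d, hd, h⟩
  calc Nat.card V = (Set.univ : Set V).ncard := (Set.ncard_univ V).symm
    _ ≤ _ := Set.ncard_le_ncard hcover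
    _ ≤ _ := Set.ncard_union_le _ _
    _ ≤ T.ncard + 3 := add_le_add (Set.ncard_image_le) <| by
      have h₁ := Set.ncard_insert_le G.A {G.B, G.rootVertex}
      have h₂ := Set.ncard_insert_le G.B {G.rootVertex}
      rw [Set.ncard_singleton] at h₂
      omega

theorem ncard_isStemEnd_le (hE : G.IsThreeOrientation E) (hT : G.IsBlossomingTree T E) :
    {d | IsStemEnd T E d}.ncard ≤ Nat.card G.Face + 1 := by
  have hsymm : SimpleGraph.Dart.symm '' (E \ T) = {d | IsStemEnd T E d} := by
    rw [SimpleGraph.Dart.symm_involutive.image_eq_preimage_symm]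
    rfl
  rw [← hsymm, Set.ncard_image_of_injective _ SimpleGraph.Dart.symm_involutive.injective]
  have hsdiff := Set.ncard_sdiff_add_ncard_of_subset hT.oriented
  have hedges := IsOrientation.ncard_eq (M := G.toRotationSystem) hE.orientation
  have hcard := hT.card_le_ncard_add_three
  have heuler := G.euler
  omega

theorem injOn_leftFace (hE : G.IsThreeOrientation E) (hT : G.IsBlossomingTree T E) :
    Set.InjOn G.leftFace {d | IsStemEnd T E d ∧ G.leftFace d ≠ G.rootFace} := by
  set S := {d | IsStemEnd T E d ∧ G.leftFace d ≠ G.rootFace}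
  set R : Set G.graph.Dart := {G.faceNext G.root, G.faceNext (G.faceNext G.root)}
  have hR : R.ncard = 2 := Set.ncard_pair (G.faceNext_ne _).symm
  have hdisj : Disjoint S R := by
    rw [Set.disjoint_right]
    rintro _ (rfl | rfl) h
    · exact h.2 G.leftFace_faceNext_root
    · exact h.2 G.leftFace_faceNext_faceNext_root
  have hsub : S ∪ R ⊆ {d | IsStemEnd T E d} := by
    rintro d (h | rfl | rfl)
    · exact h.1
    · exact hT.isStemEnd_faceNext_root hE
    · exact hT.isStemEnd_faceNext_faceNext_root hE
  have hS : S.ncard + 2 ≤ Nat.card G.Face + 1 := by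
    rw [← hR, ← Set.ncard_union_eq hdisj]
    exact (Set.ncard_le_ncard hsub).trans (hT.ncard_isStemEnd_le hE)
  have himage : ({G.rootFace}ᶜ : Set G.Face).ncard ≤ (G.leftFace '' S).ncard := by
    refine Set.ncard_le_ncard fun f hf => ?_
    obtain ⟨d, hd, rfl⟩ := hT.exists_isStemEnd hE hf
    exact ⟨d, ⟨hd, hf⟩, rfl⟩
  rw [Set.ncard_compl, Set.ncard_singleton] at himage
  exact (Set.ncard_image_iff (Set.toFinite S)).1 (le_antisymm Set.ncard_image_le (by omega))

theorem eq_of_isStemEnd (hE : G.IsThreeOrientation E) (hT : G.IsBlossomingTree T E)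
    (hd : IsStemEnd T E d) (hg : IsStemEnd T E g) (h : G.leftFace d = G.leftFace g)
    (hr : G.leftFace g ≠ G.rootFace) : d = g :=
  hT.injOn_leftFace hE ⟨hd, h.trans_ne hr⟩ ⟨hg, hr⟩ h

end IsBlossomingTree

end StemEnd

end PlantedTriangulation

namespace PlantedTriangulation

open RotationSystem

section StemLabel

variable {V : Type*} {G : PlantedTriangulation V} {T E : Set G.graph.Dart} {d g : G.graph.Dart}

theorem eq_root_or_of_leftFace_eq_rootFace [Finite V] (h : G.leftFace g = G.rootFace) :
    g = G.root ∨ g.fst = G.A ∧ g.snd = G.B ∨ g.fst = G.B ∧ g.snd = G.rootVertex := by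
  rcases G.leftFace_eq_leftFace_iff.1 h with rfl | rfl | rfl
  · exact Or.inl rfl
  · exact Or.inr (Or.inl ⟨G.faceNext_root_fst, rfl⟩)
  · exact Or.inr (Or.inr ⟨G.faceNext_faceNext_root_fst, G.faceNext_faceNext_root_snd⟩)

variable [Finite V]

theorem IsStemEnd.leftFace_ne_rootFace (hE : G.IsThreeOrientation E) (hg : IsStemEnd T E g)
    (hfst : G.IsInner g.fst) : G.leftFace g ≠ G.rootFace := fun h => by
  rcases eq_root_or_of_leftFace_eq_rootFace h with rfl | h | h
  · exact hE.fst_ne_A hg.1 rfl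
  · exact hfst.1 h.1
  · exact hfst.2 h.1

namespace IsBlossomingTree

theorem not_isStemEnd_faceNext (hE : G.IsThreeOrientation E) (hT : G.IsBlossomingTree T E)
    (hg : IsStemEnd T E g) (hf : G.leftFace g ≠ G.rootFace) : ¬IsStemEnd T E (G.faceNext g) :=
  fun h => G.faceNext_ne g (hT.eq_of_isStemEnd hE h hg (G.leftFace_faceNext g) hf)

theorem not_isStemEnd_faceNext_faceNext (hE : G.IsThreeOrientation E)
    (hT : G.IsBlossomingTree T E) (hg : IsStemEnd T E g) (hf : G.leftFace g ≠ G.rootFace) :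
    ¬IsStemEnd T E (G.faceNext (G.faceNext g)) := fun h =>
  G.faceNext_faceNext_ne g
    (hT.eq_of_isStemEnd hE h hg (by rw [G.leftFace_faceNext, G.leftFace_faceNext]) hf)

theorem isInner_snd_of_isStemEnd (hE : G.IsThreeOrientation E) (hT : G.IsBlossomingTree T E)
    (hg : IsStemEnd T E g) (hf : G.leftFace g ≠ G.rootFace) : G.IsInner g.snd := by
  rw [← G.faceNext_fst]
  refine hT.isInner_fst_of_not_isStemEnd hE (hT.not_isStemEnd_faceNext hE hg hf) ?_
  rw [← G.faceNext_fst]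
  exact hT.fst_ne_A_of_not_isStemEnd hE (hT.not_isStemEnd_faceNext_faceNext hE hg hf)

theorem isInner_snd_faceNext_of_isStemEnd (hE : G.IsThreeOrientation E)
    (hT : G.IsBlossomingTree T E) (hg : IsStemEnd T E g) (hf : G.leftFace g ≠ G.rootFace)
    (hA : g.fst ≠ G.A) : G.IsInner (G.faceNext g).snd := by
  rw [← G.faceNext_fst]
  refine hT.isInner_fst_of_not_isStemEnd hE (hT.not_isStemEnd_faceNext_faceNext hE hg hf) ?_
  rwa [← G.faceNext_fst, G.triangle]

theorem visitTime_symm_lt_faceNext (hE : G.IsThreeOrientation E) (hT : G.IsBlossomingTree T E)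
    (hg : IsStemEnd T E g) (hf : G.leftFace g ≠ G.rootFace) :
    visitTime T g.symm < visitTime T (G.faceNext g) := by
  have hsnd := hT.isInner_snd_of_isStemEnd hE hg hf
  exact hT.visitTime_lt hE hsnd (by rwa [G.faceNext_fst])
    (hT.visitTime_symm_le_faceNext hE hsnd hf hg.2) (G.rot_ne g.symm).symm

theorem visitLabel_faceNext_of_isStemEnd (hE : G.IsThreeOrientation E)
    (hT : G.IsBlossomingTree T E) (hg : IsStemEnd T E g) (hf : G.leftFace g ≠ G.rootFace) :
    visitLabel T E (G.faceNext g) = visitLabel T E g.symm + 1 :=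
  hT.visitLabel_rot hE (g := g.symm) (hT.isInner_snd_of_isStemEnd hE hg hf) hg.2 hg.1
    (faceNext_ne_root_of_leftFace_ne hf)

theorem visitLabel_faceNext_of_visitLabel_symm (hE : G.IsThreeOrientation E)
    (hT : G.IsBlossomingTree T E) (hfst : G.IsInner g.fst) (hsnd : G.IsInner g.snd)
    (hf : G.leftFace g ≠ G.rootFace) (hg : ¬IsStemEnd T E g)
    (hsymm : g ∈ E → g ∉ T → visitLabel T E g.symm = visitLabel T E g - 1) :
    visitLabel T E (G.faceNext g) = visitLabel T E g - 1 := by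
  have hr := faceNext_ne_root_of_leftFace_ne hf
  by_cases h : g ∈ T ∨ g.symm ∈ T
  · exact (hT.visitTime_le_and_visitLabel_faceNext hE hfst h hr).2
  · push Not at h
    have hgE := (symm_mem_or_mem_of_not_isStemEnd hE.orientation hg).resolve_left h.2
    rw [← hsymm hgE h.1, faceNext_apply,
      (hT.visitTime_le_and_visitLabel_rot hE (g := g.symm) hsnd h.2 hr).2,
      if_neg fun h' => (hE.orientation _).1 h' hgE, add_zero]

/- The exploration intervals between the two ends of the stems are nested, hence the induction on
their duration. The face on the left of `g` has no stem end but `g`, so the label goes up by one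
from `g.symm` to the next corner of this triangle, and down by one along its two other sides. -/
theorem visitLabel_of_isStemEnd (hE : G.IsThreeOrientation E) (hT : G.IsBlossomingTree T E)
    (hg : IsStemEnd T E g) (hfst : G.IsInner g.fst) :
    visitLabel T E g = visitLabel T E g.symm - 1 := by
  induction hn : visitTime T g - visitTime T g.symm using Nat.strong_induction_on
    generalizing g with | _ n ih
  have hf := hg.leftFace_ne_rootFace hE hfst
  have hn₁ := hT.not_isStemEnd_faceNext hE hg hf
  have hn₂ := hT.not_isStemEnd_faceNext_faceNext hE hg hf
  have hfst₁ := hT.isInner_snd_of_isStemEnd hE hg hf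
  have hfst₂ := hT.isInner_snd_faceNext_of_isStemEnd hE hg hf hfst.1
  have hlt := hT.visitTime_symm_lt_faceNext hE hg hf
  have hup := hT.visitLabel_faceNext_of_isStemEnd hE hg hf
  have hlast : G.faceNext (G.faceNext (G.faceNext g)) = g := G.triangle g
  rw [← G.faceNext_fst] at hfst₁ hfst₂
  set g₁ := G.faceNext g
  set g₂ := G.faceNext g₁
  have hf₁ : G.leftFace g₁ ≠ G.rootFace := (G.leftFace_faceNext g).trans_ne hf
  have hf₂ : G.leftFace g₂ ≠ G.rootFace := (G.leftFace_faceNext g₁).trans_ne hf₁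
  have hsnd₁ : G.IsInner g₁.snd := by rwa [← G.faceNext_fst]
  have hsnd₂ : G.IsInner g₂.snd := by rwa [← G.faceNext_fst, hlast]
  have hle₁ : visitTime T g₁ ≤ visitTime T g₂ := hT.visitTime_le_faceNext hE hfst₁ hsnd₁ hf₁ hn₁
  have hle₂ : visitTime T g₂ ≤ visitTime T g :=
    hlast ▸ hT.visitTime_le_faceNext hE hfst₂ hsnd₂ hf₂ hn₂
  have hnested : ∀ d ∈ E, d ∉ T → G.IsInner d.snd → G.leftFace d ≠ G.rootFace →
      visitTime T g.symm < visitTime T d → visitTime T (G.faceNext d) ≤ visitTime T g →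
      visitLabel T E d.symm = visitLabel T E d - 1 := by
    intro d hd hdT hsnd hfd hstart hfinish
    have hle := hT.visitTime_symm_le_faceNext hE hsnd hfd
      fun h => (hE.orientation _).1 (hT.oriented h) hd
    refine ih _ ?_ (g := d.symm) ⟨by rwa [d.symm_symm], by rwa [d.symm_symm]⟩ hsnd rfl
    rw [d.symm_symm]
    omega
  have hdown₁ : visitLabel T E g₂ = visitLabel T E g₁ - 1 :=
    hT.visitLabel_faceNext_of_visitLabel_symm hE hfst₁ hsnd₁ hf₁ hn₁ fun h h' =>
      hnested g₁ h h' hsnd₁ hf₁ hlt hle₂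
  have hdown₂ : visitLabel T E g = visitLabel T E g₂ - 1 :=
    hlast ▸ hT.visitLabel_faceNext_of_visitLabel_symm hE hfst₂ hsnd₂ hf₂ hn₂ fun h h' =>
      hnested g₂ h h' hsnd₂ hf₂ (hlt.trans_le hle₁) (congrArg _ hlast).le
  linarith

theorem visitLabel_symm (hE : G.IsThreeOrientation E) (hT : G.IsBlossomingTree T E) (hd : d ∈ E)
    (hs : G.IsInner d.snd) : visitLabel T E d.symm = visitLabel T E d - 1 := by
  by_cases h : d ∈ T
  · exact hT.visitLabel_symm_of_mem hE h
  · exact hT.visitLabel_of_isStemEnd hE (g := d.symm)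
      ⟨by rwa [d.symm_symm], by rwa [d.symm_symm]⟩ hs

theorem visitLabel_faceNext_of_not_isStemEnd (hE : G.IsThreeOrientation E)
    (hT : G.IsBlossomingTree T E) (hfst : G.IsInner g.fst) (hsnd : G.IsInner g.snd)
    (hf : G.leftFace g ≠ G.rootFace) (hg : ¬IsStemEnd T E g) :
    visitLabel T E (G.faceNext g) = visitLabel T E g - 1 :=
  hT.visitLabel_faceNext_of_visitLabel_symm hE hfst hsnd hf hg fun h _ =>
    hT.visitLabel_symm hE h hsnd

theorem isStemEnd_of_fst_eq_A (hE : G.IsThreeOrientation E) (hT : G.IsBlossomingTree T E)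
    (hA : g.fst = G.A) : IsStemEnd T E g :=
  by_contra fun h => hT.fst_ne_A_of_not_isStemEnd hE h hA

theorem isStemEnd_of_fst_eq_B (hE : G.IsThreeOrientation E) (hT : G.IsBlossomingTree T E)
    (hB : g.fst = G.B) (hA : g.snd ≠ G.A) : IsStemEnd T E g :=
  by_contra fun h => (hT.isInner_fst_of_not_isStemEnd hE h hA).2 hB

theorem visitLabel_symm_eq_visitLabel_rot_symm (hE : G.IsThreeOrientation E)
    (hT : G.IsBlossomingTree T E) (hg : IsStemEnd T E (G.rot g))
    (hf : G.leftFace g.symm ≠ G.rootFace) (hsnd : G.IsInner g.snd) :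
    visitLabel T E g.symm = visitLabel T E (G.rot g).symm := by
  have hlast : G.faceNext (G.faceNext (G.rot g)) = g.symm := G.triangle g.symm
  have hf₀ : G.leftFace (G.rot g) ≠ G.rootFace := (G.leftFace_faceNext g.symm).trans_ne hf
  have hup := hT.visitLabel_faceNext_of_isStemEnd hE hg hf₀
  have hdown := hT.visitLabel_faceNext_of_not_isStemEnd hE
    (by rw [G.faceNext_fst]; exact hT.isInner_snd_of_isStemEnd hE hg hf₀)
    (by rwa [← G.faceNext_fst, hlast])
    ((G.leftFace_faceNext _).trans_ne hf₀) (hT.not_isStemEnd_faceNext hE hg hf₀)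
  rw [hlast] at hdown
  linarith

theorem visitLabel_of_snd_eq_A (hE : G.IsThreeOrientation E) (hT : G.IsBlossomingTree T E)
    (hA : d.snd = G.A) (hB : d.fst ≠ G.B) : visitLabel T E d = 2 := by
  suffices h : ∀ g : G.graph.Dart, G.A = g.fst → g.snd = G.B ∨ visitLabel T E g.symm = 2 from
    (h d.symm hA.symm).resolve_left hB
  refine fun g hg => G.rot_induction_symm
    (p := fun g => g.snd = G.B ∨ visitLabel T E g.symm = 2) (d := G.root.symm)
    (Or.inr visitLabel_root) hg fun g (hgA : g.fst = G.A) ih => or_iff_not_imp_left.2 fun hgB => ?_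
  by_cases hroot : g.symm = G.root
  · rw [hroot, visitLabel_root]
  have hf : G.leftFace g.symm ≠ G.rootFace := fun h => by
    rcases eq_root_or_of_leftFace_eq_rootFace h with h | h | h
    · exact hroot h
    · exact A_ne_B (hgA.symm.trans h.2)
    · exact hgB h.1
  have hrA : (G.rot g).fst = G.A := (G.rot_fst g).trans hgA
  have hrB : (G.rot g).snd ≠ G.B := fun h => hf <| by
    have hrot : G.rot g = G.faceNext G.root :=
      SimpleGraph.Dart.ext _ _ (Prod.ext (hrA.trans G.faceNext_root_fst.symm) h)
    rw [G.leftFace_symm, ← G.leftFace_rot, hrot, G.leftFace_faceNext_root]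
  rw [hT.visitLabel_symm_eq_visitLabel_rot_symm hE (hT.isStemEnd_of_fst_eq_A hE hrA) hf
    ⟨fun h => g.adj.ne (hgA.trans h.symm), hgB⟩]
  exact ih.resolve_left hrB

theorem visitLabel_symm_of_rot_snd_eq_A (hE : G.IsThreeOrientation E)
    (hT : G.IsBlossomingTree T E) (hg : G.IsInner g.snd) (hf : G.leftFace g.symm ≠ G.rootFace)
    (hA : (G.rot g).snd = G.A) : visitLabel T E g.symm = 3 := by
  have hlast : G.faceNext (G.faceNext (G.rot g)) = g.symm := G.triangle g.symm
  set h := G.faceNext (G.rot g) with hdef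
  have hfst : h.fst = G.A := by rw [hdef, G.faceNext_fst, hA]
  have hsnd : h.snd = g.snd := by rw [← G.faceNext_fst, hlast]; rfl
  have htwo : visitLabel T E h.symm = 2 := hT.visitLabel_of_snd_eq_A hE hfst (hsnd.trans_ne hg.2)
  rw [← hlast, hT.visitLabel_faceNext_of_isStemEnd hE (hT.isStemEnd_of_fst_eq_A hE hfst), htwo]
  · rfl
  · rwa [← G.leftFace_faceNext, hlast]

theorem visitLabel_of_snd_eq_B (hE : G.IsThreeOrientation E) (hT : G.IsBlossomingTree T E)
    (hB : d.snd = G.B) (hA : d.fst ≠ G.A) : visitLabel T E d = 3 := by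
  suffices h : ∀ g : G.graph.Dart, G.B = g.fst → g.snd = G.A ∨ visitLabel T E g.symm = 3 from
    (h d.symm hB.symm).resolve_left hA
  refine fun g hg => G.rot_induction_symm
    (p := fun g => g.snd = G.A ∨ visitLabel T E g.symm = 3) (d := (G.faceNext G.root).symm)
    (Or.inl G.faceNext_root_fst) hg
    fun g (hgB : g.fst = G.B) ih => or_iff_not_imp_left.2 fun hgA => ?_
  have hsnd : G.IsInner g.snd := ⟨hgA, fun h => g.adj.ne (hgB.trans h.symm)⟩
  have hf : G.leftFace g.symm ≠ G.rootFace := fun h => by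
    rcases eq_root_or_of_leftFace_eq_rootFace h with h | h | h
    · exact A_ne_B ((congrArg (fun g : G.graph.Dart => g.snd) h).symm.trans hgB)
    · exact hgA h.1
    · exact hsnd.2 h.1
  by_cases hrA : (G.rot g).snd = G.A
  · exact hT.visitLabel_symm_of_rot_snd_eq_A hE hsnd hf hrA
  · rw [hT.visitLabel_symm_eq_visitLabel_rot_symm hE
      (hT.isStemEnd_of_fst_eq_B hE ((G.rot_fst g).trans hgB) hrA) hf hsnd]
    exact ih.resolve_left hrA

theorem visitLabel_le_of_isFirstOutgoing (hE : G.IsThreeOrientation E)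
    (hT : G.IsBlossomingTree T E) (hd : d ∈ E) (hs : G.IsInner d.snd)
    (h : G.IsFirstOutgoing E d g) : visitLabel T E g ≤ visitLabel T E d - 1 := by
  rw [← hT.visitLabel_symm hE hd hs]
  obtain ⟨-, k, -, rfl, hmin⟩ := h
  have hnotMem : ∀ j < k, (G.rot ^ j) d.symm ∉ E := fun j hj => by
    rcases Nat.eq_zero_or_pos j with rfl | hpos
    · exact fun h => (hE.orientation d).1 h hd
    · exact hmin j hpos hj
  clear hmin
  induction k with
  | zero => exact le_rfl
  | succ k ih =>
    rw [G.rot_pow_succ_apply]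
    exact (hT.visitLabel_rot_le hE (by rwa [G.rot_pow_fst]) (hnotMem k k.lt_succ_self)).trans
      (ih fun j hj => hnotMem j (hj.trans k.lt_succ_self))

end IsBlossomingTree

omit [Finite V] in
theorem label_A : G.label T E G.A = 1 := if_pos rfl

omit [Finite V] in
theorem label_B : G.label T E G.B = 2 := by rw [label, if_neg A_ne_B.symm, if_pos rfl]

theorem IsBlossomingTree.label_snd_le (hE : G.IsThreeOrientation E) (hT : G.IsBlossomingTree T E)
    (hd : d ∈ E) (hB : d.fst ≠ G.B) : G.label T E d.snd ≤ visitLabel T E d - 1 := by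
  by_cases hsA : d.snd = G.A
  · rw [hsA, label_A, hT.visitLabel_of_snd_eq_A hE hsA hB]; rfl
  by_cases hsB : d.snd = G.B
  · rw [hsB, label_B, hT.visitLabel_of_snd_eq_B hE hsB (hE.fst_ne_A hd)]; rfl
  · rw [← hT.visitLabel_symm hE hd ⟨hsA, hsB⟩]
    exact (hT.label_fst_mem_Icc hE (g := d.symm) ⟨hsA, hsB⟩).2

namespace IsLeftmost

variable {a : V} {P : G.graph.Walk a G.A} {i j k : ℕ}

theorem getVert_ne_B (hE : G.IsThreeOrientation E) (hP : G.IsLeftmost E P)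
    (hk : k + 1 < P.darts.length) : P.getVert k ≠ G.B := fun h =>
  hP.getVert_ne_A hE hk (hP.getVert_succ_eq_A hE (by omega) h)

theorem sub_le_visitLabel_sub (hE : G.IsThreeOrientation E) (hT : G.IsBlossomingTree T E)
    (hP : G.IsLeftmost E P) (hik : i ≤ k) (hk : k < P.darts.length) (hkB : P.getVert k ≠ G.B) :
    (k : ℤ) - i ≤ visitLabel T E P.darts[i] - visitLabel T E P.darts[k] := by
  induction k, hik using Nat.le_induction with
  | base => simp
  | succ k hik ih =>
    have hle := ih (by omega) (hP.getVert_ne_B hE hk)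
    have hdrop := hT.visitLabel_le_of_isFirstOutgoing hE (hP.mem _ (List.getElem_mem _))
      (by rw [snd_getElem_darts P]; exact ⟨hP.getVert_ne_A hE hk, hkB⟩) (hP.first hk)
    push_cast; linarith

theorem sub_sub_two_le_label_sub_succ (hE : G.IsThreeOrientation E) (hT : G.IsBlossomingTree T E)
    (hP : G.IsLeftmost E P) (hik : i ≤ k) (hk : k < P.darts.length) (hkB : P.getVert k ≠ G.B) :
    (k : ℤ) + 1 - i - 2 ≤ G.label T E (P.getVert i) - G.label T E (P.getVert (k + 1)) := by
  have hi : i < P.darts.length := by omega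
  have hiB : P.getVert i ≠ G.B := by
    rcases hik.eq_or_lt with rfl | hlt
    · exact hkB
    · exact hP.getVert_ne_B hE (by omega)
  have hdrop := hP.sub_le_visitLabel_sub hE hT hik hk hkB
  have hfst := (hT.label_fst_mem_Icc hE (g := P.darts[i])
    (by rw [fst_getElem_darts P hi]; exact ⟨hP.getVert_ne_A hE hi, hiB⟩)).1
  have hsnd := hT.label_snd_le hE (hP.mem _ (List.getElem_mem hk))
    (by rwa [fst_getElem_darts P hk])
  rw [fst_getElem_darts P hi] at hfst
  rw [snd_getElem_darts P hk] at hsnd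
  linarith

theorem sub_sub_two_le_label_sub (hE : G.IsThreeOrientation E) (hT : G.IsBlossomingTree T E)
    (hP : G.IsLeftmost E P) (hij : i ≤ j) (hj : j ≤ P.length) :
    (j : ℤ) - i - 2 ≤ G.label T E (P.getVert i) - G.label T E (P.getVert j) := by
  have hlen := P.length_darts
  rcases hij.eq_or_lt with rfl | hij
  · omega
  obtain ⟨k, rfl⟩ : ∃ k, j = k + 1 := ⟨j - 1, by omega⟩
  by_cases hkB : P.getVert k = G.B
  · rw [hP.getVert_succ_eq_A hE (by omega) hkB, label_A]
    rcases (Nat.le_of_lt_succ hij).eq_or_lt with rfl | hik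
    · rw [hkB, label_B]
      push_cast; linarith
    · obtain ⟨l, rfl⟩ : ∃ l, k = l + 1 := ⟨k - 1, by omega⟩
      have hle := hP.sub_sub_two_le_label_sub_succ hE hT (Nat.le_of_lt_succ hik) (by omega)
        (hP.getVert_ne_B hE (by omega))
      rw [hkB, label_B] at hle
      push_cast; linarith
  · exact_mod_cast hP.sub_sub_two_le_label_sub_succ hE hT (Nat.le_of_lt_succ hij) (by omega) hkB

end IsLeftmost

end StemLabel

end PlantedTriangulation

section SideDiameter

variable {V : Type*} {G : SimpleGraph V} {x y : V} {Q : G.Walk x y} {s t : ℕ} {S : Set V}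

theorem connected_induce_of_forall_exists_walk (hx : x ∈ S)
    (h : ∀ z ∈ S, ∃ W : G.Walk x z, ∀ v ∈ W.support, v ∈ S) : (G.induce S).Connected :=
  G.induce_connected_of_patches x hx fun {z} hz =>
    have ⟨W, hW⟩ := h z hz
    ⟨{v | v ∈ W.support}, hW, W.start_mem_support, W.end_mem_support,
      W.connected_induce_support.preconnected _ _⟩

theorem sub_le_diam_induce [Finite S] (hQ : Q.length = G.dist x y) (hst : s ≤ t)
    (ht : t ≤ Q.length) (hS : (G.induce S).Connected) (hsS : Q.getVert s ∈ S)
    (htS : Q.getVert t ∈ S) : t - s ≤ (G.induce S).diam := by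
  have := hS.nonempty
  obtain ⟨W, hW⟩ := hS.exists_walk_length_eq_dist ⟨_, hsS⟩ ⟨_, htS⟩
  calc t - s ≤ (W.map (SimpleGraph.Embedding.induce S).toHom).length :=
        sub_le_length_of_length_eq_dist hQ hst ht _
    _ = (G.induce S).dist ⟨_, hsS⟩ ⟨_, htS⟩ := (W.length_map _).trans hW
    _ ≤ (G.induce S).diam :=
        SimpleGraph.dist_le_diam (SimpleGraph.connected_iff_ediam_ne_top.1 hS)

end SideDiameter

namespace PlanarMap

open RotationSystem

variable {V : Type*} {M : PlanarMap V} {a : V} {C : M.graph.Walk a a} {d d' : M.graph.Dart}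

theorem leftVertices_reverse : M.leftVertices C.reverse = M.rightVertices C := by
  simp only [leftVertices, rightVertices, leftFaces_reverse, SimpleGraph.Walk.support_reverse,
    List.mem_reverse]

variable [Finite V]

theorem exists_walk_of_leftFace_eq (h : M.leftFace d = M.leftFace d') :
    ∃ W : M.graph.Walk d.fst d'.fst, ∀ v ∈ W.support,
      ∃ g : M.graph.Dart, g.fst = v ∧ M.leftFace g = M.leftFace d := by
  obtain ⟨n, rfl⟩ := (M.leftFace_eq_iff.1 h).exists_nat_pow_eq
  clear h
  induction n with
  | zero => exact ⟨.nil, fun v hv => ⟨d, (List.mem_singleton.1 hv).symm, rfl⟩⟩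
  | succ n ih =>
    obtain ⟨W, hW⟩ := ih
    have hface : M.leftFace ((M.faceNext ^ (n + 1)) d) = M.leftFace d :=
      (M.leftFace_eq_iff.2 (Equiv.Perm.sameCycle_pow_left.2 (.refl _ _)))
    have hadj : M.graph.Adj ((M.faceNext ^ n) d).fst ((M.faceNext ^ (n + 1)) d).fst := by
      rw [pow_succ', Equiv.Perm.mul_apply, M.faceNext_fst]
      exact ((M.faceNext ^ n) d).adj
    refine ⟨W.concat hadj, fun v hv => ?_⟩
    rw [SimpleGraph.Walk.support_concat, List.mem_append, List.mem_singleton] at hv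
    rcases hv with hv | rfl
    · exact hW v hv
    · exact ⟨_, rfl, hface⟩

theorem exists_walk_of_leftFace_mem_leftFaces (hd : M.leftFace d ∈ M.leftFaces C) :
    ∃ W : M.graph.Walk a d.fst, ∀ v ∈ W.support, v ∈ M.leftVertices C := by
  classical
  have hextend : ∀ {g g' : M.graph.Dart}, M.leftFace g = M.leftFace g' →
      M.leftFace g' ∈ M.leftFaces C →
      (∃ W : M.graph.Walk a g.fst, ∀ v ∈ W.support, v ∈ M.leftVertices C) →
      ∃ W : M.graph.Walk a g'.fst, ∀ v ∈ W.support, v ∈ M.leftVertices C := by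
    rintro g g' hgg' hg' ⟨W, hW⟩
    obtain ⟨W', hW'⟩ := exists_walk_of_leftFace_eq hgg'
    refine ⟨W.append W', fun v hv => ?_⟩
    rcases (SimpleGraph.Walk.mem_support_append_iff _ _).1 hv with hv | hv
    · exact hW v hv
    · obtain ⟨p, rfl, hp⟩ := hW' v hv
      exact Or.inr ⟨p, rfl, by rwa [hp, hgg']⟩
  obtain ⟨c, hc, hreach⟩ := id hd
  generalize hf : M.leftFace d = f at hreach
  induction hreach generalizing d with
  | refl =>
    exact hextend hf.symm hd ⟨C.takeUntil _ (C.dart_fst_mem_support_of_mem_darts hc), fun v hv =>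
      Or.inl (C.support_takeUntil_subset_support _ hv)⟩
  | tail hreach hadj ih =>
    obtain ⟨p, -, rfl, rfl⟩ := hadj
    have hnext := M.leftFace_faceNext p
    refine hextend (g := p.symm) hf.symm hd ?_
    rw [show p.symm.fst = (M.faceNext p).fst from (M.faceNext_fst p).symm]
    exact ih (hnext.symm ▸ ⟨c, hc, hreach⟩) hnext

theorem connected_induce_leftVertices : (M.graph.induce (M.leftVertices C)).Connected := by
  classical
  refine connected_induce_of_forall_exists_walk (Or.inl C.start_mem_support) ?_
  rintro z (hz | ⟨d, rfl, hd⟩)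
  · exact ⟨C.takeUntil z hz, fun v hv => Or.inl (C.support_takeUntil_subset_support hz hv)⟩
  · exact exists_walk_of_leftFace_mem_leftFaces hd

theorem connected_induce_rightVertices : (M.graph.induce (M.rightVertices C)).Connected := by
  rw [← leftVertices_reverse]
  exact connected_induce_leftVertices

end PlanarMap

section FloorBounds

variable {w : ℤ}

theorem exists_floor_neg_div_three_eq (hw : w < -2) :
    ∃ m : ℕ, 1 ≤ m ∧ 3 * (m : ℤ) ≤ -w ∧ -w < 3 * m + 3 ∧ ⌊-(w : ℚ) / 3⌋ = m := by
  refine ⟨(-w / 3).toNat, by omega, by omega, by omega, ?_⟩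
  rw [show -(w : ℚ) / 3 = ((-w : ℤ) : ℚ) / (3 : ℕ) by push_cast; rfl, Rat.floor_intCast_div_natCast]
  push_cast; omega

theorem cast_le_six_mul_div (hw : w < -2) {ℓ L m n : ℕ} (hm : -w < 3 * m + 3)
    (hℓ : ℓ ≤ 2 * n + 2) (hL : m * n + 2 * m ≤ L) : (ℓ : ℚ) ≤ 6 * L / (-w - 2) := by
  have hw' : (0 : ℤ) < -w - 2 := by omega
  rw [le_div_iff₀ (by exact_mod_cast hw')]
  have hbound : (ℓ : ℤ) * (-w - 2) ≤ 6 * L := by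
    calc (ℓ : ℤ) * (-w - 2) ≤ (2 * n + 2) * (3 * m) := by
          gcongr <;> omega
      _ ≤ 6 * (m * n + 2 * m) := by nlinarith
      _ ≤ 6 * L := by exact_mod_cast Nat.mul_le_mul_left 6 hL
  exact_mod_cast hbound

end FloorBounds

namespace PlantedTriangulation

open RotationSystem PlanarMap

variable {V : Type*} {G : PlantedTriangulation V} {a : V} {C : G.graph.Walk a a}

theorem A_mem_leftVertices (h : G.rootFace ∈ G.leftFaces C) : G.A ∈ G.leftVertices C :=
  Or.inr ⟨G.faceNext G.root, G.faceNext_root_fst, by rwa [G.leftFace_faceNext_root]⟩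

theorem fst_mem_rightVertices {d : G.graph.Dart} (h : G.rightFace d ∈ G.rightFaces C) :
    d.fst ∈ G.rightVertices C :=
  Or.inr ⟨G.rot d, G.rot_fst d, by rwa [G.leftFace_rot]⟩

variable [Finite V] {T E : Set G.graph.Dart} {S : Set V}

theorem label_sub_label_le_labelSpan {x y : V} (hx : x ∈ S) (hy : y ∈ S) :
    G.label T E x - G.label T E y ≤ G.labelSpan T E S :=
  have hfin : (G.label T E '' S).Finite := Set.toFinite _
  sub_le_sub (le_csSup hfin.bddAbove (Set.mem_image_of_mem _ hx))
    (csInf_le hfin.bddBelow (Set.mem_image_of_mem _ hy))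

theorem IsLeftmost.sub_sub_two_le_labelSpan (hE : G.IsThreeOrientation E)
    (hT : G.IsBlossomingTree T E) {P : G.graph.Walk a G.A} (hP : G.IsLeftmost E P) {i j : ℕ}
    (hij : i ≤ j) (hj : j ≤ P.length) (hiS : P.getVert i ∈ S) (hjS : P.getVert j ∈ S) :
    (j : ℤ) - i - 2 ≤ G.labelSpan T E S :=
  (hP.sub_sub_two_le_label_sub hE hT hij hj).trans (label_sub_label_le_labelSpan hiS hjS)

variable {e : G.graph.Dart} {P Q : G.graph.Walk e.fst G.A}

theorem IsLeftmostPath.exists_short_separating_cycle (hE : G.IsMinimalThreeOrientation E)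
    (he : e ∈ E) (hP : G.IsLeftmostPath E e P) (hQ : Q.length = G.graph.dist e.fst G.A) {m : ℕ}
    (hm : 1 ≤ m) (hw : 3 * (m : ℤ) ≤ -G.windingNumber P Q) :
    ∃ (a : V) (C : G.graph.Walk a a) (s t i j n : ℕ), C.IsCycle ∧
      G.rootFace ∈ G.leftFaces C ∧ G.rightFace e ∈ G.rightFaces C ∧
      (Q.getVert s ∈ C.support ∧ s + m ≤ Q.length) ∧
      (Q.getVert t ∈ C.support ∧ t ≤ Q.length ∧ m ≤ t) ∧
      (P.getVert i ∈ C.support ∧ i + m + 2 ≤ P.length) ∧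
      (P.getVert j ∈ C.support ∧ j ≤ P.length ∧ m + 2 ≤ j) ∧
      C.length ≤ 2 * n + 2 ∧ m * n + 2 * m ≤ Q.length := by
  obtain ⟨s, t, i, j, hx, hij, hC, hroot, hright, hlen, hms, hmt⟩ :=
    hP.exists_short_cycle hE he hQ hm hw
  have hL := hP.isLeftmost he
  have hupper := hL.sub_le_add_two hE.toIsThreeOrientation (hL.isPath hE) hx hij hC hroot
  have hlower := hx.length_le_of_le hQ hij.le
  have hthree := hC.three_le_length
  have hsi := le_of_getVert_eq hQ (hx.lt.le.trans hx.le_length) hx.left_le hx.left_eq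
  have htj := sub_le_of_getVert_eq hQ hx.le_length hx.right_eq
  have hmem : ∀ k, i ≤ k → k ≤ j → P.getVert k ∈ (hx.forwardCycle hij.le).support :=
    fun k hik hkj => (hx.mem_support_forwardCycle hij.le).2 (Or.inr ⟨k, hik, hkj, rfl⟩)
  have hi := hmem i le_rfl hij.le
  have hj := hmem j hij.le le_rfl
  have hjP := hx.right_le
  rw [hx.length_forwardCycle] at hthree
  exact ⟨_, _, s, t, i, j, t - s, hC, hroot, hright, ⟨by rwa [hx.left_eq], by omega⟩,
    ⟨by rwa [hx.right_eq], hx.le_length, by omega⟩, ⟨hi, by omega⟩, ⟨hj, hjP, by omega⟩,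
    by rw [hx.length_forwardCycle]; omega, hlen⟩

end PlantedTriangulation

theorem mainTheorem9 {V : Type*} [Finite V] (G : PlantedTriangulation V)
    (E : Set G.graph.Dart) (hE : G.IsMinimalThreeOrientation E)
    (T : Set G.graph.Dart) (hT : G.IsBlossomingTree T E)
    (e : G.graph.Dart) (he : e ∈ E)
    (P : G.graph.Walk e.fst G.A) (hP : G.IsLeftmostPath E e P)
    (Q : G.graph.Walk e.fst G.A) (hQ : Q.length = G.graph.dist e.fst G.A)
    (hw : G.windingNumber P Q < -2) :
    ∃ (a : V) (C : G.graph.Walk a a), C.IsCycle ∧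
      (C.length : ℚ) ≤ 6 * ((Q.support.length : ℚ) - 1) / (-(G.windingNumber P Q : ℚ) - 2) ∧
      ⌊-(G.windingNumber P Q : ℚ) / 3⌋ - 2 ≤ ((G.graph.induce (G.leftVertices C)).diam : ℤ) ∧
      ⌊-(G.windingNumber P Q : ℚ) / 3⌋ - 2 ≤ ((G.graph.induce (G.rightVertices C)).diam : ℤ) ∧
      ⌊-(G.windingNumber P Q : ℚ) / 3⌋ ≤ G.labelSpan T E (G.leftVertices C) ∧
      ⌊-(G.windingNumber P Q : ℚ) / 3⌋ ≤ G.labelSpan T E (G.rightVertices C) := by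
  obtain ⟨m, hm, h3m, hm3, hfloor⟩ := exists_floor_neg_div_three_eq hw
  obtain ⟨a, C, s, t, i, j, n, hC, hroot, hright, ⟨hsC, hs⟩, ⟨htC, htQ, ht⟩, ⟨hiC, hi⟩,
    ⟨hjC, hjP, hj⟩, hlength, hn⟩ := hP.exists_short_separating_cycle hE he hQ hm h3m
  have hA : G.A ∈ G.leftVertices C := PlantedTriangulation.A_mem_leftVertices hroot
  have hu : e.fst ∈ G.rightVertices C := PlantedTriangulation.fst_mem_rightVertices hright
  have hdiamLeft := sub_le_diam_induce hQ (by omega) le_rfl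
    PlanarMap.connected_induce_leftVertices (Or.inl hsC) (by rwa [Q.getVert_length])
  have hdiamRight := sub_le_diam_induce hQ (Nat.zero_le t) htQ
    PlanarMap.connected_induce_rightVertices (by rwa [Q.getVert_zero]) (Or.inl htC)
  have hL := hP.isLeftmost he
  have hspanLeft := hL.sub_sub_two_le_labelSpan hE.toIsThreeOrientation hT (i := i) (by omega)
    le_rfl (Or.inl hiC) (by rwa [P.getVert_length])
  have hspanRight := hL.sub_sub_two_le_labelSpan hE.toIsThreeOrientation hT (Nat.zero_le j) hjP
    (by rwa [P.getVert_zero]) (Or.inl hjC)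
  rw [hfloor, Q.length_support]
  push_cast
  rw [add_sub_cancel_right]
  exact ⟨a, C, hC, cast_le_six_mul_div hw hm3 hlength hn, by omega, by omega, by omega, by omega⟩
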